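/- A planar map is a connected finite multigraph (loops and multiple edges allowed) drawn on the 2-sphere without crossing edges, considered up to orientation-preserving homeomorphism; it is rooted if an oriented edge (the root edge) is distinguished; it is a planar triangulation if all its faces have degree three. A hierarchical triangulation is a planar triangulation that can be obtained from the loopless triangulation with two triangles (sharing their three edges) by repeatedly zipping open an edge and inserting in the resulting 2-gon a pair of triangles that are glued to each other along two of their sides. For $n\ge 1$ let $\mathcal{H}_n$ be the set of rooted hierarchical triangulations with $n+1$ vertices and a distinguished spanning tree, such that the spanning tree contains the root edge and contains no edge that belongs to a cycle of length two. Then every $\mathcal{H}_n$ is finite, $\mathcal{H}_1=\emptyset$, and the generating function $H(z)=\sum_{n\ge 1}|\mathcal{H}_n|\,z^{n-1}$ (a formal power series; the exponent of $z$ is the number of vertices minus two) is $$H(z)=\frac{1-\sqrt{1-12z}}{3}=2z+6z^2+36z^3+\cdots,$$ where $\sqrt{1-12z}$ is the formal power series with constant term $1$ whose square is $1-12z$. Explicitly, for all $n\ge 2$, $$|\mathcal{H}_n|=2\cdot 3^{n-2}\operatorname{Cat}(n-2),\qquad \operatorname{Cat}(m)=\frac{1}{m+1}\binom{2m}{m},$$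 and, as $n\to\infty$, $$|\mathcal{H}_n|\sim \frac{1}{72\sqrt{\pi}}\,\frac{12^n}{n^{3/2}}.$$ -/

import Mathlib

open Filter Asymptotics

/-- A finite combinatorial map: a finite set of darts (the oriented edges), the orientation reversal
`rev` of an oriented edge, and the permutation `face` sending an oriented edge to the next one along
the face on its right. -/
structure CombMap where
  Dart : Type
  finite_dart : Finite Dart
  rev : Equiv.Perm Dart
  face : Equiv.Perm Dart
  rev_rev : ∀ d, rev (rev d) = d
  rev_ne : ∀ d, rev d ≠ d

/-- The number of orbits (cycles, including fixed points) of a permutation. -/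
noncomputable def numOrbits {α : Type} (p : Equiv.Perm α) : ℕ :=
  Nat.card (Quotient (Equiv.Perm.SameCycle.setoid p))

namespace CombMap

/-- The permutation turning around the vertices: `face (rev d)` is an oriented edge with the same
origin as `d`. -/
def vert (M : CombMap) : Equiv.Perm M.Dart := M.face * M.rev

/-- The vertices are the orbits of the permutation `vert`. -/
def Vertex (M : CombMap) : Type := Quotient (Equiv.Perm.SameCycle.setoid M.vert)

/-- The vertex from which an oriented edge starts. -/
def origin (M : CombMap) (d : M.Dart) : M.Vertex :=
  Quotient.mk (Equiv.Perm.SameCycle.setoid M.vert) d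

/-- The unordered pair of endpoints of the edge underlying an oriented edge. -/
def ends (M : CombMap) (d : M.Dart) : Sym2 M.Vertex :=
  s(M.origin d, M.origin (M.rev d))

noncomputable def numVertices (M : CombMap) : ℕ := numOrbits M.vert

noncomputable def numEdges (M : CombMap) : ℕ := numOrbits M.rev

noncomputable def numFaces (M : CombMap) : ℕ := numOrbits M.face

def IsConnected (M : CombMap) : Prop :=
  ∀ d d' : M.Dart, Relation.ReflTransGen (fun x y => y = M.rev x ∨ y = M.face x) d d'

/-- Planar maps: the connected combinatorial maps of Euler characteristic `2`. -/
def IsPlanar (M : CombMap) : Prop :=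
  M.IsConnected ∧ M.numVertices + M.numFaces = M.numEdges + 2

/-- All faces have degree three, the degree of a face being the size of its orbit. -/
def IsTriangulation (M : CombMap) : Prop :=
  ∀ d : M.Dart, Function.minimalPeriod M.face d = 3

/-- The oriented edge `d` belongs to a cycle of length two: its endpoints are distinct and some other
edge has the same endpoints. -/
def InTwoCycle (M : CombMap) (d : M.Dart) : Prop :=
  M.origin d ≠ M.origin (M.rev d) ∧ ∃ d', d' ≠ d ∧ d' ≠ M.rev d ∧ M.ends d' = M.ends d

/-- A set of edges, given as a set `T` of oriented edges closed under reversal, is a spanning tree: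
it has no loops, no two different edges with the same endpoints, and the simple graph it forms
on the set of all vertices is a tree. -/
def IsSpanningTree (M : CombMap) (T : Set M.Dart) : Prop :=
  (∀ d ∈ T, M.rev d ∈ T) ∧
  (∀ d ∈ T, M.origin d ≠ M.origin (M.rev d)) ∧
  (∀ d ∈ T, ∀ d' ∈ T, M.ends d = M.ends d' → d' = d ∨ d' = M.rev d) ∧
  (SimpleGraph.fromEdgeSet (M.ends '' T)).IsTree

/-- Isomorphism of (unrooted) combinatorial maps, i.e. orientation-preserving homeomorphism of the
corresponding maps on surfaces. -/
def Iso (M N : CombMap) : Prop :=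
  ∃ f : M.Dart ≃ N.Dart, (∀ d, f (M.rev d) = N.rev (f d)) ∧ (∀ d, f (M.face d) = N.face (f d))

/-- The sides of two triangles: `(false, i)` and `(true, i)` with `i ∈ ℤ/3`. This permutation exchanges
the sides `(false, i)` and `(true, i)`. -/
def pairRev : Equiv.Perm (Bool × ZMod 3) where
  toFun := fun d => (!d.1, d.2)
  invFun := fun d => (!d.1, d.2)
  left_inv := fun d => by simp
  right_inv := fun d => by simp

/-- The sides of the triangle `false` are run through in increasing order, those of the triangle `true`
in decreasing order. -/
def pairFace : Equiv.Perm (Bool × ZMod 3) where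
  toFun := fun d => (d.1, if d.1 then d.2 - 1 else d.2 + 1)
  invFun := fun d => (d.1, if d.1 then d.2 + 1 else d.2 - 1)
  left_inv := fun d => by rcases d with ⟨b, i⟩; cases b <;> simp
  right_inv := fun d => by rcases d with ⟨b, i⟩; cases b <;> simp

/-- The loopless triangulation with two triangles, which share three edges: two triangles, run through
in opposite directions, with the side `(false, i)` glued to `(true, i)` for each `i`. -/
def twoTriangles : CombMap where
  Dart := Bool × ZMod 3
  finite_dart := inferInstance
  rev := pairRev
  face := pairFace
  rev_rev := by decide
  rev_ne := by decide

open Classical in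
/-- Zip open the edge `{d, rev d}` of `M` and insert a pair of triangles glued to each other along two
of their sides. The two new triangles are those of `twoTriangles`, and stay glued along the sides
numbered `1` and `2`. The third side `(false, 0)` of the first one is glued to `d`, and the third side
`(true, 0)` of the second one to `rev d`: conjugating the old gluing by the transposition of `rev d`
and `(false, 0)` has precisely this effect. All other gluings, and the old faces, are unchanged. -/
noncomputable def insertPair (M : CombMap) (d : M.Dart) : CombMap where
  Dart := M.Dart ⊕ (Bool × ZMod 3)
  finite_dart := by
    have := M.finite_dart
    infer_instance
  rev :=
    Equiv.swap (Sum.inl (M.rev d)) (Sum.inr (false, 0)) *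
      Equiv.Perm.sumCongr M.rev pairRev *
      Equiv.swap (Sum.inl (M.rev d)) (Sum.inr (false, 0))
  face := Equiv.Perm.sumCongr M.face pairFace
  rev_rev := fun x => by
    have h : ∀ y, Equiv.Perm.sumCongr M.rev pairRev
        (Equiv.Perm.sumCongr M.rev pairRev y) = y := by
      rintro (y | y)
      · simp [M.rev_rev]
      · exact congrArg Sum.inr (twoTriangles.rev_rev y)
    simp only [Equiv.Perm.mul_apply, Equiv.swap_apply_self, h]
  rev_ne := fun x hx => by
    have h : ∀ y, Equiv.Perm.sumCongr M.rev pairRev y ≠ y := by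
      rintro (y | y) hy
      · exact M.rev_ne y (Sum.inl_injective hy)
      · exact twoTriangles.rev_ne y (Sum.inr_injective hy)
    simp only [Equiv.Perm.mul_apply] at hx
    refine h (Equiv.swap (Sum.inl (M.rev d)) (Sum.inr (false, 0)) x)
      ((Equiv.swap (Sum.inl (M.rev d)) (Sum.inr (false, 0))).injective ?_)
    rw [Equiv.swap_apply_self]
    exact hx

/-- Hierarchical triangulations: those obtained from the loopless triangulation with two triangles by
repeatedly zipping open an edge and inserting a pair of triangles glued along two of their sides. -/
inductive IsHierarchical : CombMap → Prop
  | base (M : CombMap) (h : twoTriangles.Iso M) : IsHierarchical M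
  | insertPair (M : CombMap) (hM : IsHierarchical M) (d : M.Dart)
      (N : CombMap) (h : (M.insertPair d).Iso N) : IsHierarchical N

end CombMap

/-- Planar triangulations with a root (an oriented edge) and a distinguished spanning tree that
contains the root edge. -/
structure TreeDecorated where
  map : CombMap
  planar : map.IsPlanar
  triangulation : map.IsTriangulation
  root : map.Dart
  tree : Set map.Dart
  spanning : map.IsSpanningTree tree
  root_mem : root ∈ tree

namespace TreeDecorated

/-- Isomorphism of rooted tree-decorated triangulations: an isomorphism of maps that
preserves the root and the spanning tree. -/
def Iso (s t : TreeDecorated) : Prop :=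
  ∃ f : s.map.Dart ≃ t.map.Dart,
    (∀ d, f (s.map.rev d) = t.map.rev (f d)) ∧ (∀ d, f (s.map.face d) = t.map.face (f d)) ∧
    f s.root = t.root ∧ ∀ d, f d ∈ t.tree ↔ d ∈ s.tree

instance isoSetoid : Setoid TreeDecorated where
  r := Iso
  iseqv :=
    { refl := fun s => ⟨Equiv.refl _, fun _ => rfl, fun _ => rfl, rfl, fun _ => Iff.rfl⟩
      symm := by
        rintro s t ⟨f, h1, h2, h3, h4⟩
        refine ⟨f.symm, fun d => ?_, fun d => ?_, ?_, fun d => ?_⟩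
        · apply f.injective; simp [h1]
        · apply f.injective; simp [h2]
        · apply f.injective; simp [h3]
        · rw [← h4]; simp
      trans := by
        rintro s t u ⟨f, h1, h2, h3, h4⟩ ⟨g, k1, k2, k3, k4⟩
        refine ⟨f.trans g, fun d => ?_, fun d => ?_, ?_, fun d => ?_⟩
        · simp [h1, k1]
        · simp [h2, k2]
        · simp [h3, k3]
        · simp [h4, k4] }

end TreeDecorated

/-- The set of (isomorphism classes of) rooted tree-decorated hierarchical triangulations with `n + 1`
vertices whose spanning tree contains no edge belonging to a cycle of length two. -/
def hierarchicalFamily (n : ℕ) : Set (Quotient TreeDecorated.isoSetoid) :=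
  {q | ∃ t : TreeDecorated, Quotient.mk TreeDecorated.isoSetoid t = q ∧
    t.map.numVertices = n + 1 ∧ t.map.IsHierarchical ∧ ∀ d ∈ t.tree, ¬ t.map.InTwoCycle d}

/-- The generating function `∑ |𝓗ₙ| z ^ (n - 1)` (sum over `n ≥ 1`): the exponent of `z` is the number of
vertices minus two. -/
noncomputable def hierarchicalSeries : PowerSeries ℝ :=
  PowerSeries.mk fun k => ((hierarchicalFamily (k + 1)).ncard : ℝ)

/-! The proof decomposes a triangulation along its pairs of parallel edges. A region bounded by a
2-gon is either a single edge, or is obtained from a region `A` by laying a new edge along one outer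
side of `A` and filling the gap with a pair of triangles, the two common sides of the pair being
thickened into regions `B` and `C` that meet at a new vertex, the apex. Regions are thus coded by
ternary trees, and maps on the sphere by three ternary trees glued into the sides of two triangles.
Every rooted hierarchical triangulation has such a code (`Tern.coded_of_isHierarchical`), and every
code gives a planar hierarchical triangulation. The tree contains the root edge and avoids edges
with a parallel, so the region at the root is a single edge (`Tern.eq_leaf_of_root_isolated`), and
then the two other ternary trees are determined by the rooted map (`Tern.eq_of_closed_leaf_iso`).

Vertices are treated through labellings: functions on darts that are constant around each vertex. A
labelling of a node is a triple of labellings of its three parts that agree at the two ends and the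
apex. All facts on vertices (their number, parallel edges, absence of loops, connectedness) follow
by exhibiting or counting labellings.

A spanning tree of the whole map meets a region either in a spanning tree of the region or in a
two-component forest separating its ends. By `Tern.state_iff` these possibilities satisfy a
recursion along the ternary tree. An edge has a parallel unless it is a single edge in a slot `B` or
`C`, or in one of the three slots of the closed map.

Let `D` count forests and `K` trees in regions, by the size of the ternary tree. A single edge in
the slot `A` may not be used, so trees in that slot are counted by `K - 1`. Attaching the apex
through exactly one of `B`, `C` contributes `H = 2 X K D`, which is also the series to be found. The
recursion reads `D = 1 + H D` and `K = 1 + H (K - 1) + X D K ^ 2`. Eliminating `D` and `K` gives `2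
H - 3 H ^ 2 = 4 X` (`Tern.two_mul_hierarchicalSeries`). This has a unique solution without constant
term, a rescaled Catalan series; the asymptotics are Stirling's. -/

/-! ### Gluing of dart sets -/

/-- The disjoint union of the darts of three regions and of some additional darts. -/
inductive Glue (A B C Z : Type) : Type
  | inA (d : A) : Glue A B C Z
  | inB (d : B) : Glue A B C Z
  | inC (d : C) : Glue A B C Z
  | nw (z : Z) : Glue A B C Z

namespace Glue

variable {A B C Z A' B' C' Z' : Type}

def equivSum : Glue A B C Z ≃ (A ⊕ B) ⊕ (C ⊕ Z) where
  toFun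
    | inA d => .inl (.inl d)
    | inB d => .inl (.inr d)
    | inC d => .inr (.inl d)
    | nw d => .inr (.inr d)
  invFun
    | .inl (.inl d) => inA d
    | .inl (.inr d) => inB d
    | .inr (.inl d) => inC d
    | .inr (.inr d) => nw d
  left_inv d := by cases d <;> rfl
  right_inv d := by rcases d with (d | d) | (d | d) <;> rfl

instance [Finite A] [Finite B] [Finite C] [Finite Z] : Finite (Glue A B C Z) :=
  Finite.of_equiv _ equivSum.symm

def elim {X : Type*} (f : A → X) (g : B → X) (h : C → X) (k : Z → X) : Glue A B C Z → X
  | inA d => f d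
  | inB d => g d
  | inC d => h d
  | nw d => k d

def map (f : A → A') (g : B → B') (h : C → C') (k : Z → Z') : Glue A B C Z → Glue A' B' C' Z' :=
  elim (fun d => inA (f d)) (fun d => inB (g d)) (fun d => inC (h d)) (fun d => nw (k d))

def congr (f : A ≃ A') (g : B ≃ B') (h : C ≃ C') (k : Z ≃ Z') :
    Glue A B C Z ≃ Glue A' B' C' Z' where
  toFun := map f g h k
  invFun := map f.symm g.symm h.symm k.symm
  left_inv d := by cases d <;> simp [map, elim]
  right_inv d := by cases d <;> simp [map, elim]

section
variable (f : A ≃ A') (g : B ≃ B') (h : C ≃ C') (k : Z ≃ Z')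
@[simp] theorem congr_inA (d : A) : congr f g h k (inA d) = inA (f d) := rfl
@[simp] theorem congr_inB (d : B) : congr f g h k (inB d) = inB (g d) := rfl
@[simp] theorem congr_inC (d : C) : congr f g h k (inC d) = inC (h d) := rfl
@[simp] theorem congr_nw (d : Z) : congr f g h k (nw d) = nw (k d) := rfl
end

section
variable (f : A → A') (g : B → B') (h : C → C') (k : Z → Z')
@[simp] theorem map_inA (d : A) : map f g h k (inA d) = inA (f d) := rfl
@[simp] theorem map_inB (d : B) : map f g h k (inB d) = inB (g d) := rfl
@[simp] theorem map_inC (d : C) : map f g h k (inC d) = inC (h d) := rfl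
@[simp] theorem map_nw (d : Z) : map f g h k (nw d) = nw (k d) := rfl
end

section
variable {X : Type*} (f : A → X) (g : B → X) (h : C → X) (k : Z → X)
@[simp] theorem elim_inA (d : A) : elim f g h k (inA d) = f d := rfl
@[simp] theorem elim_inB (d : B) : elim f g h k (inB d) = g d := rfl
@[simp] theorem elim_inC (d : C) : elim f g h k (inC d) = h d := rfl
@[simp] theorem elim_nw (d : Z) : elim f g h k (nw d) = k d := rfl
end

end Glue

/-! ### Regions and their gluing along two triangles -/

/-- A region bounded by a `2`-gon: a combinatorial map with two outer darts, fixed by `face`. -/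
structure Region extends CombMap where
  u : Dart
  w : Dart
  u_ne_w : u ≠ w
  face_u : face u = u
  face_w : face w = w

namespace Region

open Glue Equiv

attribute [simp] face_u face_w

/-- The cyclic permutation `x ↦ y ↦ z ↦ x`. -/
noncomputable def cyc3 {X : Type} (x y z : X) : Perm X := by
  classical exact swap x y * swap y z

section Cyc3
variable {X : Type} {x y z : X}

theorem cyc3_fst (h : x ≠ y) (h' : x ≠ z) : cyc3 x y z x = y := by
  classical simp [cyc3, swap_apply_of_ne_of_ne h h']

theorem cyc3_snd (h : x ≠ z) (h' : y ≠ z) : cyc3 x y z y = z := by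
  classical simp [cyc3, swap_apply_of_ne_of_ne h.symm h'.symm]

theorem cyc3_trd : cyc3 x y z z = x := by
  simp [cyc3]

theorem cyc3_of_ne {t : X} (h : t ≠ x) (h' : t ≠ y) (h'' : t ≠ z) : cyc3 x y z t = t := by
  simp [cyc3, swap_apply_of_ne_of_ne, *]

end Cyc3

/-- Positions for the distinguished dart of the second new triangle of a glued map. -/
def Free (A B C : Region) {Z : Type} (y : Glue A.Dart B.Dart C.Dart Z) : Prop :=
  y = inA A.u ∨ ∃ z, y = nw z

theorem free_u (A B C : Region) {Z : Type} : Free A B C (inA A.u : Glue A.Dart B.Dart C.Dart Z) :=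
  Or.inl rfl

theorem free_nw (A B C : Region) {Z : Type} (z : Z) :
    Free A B C (nw z : Glue A.Dart B.Dart C.Dart Z) :=
  Or.inr ⟨z, rfl⟩

/-- Three regions glued into the sides of two triangles. -/
@[reducible]
noncomputable def glueMap (A B C : Region) (Z : Type) [Finite Z] (ρ : Perm Z) (h : ∀ z, ρ (ρ z) = z)
    (h' : ∀ z, ρ z ≠ z) (y : Glue A.Dart B.Dart C.Dart Z) : CombMap where
  Dart := Glue A.Dart B.Dart C.Dart Z
  finite_dart := by
    have := A.finite_dart
    have := B.finite_dart
    have := C.finite_dart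
    infer_instance
  rev := Glue.congr A.rev B.rev C.rev ρ
  -- Outer darts are fixed by the face permutations of the regions. Composing with two disjoint
  -- 3-cycles turns them into the sides of two triangles; `y` is the last side of the second one,
  -- namely `nw true` for a region and `inA A.u` for a map on the sphere.
  face := Glue.congr A.face B.face C.face 1 *
    (cyc3 (inA A.w) (inB B.u) (inC C.u) * cyc3 y (inC C.w) (inB B.w))
  rev_rev d := by cases d <;> simp [CombMap.rev_rev, h]
  rev_ne d := by cases d <;> simp [CombMap.rev_ne, h']

section GlueMap
variable (A B C : Region) {Z : Type} [Finite Z] (ρ : Perm Z) (h : ∀ z, ρ (ρ z) = z)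
  (h' : ∀ z, ρ z ≠ z) {y : Glue A.Dart B.Dart C.Dart Z} (hy : Free A B C y)

local notation "G" => glueMap A B C Z ρ h h' y

theorem glueMap_face (d : (G).Dart) : (G).face d = Glue.congr A.face B.face C.face 1
    (cyc3 (inA A.w) (inB B.u) (inC C.u) (cyc3 y (inC C.w) (inB B.w) d)) := rfl

theorem glueMap_face_inA {d : A.Dart} (h1 : d ≠ A.w) (h2 : inA d ≠ y) :
    (G).face (inA d) = (inA (A.face d) : (G).Dart) := by
  rw [glueMap_face, cyc3_of_ne (x := y), cyc3_of_ne] <;> simp [*]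

theorem glueMap_face_nw {z : Z} (h1 : nw z ≠ y) :
    (G).face (nw z) = (nw z : (G).Dart) := by
  rw [glueMap_face, cyc3_of_ne (x := y), cyc3_of_ne] <;> simp [*]

include hy

theorem glueMap_face_y : (G).face y = (inC C.w : (G).Dart) := by
  have := C.u_ne_w
  rw [glueMap_face, cyc3_fst, cyc3_of_ne] <;> rcases hy with rfl | ⟨z, rfl⟩ <;> simp [*, Ne.symm]

theorem glueMap_face_wA : (G).face (inA A.w) = (inB B.u : (G).Dart) := by
  have := A.u_ne_w
  rw [glueMap_face, cyc3_of_ne (x := y), cyc3_fst] <;> rcases hy with rfl | ⟨z, rfl⟩ <;> simp [*, Ne.symm]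

theorem glueMap_face_uB : (G).face (inB B.u) = (inC C.u : (G).Dart) := by
  have := B.u_ne_w
  rw [glueMap_face, cyc3_of_ne (x := y), cyc3_snd] <;> rcases hy with rfl | ⟨z, rfl⟩ <;> simp [*, Ne.symm]

theorem glueMap_face_uC : (G).face (inC C.u) = (inA A.w : (G).Dart) := by
  have := C.u_ne_w
  rw [glueMap_face, cyc3_of_ne (x := y), cyc3_trd] <;> rcases hy with rfl | ⟨z, rfl⟩ <;> simp [*, Ne.symm]

theorem glueMap_face_wC : (G).face (inC C.w) = (inB B.w : (G).Dart) := by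
  have := B.u_ne_w
  rw [glueMap_face, cyc3_snd, cyc3_of_ne] <;> rcases hy with rfl | ⟨z, rfl⟩ <;> simp [*, Ne.symm]

theorem glueMap_face_wB : (G).face (inB B.w) = (y : (G).Dart) := by
  have := A.u_ne_w
  rw [glueMap_face, cyc3_trd, cyc3_of_ne] <;> rcases hy with rfl | ⟨z, rfl⟩ <;> simp [*, Ne.symm]

theorem glueMap_face_inB {d : B.Dart} (h1 : d ≠ B.u) (h2 : d ≠ B.w) :
    (G).face (inB d) = (inB (B.face d) : (G).Dart) := by
  rw [glueMap_face, cyc3_of_ne (x := y), cyc3_of_ne] <;> rcases hy with rfl | ⟨z, rfl⟩ <;> simp [*]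

theorem glueMap_face_inC {d : C.Dart} (h1 : d ≠ C.u) (h2 : d ≠ C.w) :
    (G).face (inC d) = (inC (C.face d) : (G).Dart) := by
  rw [glueMap_face, cyc3_of_ne (x := y), cyc3_of_ne] <;> rcases hy with rfl | ⟨z, rfl⟩ <;> simp [*]

end GlueMap

/-- The region consisting of a single edge. -/
@[reducible]
def single : Region where
  Dart := Bool
  finite_dart := inferInstance
  rev := ⟨not, not, Bool.not_not, Bool.not_not⟩
  face := 1
  rev_rev := by decide
  rev_ne := by decide
  u := false
  w := true
  u_ne_w := by decide
  face_u := rfl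
  face_w := rfl

/-- The region obtained from `A` by adding, along its outer dart `w`, two triangles whose other
sides are filled by `B` and `C`. -/
@[reducible]
noncomputable def node (A B C : Region) : Region where
  toCombMap := glueMap A B C Bool ⟨not, not, Bool.not_not, Bool.not_not⟩ (by decide) (by decide)
    (nw true)
  u := inA A.u
  w := nw false
  u_ne_w := by simp
  face_u := by
    rw [glueMap_face_inA _ _ _ _ _ _ A.u_ne_w (by simp), A.face_u]
  face_w := glueMap_face_nw _ _ _ _ _ _ (by simp)

/-- The map on the sphere consisting of two triangles, whose sides are glued along the regions
`A`, `B`, `C`. -/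
@[reducible]
noncomputable def close (A B C : Region) : CombMap :=
  glueMap A B C Empty 1 (fun _ => rfl) (fun z => z.elim) (inA A.u)

/-- The root of `close A B C`. -/
def closeRoot (A B C : Region) : (close A B C).Dart := (inA A.u : Glue _ _ _ _)

section Node
variable (A B C : Region)

theorem node_face_nw : (node A B C).face (nw true) = (inC C.w : Glue _ _ _ _) :=
  glueMap_face_y _ _ _ _ (by decide) (by decide) (free_nw A B C true)

theorem node_face_wA : (node A B C).face (inA A.w) = (inB B.u : Glue _ _ _ _) :=
  glueMap_face_wA _ _ _ _ (by decide) (by decide) (free_nw A B C true)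

theorem node_face_uB : (node A B C).face (inB B.u) = (inC C.u : Glue _ _ _ _) :=
  glueMap_face_uB _ _ _ _ (by decide) (by decide) (free_nw A B C true)

theorem node_face_uC : (node A B C).face (inC C.u) = (inA A.w : Glue _ _ _ _) :=
  glueMap_face_uC _ _ _ _ (by decide) (by decide) (free_nw A B C true)

theorem node_face_wC : (node A B C).face (inC C.w) = (inB B.w : Glue _ _ _ _) :=
  glueMap_face_wC _ _ _ _ (by decide) (by decide) (free_nw A B C true)

theorem node_face_wB : (node A B C).face (inB B.w) = (nw true : Glue _ _ _ _) :=
  glueMap_face_wB _ _ _ _ (by decide) (by decide) (free_nw A B C true)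

theorem node_face_inA {d : A.Dart} (h' : d ≠ A.w) : (node A B C).face (inA d) = (inA (A.face d) : Glue _ _ _ _) :=
  glueMap_face_inA _ _ _ _ (by decide) (by decide) h' (by simp)

theorem node_face_inB {d : B.Dart} (h : d ≠ B.u) (h' : d ≠ B.w) : (node A B C).face (inB d) = (inB (B.face d) : Glue _ _ _ _) :=
  glueMap_face_inB _ _ _ _ (by decide) (by decide) (free_nw A B C true) h h'

theorem node_face_inC {d : C.Dart} (h : d ≠ C.u) (h' : d ≠ C.w) : (node A B C).face (inC d) = (inC (C.face d) : Glue _ _ _ _) :=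
  glueMap_face_inC _ _ _ _ (by decide) (by decide) (free_nw A B C true) h h'

theorem node_face_w : (node A B C).face (nw false) = (nw false : Glue _ _ _ _) :=
  (node A B C).face_w

end Node

section Close
variable (A B C : Region)

theorem close_face_uA : (close A B C).face (inA A.u) = (inC C.w : Glue _ _ _ _) :=
  glueMap_face_y _ _ _ _ _ _ (free_u A B C)

theorem close_face_wA : (close A B C).face (inA A.w) = (inB B.u : Glue _ _ _ _) :=
  glueMap_face_wA _ _ _ _ _ _ (free_u A B C)

theorem close_face_uB : (close A B C).face (inB B.u) = (inC C.u : Glue _ _ _ _) :=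
  glueMap_face_uB _ _ _ _ _ _ (free_u A B C)

theorem close_face_uC : (close A B C).face (inC C.u) = (inA A.w : Glue _ _ _ _) :=
  glueMap_face_uC _ _ _ _ _ _ (free_u A B C)

theorem close_face_wC : (close A B C).face (inC C.w) = (inB B.w : Glue _ _ _ _) :=
  glueMap_face_wC _ _ _ _ _ _ (free_u A B C)

theorem close_face_wB : (close A B C).face (inB B.w) = (inA A.u : Glue _ _ _ _) :=
  glueMap_face_wB _ _ _ _ _ _ (free_u A B C)

theorem close_face_inA {d : A.Dart} (h : d ≠ A.u) (h' : d ≠ A.w) : (close A B C).face (inA d) = (inA (A.face d) : Glue _ _ _ _) :=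
  glueMap_face_inA _ _ _ _ _ _ h' (by simpa using h)

theorem close_face_inB {d : B.Dart} (h : d ≠ B.u) (h' : d ≠ B.w) : (close A B C).face (inB d) = (inB (B.face d) : Glue _ _ _ _) :=
  glueMap_face_inB _ _ _ _ _ _ (free_u A B C) h h'

theorem close_face_inC {d : C.Dart} (h : d ≠ C.u) (h' : d ≠ C.w) : (close A B C).face (inC d) = (inC (C.face d) : Glue _ _ _ _) :=
  glueMap_face_inC _ _ _ _ _ _ (free_u A B C) h h'

end Close

end Region

/-! ### Ternary trees as codes of regions -/

/-- Ternary trees. -/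
inductive Tern : Type
  | leaf : Tern
  | node (a b c : Tern) : Tern

namespace Tern

/-- The number of nodes of a ternary tree. -/
def size : Tern → ℕ
  | leaf => 0
  | node a b c => size a + size b + size c + 1

/-- The region coded by a ternary tree. -/
noncomputable def reg : Tern → Region
  | leaf => Region.single
  | node a b c => Region.node a.reg b.reg c.reg

end Tern

/-! ### Isomorphisms and insertion of a pair of triangles -/

namespace CombMap

/-- A bijection between the darts of two combinatorial maps that is an isomorphism. -/
def IsIso {M N : CombMap} (f : M.Dart ≃ N.Dart) : Prop :=
  (∀ d, f (M.rev d) = N.rev (f d)) ∧ ∀ d, f (M.face d) = N.face (f d)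

theorem IsIso.symm {M N : CombMap} {f : M.Dart ≃ N.Dart} (h : IsIso f) : IsIso f.symm :=
  ⟨fun d => by rw [Equiv.symm_apply_eq, h.1, f.apply_symm_apply],
    fun d => by rw [Equiv.symm_apply_eq, h.2, f.apply_symm_apply]⟩

theorem IsIso.trans {M N K : CombMap} {f : M.Dart ≃ N.Dart} {g : N.Dart ≃ K.Dart} (hf : IsIso f)
    (hg : IsIso g) : IsIso (f.trans g) :=
  ⟨fun d => by simp [hf.1, hg.1], fun d => by simp [hf.2, hg.2]⟩

/-- Isomorphism of rooted combinatorial maps. -/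
def RootedIso (M : CombMap) (r : M.Dart) (N : CombMap) (s : N.Dart) : Prop :=
  ∃ f : M.Dart ≃ N.Dart, IsIso f ∧ f r = s

theorem RootedIso.trans {M N K : CombMap} {r : M.Dart} {s : N.Dart} {t : K.Dart}
    (h : RootedIso M r N s) (h' : RootedIso N s K t) : RootedIso M r K t := by
  obtain ⟨f, hf, rfl⟩ := h
  obtain ⟨g, hg, rfl⟩ := h'
  exact ⟨f.trans g, hf.trans hg, rfl⟩

/-- `N` is obtained from `M` by inserting a pair of triangles into the edge of `d`; the old darts are
embedded by `i`, the new ones by `j`. -/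
structure Ins (M : CombMap) (d : M.Dart) (N : CombMap) (i : M.Dart → N.Dart)
    (j : Bool × ZMod 3 → N.Dart) : Prop where
  bij : Function.Bijective (Sum.elim i j)
  rev_d : N.rev (i d) = j (false, 0)
  rev_rev_d : N.rev (i (M.rev d)) = j (true, 0)
  rev_of_ne : ∀ x, x ≠ d → x ≠ M.rev d → N.rev (i x) = i (M.rev x)
  rev_one : N.rev (j (false, 1)) = j (true, 1)
  rev_two : N.rev (j (false, 2)) = j (true, 2)
  face_i : ∀ x, N.face (i x) = i (M.face x)
  face_j : ∀ t, N.face (j t) = j (pairFace t)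

open Classical in
theorem insertPair_rev (M : CombMap) (d : M.Dart) (x : M.Dart ⊕ (Bool × ZMod 3)) :
    (M.insertPair d).rev x = Equiv.swap (Sum.inl (M.rev d)) (Sum.inr (false, 0))
      (Equiv.Perm.sumCongr M.rev pairRev
        (Equiv.swap (Sum.inl (M.rev d)) (Sum.inr (false, 0)) x)) := rfl

theorem ins_insertPair (M : CombMap) (d : M.Dart) :
    Ins M d (M.insertPair d) (Sum.inl : M.Dart → M.Dart ⊕ (Bool × ZMod 3))
      (Sum.inr : _ → M.Dart ⊕ (Bool × ZMod 3)) where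
  bij := by
    change @Function.Bijective (M.Dart ⊕ (Bool × ZMod 3)) (M.Dart ⊕ (Bool × ZMod 3))
      (Sum.elim Sum.inl Sum.inr)
    rw [Sum.elim_inl_inr]
    exact Function.bijective_id
  rev_d := by
    have := M.rev_ne d
    refine (insertPair_rev _ _ _).trans ?_
    simp [Equiv.swap_apply_of_ne_of_ne, this.symm]; rfl
  rev_rev_d := by
    refine (insertPair_rev _ _ _).trans ?_
    simp [pairRev, Equiv.swap_apply_of_ne_of_ne]; rfl
  rev_of_ne x h h' := by
    have h1 : M.rev x ≠ M.rev d := fun e => h (M.rev.injective e)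
    refine (insertPair_rev _ _ _).trans ?_
    simp [Equiv.swap_apply_of_ne_of_ne, h', h1]; rfl
  rev_one := by
    refine (insertPair_rev _ _ _).trans ?_
    simp [pairRev, Equiv.swap_apply_of_ne_of_ne]; rfl
  rev_two := by
    have : (2 : ZMod 3) ≠ 0 := by decide
    refine (insertPair_rev _ _ _).trans ?_
    simp [pairRev, Equiv.swap_apply_of_ne_of_ne, this]; rfl
  face_i _ := rfl
  face_j _ := rfl

namespace Ins

variable {M : CombMap} {d : M.Dart} {N : CombMap} {i : M.Dart → N.Dart}
  {j : Bool × ZMod 3 → N.Dart}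

theorem cases (h : Ins M d N i j) (P : N.Dart → Prop) (hi : ∀ x, P (i x)) (hj : ∀ t, P (j t)) (y) :
    P y := by
  obtain ⟨x | t, rfl⟩ := h.bij.2 y
  exacts [hi x, hj t]

theorem injective_i (h : Ins M d N i j) : Function.Injective i :=
  (Sum.elim_injective.1 h.bij.1).1

theorem injective_j (h : Ins M d N i j) : Function.Injective j :=
  (Sum.elim_injective.1 h.bij.1).2.1

theorem i_ne_j (h : Ins M d N i j) (x t) : i x ≠ j t :=
  (Sum.elim_injective.1 h.bij.1).2.2 x t

theorem rev_j (h : Ins M d N i j) (t : Bool × ZMod 3) :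
    N.rev (j t) = if t.2 = 0 then (if t.1 then i (M.rev d) else i d) else j (!t.1, t.2) := by
  have h1 : ∀ {x y}, N.rev x = y → N.rev y = x := fun e => by rw [← e, N.rev_rev]
  obtain ⟨b, k⟩ := t
  fin_cases k <;> cases b
  · exact h1 h.rev_d
  · exact h1 h.rev_rev_d
  · exact h.rev_one
  · exact h1 h.rev_one
  · exact h.rev_two
  · exact h1 h.rev_two

/-- The old darts and the new sides exhaust `N`, and `Ins` prescribes `rev` and `face` on both.
Hence the result of an insertion is unique up to isomorphism, and any convenient model can replace
`insertPair`. -/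
theorem exists_isIso (h : Ins M d N i j) {N' : CombMap} {i' : M.Dart → N'.Dart}
    {j' : Bool × ZMod 3 → N'.Dart} (h' : Ins M d N' i' j') :
    ∃ f : N.Dart ≃ N'.Dart, IsIso f ∧ (∀ x, f (i x) = i' x) ∧ ∀ t, f (j t) = j' t := by
  set e := Equiv.ofBijective _ h.bij
  set e' := Equiv.ofBijective _ h'.bij
  have hi : ∀ x, (e.symm.trans e') (i x) = i' x := fun x => by
    have : i x = e (.inl x) := rfl
    simp [this, e']
  have hj : ∀ x, (e.symm.trans e') (j x) = j' x := fun x => by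
    have : j x = e (.inr x) := rfl
    simp [this, e']
  refine ⟨e.symm.trans e', ⟨?_, ?_⟩, hi, hj⟩
  · refine h.cases _ (fun x => ?_) (fun t => ?_)
    · rw [hi]
      by_cases h1 : x = d
      · subst h1; rw [h.rev_d, h'.rev_d, hj]
      by_cases h2 : x = M.rev d
      · subst h2; rw [h.rev_rev_d, h'.rev_rev_d, hj]
      rw [h.rev_of_ne _ h1 h2, h'.rev_of_ne _ h1 h2, hi]
    · rw [hj, h.rev_j, h'.rev_j]
      split_ifs <;> simp only [hi, hj]
  · refine h.cases _ (fun x => ?_) (fun t => ?_)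
    · rw [hi, h.face_i, h'.face_i, hi]
    · rw [hj, h.face_j, h'.face_j, hj]

/-- The inserted pair has a half-turn that exchanges its triangles and reverses the numbering of the
sides; an insertion depends on the edge only, not on its orientation. -/
theorem swap (h : Ins M d N i j) : Ins M (M.rev d) N i (fun t => j (!t.1, -t.2)) where
  bij := by
    have : Sum.elim i (fun t => j (!t.1, -t.2)) =
        Sum.elim i j ∘ (Equiv.sumCongr (Equiv.refl _)
          (Equiv.prodCongr Equiv.boolNot (Equiv.neg (ZMod 3)))) := by
      funext x; cases x <;> rfl
    rw [this]
    exact h.bij.comp (Equiv.bijective _)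
  rev_d := by simpa using h.rev_rev_d
  rev_rev_d := by simpa [M.rev_rev] using h.rev_d
  rev_of_ne x h1 h2 := h.rev_of_ne x (by rwa [M.rev_rev] at h2) h1
  rev_one := by
    rw [h.rev_j]; rfl
  rev_two := by
    rw [h.rev_j]; rfl
  face_i := h.face_i
  face_j t := by
    rw [h.face_j]
    congr 1
    revert t
    decide

theorem comp_iso {K : CombMap} {f : K.Dart ≃ M.Dart} (hf : IsIso f) {x : K.Dart}
    (h : Ins M (f x) N i j) : Ins K x N (i ∘ f) j where
  bij := by
    have : Sum.elim (i ∘ f) j = Sum.elim i j ∘ (Equiv.sumCongr f (Equiv.refl _)) := by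
      funext x; cases x <;> rfl
    rw [this]
    exact h.bij.comp (Equiv.bijective _)
  rev_d := h.rev_d
  rev_rev_d := by simpa [hf.1] using h.rev_rev_d
  rev_of_ne y h1 h2 := by
    simp only [Function.comp, hf.1]
    exact h.rev_of_ne _ (by simpa using h1) (by rw [← hf.1]; simpa using h2)
  rev_one := h.rev_one
  rev_two := h.rev_two
  face_i y := by simp [hf.2, h.face_i]
  face_j := h.face_j

end Ins

end CombMap

/-! ### Insertion inside one of the glued regions -/

namespace Region

open Glue CombMap

/-- Insertion of a pair of triangles into a region. -/
def RIns (R : Region) (d : R.Dart) (R' : Region) : Prop :=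
  ∃ i j, Ins R.toCombMap d R'.toCombMap i j ∧ i R.u = R'.u ∧ i R.w = R'.w

theorem RIns.swap {R R' : Region} {d : R.Dart} (h : RIns R d R') : RIns R (R.rev d) R' := by
  obtain ⟨i, j, h, h'⟩ := h
  exact ⟨_, _, h.swap, h'⟩

/-- An injection between the darts of two regions that is compatible with the faces and the outer
darts. -/
structure FaceMap (A A' : Region) (i : A.Dart → A'.Dart) : Prop where
  inj : Function.Injective i
  map_u : i A.u = A'.u
  map_w : i A.w = A'.w
  map_face : ∀ x, A'.face (i x) = i (A.face x)

theorem FaceMap.id (A : Region) : FaceMap A A id := ⟨Function.injective_id, rfl, rfl, fun _ => rfl⟩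

section Glue

variable {A B C A' B' C' : Region} {Z : Type}

section
variable {f : A.Dart → A'.Dart} {g : B.Dart → B'.Dart} {k : C.Dart → C'.Dart}

theorem Free.map {y : Glue A.Dart B.Dart C.Dart Z} (hy : Free A B C y) (hf : FaceMap A A' f) :
    Free A' B' C' (Glue.map f g k id y) := by
  rcases hy with rfl | ⟨z, rfl⟩ <;> simp [Free, hf.map_u]

theorem map_injective (hf : Function.Injective f) (hg : Function.Injective g)
    (hk : Function.Injective k) :
    Function.Injective (Glue.map f g k (id : Z → Z)) := by
  intro x y e
  cases x <;> cases y <;> simp_all [hf.eq_iff, hg.eq_iff, hk.eq_iff]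

variable [Finite Z] (ρ : Equiv.Perm Z) (h : ∀ z, ρ (ρ z) = z) (h' : ∀ z, ρ z ≠ z)

/-- Outer darts go to outer darts and, by injectivity, no other dart does; so both face permutations
follow the same case of the gluing. -/
theorem glueMap_face_map (hf : FaceMap A A' f) (hg : FaceMap B B' g) (hk : FaceMap C C' k)
    {y : Glue A.Dart B.Dart C.Dart Z} (hy : Free A B C y) (x : Glue A.Dart B.Dart C.Dart Z) :
    (glueMap A' B' C' Z ρ h h' (Glue.map f g k id y)).face (Glue.map f g k id x) =
      Glue.map f g k id ((glueMap A B C Z ρ h h' y).face x) := by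
  have hy' : Free A' B' C' (Glue.map f g k id y) := hy.map hf
  have hinj := map_injective (Z := Z) hf.inj hg.inj hk.inj
  by_cases e : x = y
  · rw [e, glueMap_face_y _ _ _ _ _ _ hy', glueMap_face_y _ _ _ _ _ _ hy, map_inC, hk.map_w]
  cases x with
  | inA x =>
    by_cases e1 : x = A.w
    · rw [e1, glueMap_face_wA _ _ _ _ _ _ hy, map_inA, hf.map_w, glueMap_face_wA _ _ _ _ _ _ hy',
        map_inB, hg.map_u]
    rw [glueMap_face_inA _ _ _ _ _ _ e1 e, map_inA, map_inA, glueMap_face_inA, hf.map_face]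
    · rw [← hf.map_w]
      exact fun h => e1 (hf.inj h)
    · exact fun h => e (hinj h)
  | inB x =>
    by_cases e1 : x = B.u
    · rw [e1, glueMap_face_uB _ _ _ _ _ _ hy, map_inB, hg.map_u, glueMap_face_uB _ _ _ _ _ _ hy',
        map_inC, hk.map_u]
    by_cases e2 : x = B.w
    · rw [e2, glueMap_face_wB _ _ _ _ _ _ hy, map_inB, hg.map_w, glueMap_face_wB _ _ _ _ _ _ hy']
    rw [glueMap_face_inB _ _ _ _ _ _ hy e1 e2, map_inB, map_inB,
      glueMap_face_inB _ _ _ _ _ _ hy', hg.map_face]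
    · rw [← hg.map_u]; exact fun h => e1 (hg.inj h)
    · rw [← hg.map_w]; exact fun h => e2 (hg.inj h)
  | inC x =>
    by_cases e1 : x = C.u
    · rw [e1, glueMap_face_uC _ _ _ _ _ _ hy, map_inC, hk.map_u, glueMap_face_uC _ _ _ _ _ _ hy',
        map_inA, hf.map_w]
    by_cases e2 : x = C.w
    · rw [e2, glueMap_face_wC _ _ _ _ _ _ hy, map_inC, hk.map_w, glueMap_face_wC _ _ _ _ _ _ hy',
        map_inB, hg.map_w]
    rw [glueMap_face_inC _ _ _ _ _ _ hy e1 e2, map_inC, map_inC,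
      glueMap_face_inC _ _ _ _ _ _ hy', hk.map_face]
    · rw [← hk.map_u]; exact fun h => e1 (hk.inj h)
    · rw [← hk.map_w]; exact fun h => e2 (hk.inj h)
  | nw x =>
    rw [glueMap_face_nw _ _ _ _ _ _ e, map_nw, id, glueMap_face_nw]
    exact fun h => e (hinj h)

end

variable [Finite Z] (ρ : Equiv.Perm Z) (h : ∀ z, ρ (ρ z) = z) (h' : ∀ z, ρ z ≠ z)

theorem ins_glueMap_A {d : A.Dart} {i : A.Dart → A'.Dart}
    {j : Bool × ZMod 3 → A'.Dart} (H : Ins A.toCombMap d A'.toCombMap i j)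
    (hu : i A.u = A'.u) (hw : i A.w = A'.w) {y : Glue A.Dart B.Dart C.Dart Z} (hy : Free A B C y)
    {y' : Glue A'.Dart B.Dart C.Dart Z} (hy' : Glue.map i id id id y = y') :
    Ins (glueMap A B C Z ρ h h' y) (inA d)
      (glueMap A' B C Z ρ h h' y') (Glue.map i id id id)
      (fun t => inA (j t)) where
  bij := by
    refine ⟨Sum.elim_injective.2 ⟨map_injective H.injective_i Function.injective_id
      Function.injective_id, fun a b e => H.injective_j (by simpa using e), ?_⟩, ?_⟩
    · intro x t; cases x <;> simp [H.i_ne_j]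
    · rintro (x | x | x | x)
      · obtain ⟨a | a, rfl⟩ := H.bij.2 x
        exacts [⟨.inl (inA a), rfl⟩, ⟨.inr a, rfl⟩]
      exacts [⟨.inl (inB x), rfl⟩, ⟨.inl (inC x), rfl⟩, ⟨.inl (nw x), rfl⟩]
  rev_d := by simp [H.rev_d]
  rev_rev_d := by simp [H.rev_rev_d]
  rev_of_ne x h1 h2 := by
    cases x with
    | inA x => simp only [map_inA, congr_inA]; rw [H.rev_of_ne] <;> simp_all
    | _ => simp
  rev_one := by simp [H.rev_one]
  rev_two := by simp [H.rev_two]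
  face_i x := hy' ▸ glueMap_face_map ρ h h' ⟨H.injective_i, hu, hw, H.face_i⟩ (.id B) (.id C) hy x
  face_j t := by
    rw [glueMap_face_inA, H.face_j]
    · rw [← hw]; exact (H.i_ne_j _ _).symm
    · subst hy'
      rcases hy with rfl | ⟨z, rfl⟩ <;> simp [(H.i_ne_j _ _).symm]

theorem ins_glueMap_B {d : B.Dart} {i : B.Dart → B'.Dart}
    {j : Bool × ZMod 3 → B'.Dart} (H : Ins B.toCombMap d B'.toCombMap i j)
    (hu : i B.u = B'.u) (hw : i B.w = B'.w) {y : Glue A.Dart B.Dart C.Dart Z} (hy : Free A B C y) :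
    Ins (glueMap A B C Z ρ h h' y) (inB d)
      (glueMap A B' C Z ρ h h' (Glue.map id i id id y)) (Glue.map id i id id)
      (fun t => inB (j t)) where
  bij := by
    refine ⟨Sum.elim_injective.2 ⟨map_injective Function.injective_id H.injective_i
      Function.injective_id, fun a b e => H.injective_j (by simpa using e), ?_⟩, ?_⟩
    · intro x t; cases x <;> simp [H.i_ne_j]
    · rintro (x | x | x | x)
      · exact ⟨.inl (inA x), rfl⟩
      · obtain ⟨a | a, rfl⟩ := H.bij.2 x
        exacts [⟨.inl (inB a), rfl⟩, ⟨.inr a, rfl⟩]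
      exacts [⟨.inl (inC x), rfl⟩, ⟨.inl (nw x), rfl⟩]
  rev_d := by simp [H.rev_d]
  rev_rev_d := by simp [H.rev_rev_d]
  rev_of_ne x h1 h2 := by
    cases x with
    | inB x => simp only [map_inB, congr_inB]; rw [H.rev_of_ne] <;> simp_all
    | _ => simp
  rev_one := by simp [H.rev_one]
  rev_two := by simp [H.rev_two]
  face_i x := glueMap_face_map ρ h h' (.id A) ⟨H.injective_i, hu, hw, H.face_i⟩ (.id C) hy x
  face_j t := by
    rw [glueMap_face_inB, H.face_j]
    · exact hy.map (.id A)
    · rw [← hu]; exact (H.i_ne_j _ _).symm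
    · rw [← hw]; exact (H.i_ne_j _ _).symm

theorem ins_glueMap_C {d : C.Dart} {i : C.Dart → C'.Dart}
    {j : Bool × ZMod 3 → C'.Dart} (H : Ins C.toCombMap d C'.toCombMap i j)
    (hu : i C.u = C'.u) (hw : i C.w = C'.w) {y : Glue A.Dart B.Dart C.Dart Z} (hy : Free A B C y) :
    Ins (glueMap A B C Z ρ h h' y) (inC d)
      (glueMap A B C' Z ρ h h' (Glue.map id id i id y)) (Glue.map id id i id)
      (fun t => inC (j t)) where
  bij := by
    refine ⟨Sum.elim_injective.2 ⟨map_injective Function.injective_id Function.injective_id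
      H.injective_i, fun a b e => H.injective_j (by simpa using e), ?_⟩, ?_⟩
    · intro x t; cases x <;> simp [H.i_ne_j]
    · rintro (x | x | x | x)
      · exact ⟨.inl (inA x), rfl⟩
      · exact ⟨.inl (inB x), rfl⟩
      · obtain ⟨a | a, rfl⟩ := H.bij.2 x
        exacts [⟨.inl (inC a), rfl⟩, ⟨.inr a, rfl⟩]
      · exact ⟨.inl (nw x), rfl⟩
  rev_d := by simp [H.rev_d]
  rev_rev_d := by simp [H.rev_rev_d]
  rev_of_ne x h1 h2 := by
    cases x with
    | inC x => simp only [map_inC, congr_inC]; rw [H.rev_of_ne] <;> simp_all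
    | _ => simp
  rev_one := by simp [H.rev_one]
  rev_two := by simp [H.rev_two]
  face_i x := glueMap_face_map ρ h h' (.id A) (.id B) ⟨H.injective_i, hu, hw, H.face_i⟩ hy x
  face_j t := by
    rw [glueMap_face_inC, H.face_j]
    · exact hy.map (.id A)
    · rw [← hu]; exact (H.i_ne_j _ _).symm
    · rw [← hw]; exact (H.i_ne_j _ _).symm

end Glue

theorem RIns.node_A {A A' : Region} (B C : Region) {d : A.Dart} (H : RIns A d A') :
    RIns (node A B C) (inA d) (node A' B C) := by
  obtain ⟨i, j, H, hu, hw⟩ := H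
  exact ⟨_, _, ins_glueMap_A _ (by decide) (by decide) H hu hw (free_nw A B C true) rfl, by simp [hu], rfl⟩

theorem RIns.node_B (A : Region) {B B' : Region} (C : Region) {d : B.Dart} (H : RIns B d B') :
    RIns (node A B C) (inB d) (node A B' C) := by
  obtain ⟨i, j, H, hu, hw⟩ := H
  exact ⟨_, _, ins_glueMap_B _ (by decide) (by decide) H hu hw (free_nw A B C true), rfl, rfl⟩

theorem RIns.node_C (A B : Region) {C C' : Region} {d : C.Dart} (H : RIns C d C') :
    RIns (node A B C) (inC d) (node A B C') := by
  obtain ⟨i, j, H, hu, hw⟩ := H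
  exact ⟨_, _, ins_glueMap_C _ (by decide) (by decide) H hu hw (free_nw A B C true), rfl, rfl⟩

/-- Insertion into a closed map, preserving the root. -/
def CIns (M : CombMap) (r d : M.Dart) (N : CombMap) (s : N.Dart) : Prop :=
  ∃ i j, Ins M d N i j ∧ i r = s

theorem RIns.close_A {A A' : Region} (B C : Region) {d : A.Dart} (H : RIns A d A') :
    CIns (close A B C) (closeRoot A B C) (inA d) (close A' B C) (closeRoot A' B C) := by
  obtain ⟨i, j, H, hu, hw⟩ := H
  exact ⟨_, _, ins_glueMap_A 1 (fun _ => rfl) (fun z => z.elim) H hu hw (free_u A B C)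
    (by simp [hu]), by simp [closeRoot, hu]⟩

theorem RIns.close_B (A : Region) {B B' : Region} (C : Region) {d : B.Dart} (H : RIns B d B') :
    CIns (close A B C) (closeRoot A B C) (inB d) (close A B' C) (closeRoot A B' C) := by
  obtain ⟨i, j, H, hu, hw⟩ := H
  exact ⟨_, _, ins_glueMap_B 1 (fun _ => rfl) (fun z => z.elim) H hu hw (free_u A B C), rfl⟩

theorem RIns.close_C (A B : Region) {C C' : Region} {d : C.Dart} (H : RIns C d C') :
    CIns (close A B C) (closeRoot A B C) (inC d) (close A B C') (closeRoot A B C') := by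
  obtain ⟨i, j, H, hu, hw⟩ := H
  exact ⟨_, _, ins_glueMap_C 1 (fun _ => rfl) (fun z => z.elim) H hu hw (free_u A B C), rfl⟩

end Region

/-- A function on the sides of two triangles, given by its values. -/
def tri {X : Type*} (x₀ x₁ x₂ y₀ y₁ y₂ : X) (t : Bool × ZMod 3) : X :=
  if t.1 then (![y₀, y₁, y₂] : Fin 3 → X) t.2 else (![x₀, x₁, x₂] : Fin 3 → X) t.2

theorem forall_side {P : Bool × ZMod 3 → Prop} (h₀ : P (false, 0)) (h₁ : P (false, 1))
    (h₂ : P (false, 2)) (k₀ : P (true, 0)) (k₁ : P (true, 1)) (k₂ : P (true, 2)) (t) : P t := by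
  obtain ⟨b, k⟩ := t
  fin_cases k <;> cases b
  exacts [h₀, k₀, h₁, k₁, h₂, k₂]

section Tri
variable {X : Type*} (x₀ x₁ x₂ y₀ y₁ y₂ : X)
@[simp] theorem tri_false_zero : tri x₀ x₁ x₂ y₀ y₁ y₂ (false, 0) = x₀ := rfl
@[simp] theorem tri_false_one : tri x₀ x₁ x₂ y₀ y₁ y₂ (false, 1) = x₁ := rfl
@[simp] theorem tri_false_two : tri x₀ x₁ x₂ y₀ y₁ y₂ (false, 2) = x₂ := rfl
@[simp] theorem tri_true_zero : tri x₀ x₁ x₂ y₀ y₁ y₂ (true, 0) = y₀ := rfl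
@[simp] theorem tri_true_one : tri x₀ x₁ x₂ y₀ y₁ y₂ (true, 1) = y₁ := rfl
@[simp] theorem tri_true_two : tri x₀ x₁ x₂ y₀ y₁ y₂ (true, 2) = y₂ := rfl

variable {x₀ x₁ x₂ y₀ y₁ y₂}

theorem tri_injective (h : [x₀, x₁, x₂, y₀, y₁, y₂].Nodup) :
    Function.Injective (tri x₀ x₁ x₂ y₀ y₁ y₂) := by
  simp only [List.nodup_cons, List.mem_cons, List.not_mem_nil, or_false, not_or] at h
  intro s t
  revert s t
  refine forall_side ?_ ?_ ?_ ?_ ?_ ?_ <;> refine forall_side ?_ ?_ ?_ ?_ ?_ ?_ <;>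
    simp only [tri_false_zero, tri_false_one, tri_false_two, tri_true_zero, tri_true_one,
      tri_true_two] <;> grind

end Tri

/-! ### Insertion at the outer edge and at the root edge -/

namespace Region

open Glue CombMap

/-- Inserting a pair of triangles along the outer dart `w` of a region. -/
theorem rins_node (R : Region) : RIns R (R.rev R.w) (node R single single) := by
  classical
  have huw := R.u_ne_w
  have hw := R.rev_ne R.w
  have hfw : ∀ x, R.face x = R.w → x = R.w := fun x h => R.face.injective (h.trans R.face_w.symm)
  -- The old dart `w` stays outer and becomes `nw false`; its former place `inA R.w` is taken by the
  -- side `(false, 0)` of the first new triangle.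
  let i : R.Dart → Glue R.Dart Bool Bool Bool := fun d => if d = R.w then nw false else inA d
  let j : Bool × ZMod 3 → Glue R.Dart Bool Bool Bool :=
    tri (inA R.w) (inB false) (inC false) (nw true) (inB true) (inC true)
  have hi : ∀ {d}, d ≠ R.w → i d = inA d := fun h => if_neg h
  have hi' : i R.w = nw false := if_pos rfl
  refine ⟨i, j, ⟨?_, ?_, ?_, ?_, ?_, ?_, ?_, ?_⟩, hi huw, hi'⟩
  · refine ⟨Sum.elim_injective.2 ⟨?_, ?_, ?_⟩, ?_⟩
    · intro x y
      simp only [i]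
      split_ifs with h1 h2 h2 <;> simp [h1, h2]
    · exact tri_injective (by simp)
    · intro x
      by_cases e : x = R.w
      · rw [e, hi']
        refine forall_side ?_ ?_ ?_ ?_ ?_ ?_ <;> simp [j]
      · rw [hi e]
        refine forall_side ?_ ?_ ?_ ?_ ?_ ?_ <;> simp [j, e]
    · rintro (x | x | x | x)
      · by_cases e : x = R.w
        · exact ⟨.inr (false, 0), by simp [j, e]⟩
        · exact ⟨.inl x, hi e⟩
      · cases x
        exacts [⟨.inr (false, 1), rfl⟩, ⟨.inr (true, 1), rfl⟩]
      · cases x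
        exacts [⟨.inr (false, 2), rfl⟩, ⟨.inr (true, 2), rfl⟩]
      · cases x
        · exact ⟨.inl R.w, hi'⟩
        · exact ⟨.inr (true, 0), by simp [j]⟩
  · rw [hi hw]; simp [j, R.rev_rev]
  · rw [R.rev_rev, hi']; simp [j]
  · intro x h1 h2
    rw [R.rev_rev] at h2
    rw [hi h2, hi]
    · simp
    · rintro h; exact h1 (by rw [← h, R.rev_rev])
  · simp [j]
  · simp [j]
  · intro x
    by_cases e : x = R.w
    · rw [e, R.face_w, hi']
      exact node_face_w _ _ _
    · rw [hi e, hi (fun h => e (hfw x h))]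
      exact node_face_inA _ _ _ e
  · refine forall_side ?_ ?_ ?_ ?_ ?_ ?_
    · exact node_face_wA _ _ _
    · exact node_face_uB _ _ _
    · exact node_face_uC _ _ _
    · exact node_face_nw _ _ _
    · exact node_face_wB _ _ _
    · exact node_face_wC _ _ _

/-- Inserting a pair of triangles at the root of a closed map. -/
theorem ins_closeRoot (A B C : Region) :
    ∃ i j, Ins (close A B C) (closeRoot A B C) (close (node A B C) single single) i j ∧
      j (true, 0) = closeRoot (node A B C) single single ∧
      j (false, 1) = (inB false : Glue (node A B C).Dart Bool Bool Empty) ∧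
      j (false, 2) = (inC false : Glue (node A B C).Dart Bool Bool Empty) := by
  classical
  -- In the closed map `A.u` is a side of the second triangle. In the node that side is `nw true`,
  -- and `inA A.u` is an outer dart, to be used as the side `(true, 0)` of the new pair.
  let e : Glue A.Dart B.Dart C.Dart Empty → Glue A.Dart B.Dart C.Dart Bool :=
    fun x => if x = inA A.u then nw true else Glue.map id id id Empty.elim x
  let j : Bool × ZMod 3 → Glue (node A B C).Dart Bool Bool Empty :=
    tri (inA (nw false)) (inB false) (inC false) (inA (inA A.u)) (inB true) (inC true)
  have he : ∀ {x}, x ≠ inA A.u → e x = Glue.map id id id Empty.elim x := fun h => if_neg h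
  have he' : e (inA A.u) = nw true := if_pos rfl
  have heu : ∀ x, e x ≠ inA A.u := by
    intro x
    simp only [e]
    split_ifs with h <;> cases x <;> simp_all
  have hew : ∀ x, e x ≠ nw false := by
    intro x
    simp only [e]
    split_ifs with h
    · simp
    · rcases x with x | x | x | x <;> simp
      exact x.elim
  have hm : ∀ x, x ≠ A.u → e (inA x) = inA x := fun x hx => he (by simpa using hx)
  have hB : ∀ x, e (inB x) = inB x := fun x => he (by simp)
  have hC : ∀ x, e (inC x) = inC x := fun x => he (by simp)
  have hef : ∀ x, (node A B C).face (e x) = e ((close A B C).face x) := by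
    rintro (x | x | x | x)
    · by_cases h : x = A.u
      · rw [h, he', node_face_nw, close_face_uA, hC]
      rw [hm _ h]
      by_cases h1 : x = A.w
      · rw [h1, node_face_wA, close_face_wA, hB]
      · rw [node_face_inA _ _ _ h1, close_face_inA _ _ _ h h1, hm]
        exact fun h' => h (A.face.injective (h'.trans A.face_u.symm))
    · rw [hB]
      by_cases h1 : x = B.u
      · rw [h1, node_face_uB, close_face_uB, hC]
      by_cases h2 : x = B.w
      · rw [h2, node_face_wB, close_face_wB, he']
      · rw [node_face_inB _ _ _ h1 h2, close_face_inB _ _ _ h1 h2, hB]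
    · rw [hC]
      by_cases h1 : x = C.u
      · rw [h1, node_face_uC, close_face_uC, hm _ A.u_ne_w.symm]
      by_cases h2 : x = C.w
      · rw [h2, node_face_wC, close_face_wC, hB]
      · rw [node_face_inC _ _ _ h1 h2, close_face_inC _ _ _ h1 h2, hC]
    · exact x.elim
  refine ⟨fun x => inA (e x), j, ⟨?_, ?_, ?_, ?_, ?_, ?_, ?_, ?_⟩, ?_, ?_, ?_⟩
  · refine ⟨Sum.elim_injective.2 ⟨?_, ?_, ?_⟩, ?_⟩
    · intro x y h
      have hinj : Function.Injective
          (Glue.map id id id Empty.elim : Glue A.Dart B.Dart C.Dart Empty → Glue _ _ _ Bool) := by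
        rintro (a | a | a | a) (b | b | b | b) <;> first | exact a.elim | exact b.elim | simp
      have hn : ∀ a, (Glue.map id id id Empty.elim : Glue A.Dart B.Dart C.Dart Empty →
          Glue _ _ _ Bool) a ≠ nw true := by
        rintro (a | a | a | a) <;> first | exact a.elim | simp
      simp only [inA.injEq, e] at h
      split_ifs at h with h1 h2 h2
      exacts [h1.trans h2.symm, absurd h.symm (hn _), absurd h (hn _), hinj h]
    · exact tri_injective (by simp)
    · intro x
      refine forall_side ?_ ?_ ?_ ?_ ?_ ?_ <;> simp [j, heu, hew]
    · rintro (x | x | x | x)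
      · rcases x with x | x | x | x
        · by_cases h : x = A.u
          · exact ⟨.inr (true, 0), by simp [j, h]⟩
          · exact ⟨.inl (inA x), congrArg inA (he (by simpa using h))⟩
        · exact ⟨.inl (inB x), congrArg inA (he (by simp))⟩
        · exact ⟨.inl (inC x), congrArg inA (he (by simp))⟩
        · cases x
          · exact ⟨.inr (false, 0), by simp [j]⟩
          · exact ⟨.inl (inA A.u), congrArg inA he'⟩
      · cases x
        exacts [⟨.inr (false, 1), rfl⟩, ⟨.inr (true, 1), rfl⟩]
      · cases x
        exacts [⟨.inr (false, 2), rfl⟩, ⟨.inr (true, 2), rfl⟩]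
      · exact x.elim
  · change _ = inA (nw false)
    rw [closeRoot, he']; rfl
  · change _ = inA (inA A.u)
    rw [show e ((close A B C).rev (closeRoot A B C)) = inA (A.rev A.u) from
      he (by simpa [closeRoot] using A.rev_ne A.u)]
    simp [A.rev_rev]
  · intro x h1 h2
    rw [he h1, he]
    · rcases x with x | x | x | x <;> simp
      exact x.elim
    · exact fun h => h2 (by rw [show closeRoot A B C = inA A.u from rfl, ← h, CombMap.rev_rev])
  · simp [j]
  · simp [j]
  · intro x
    rw [glueMap_face_inA, hef]
    · exact hew x
    · exact fun h => heu x (by simpa using h)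
  · refine forall_side ?_ ?_ ?_ ?_ ?_ ?_
    · exact close_face_wA _ _ _
    · exact close_face_uB _ _ _
    · exact close_face_uC _ _ _
    · exact close_face_uA _ _ _
    · exact close_face_wB _ _ _
    · exact close_face_wC _ _ _
  · simp [j, closeRoot]
  · simp [j]
  · simp [j]

end Region

/-! ### Change of root in closed maps -/

namespace Region

open Glue CombMap

/-- The isomorphism is a half-turn of the sphere: it exchanges the two triangles and the first two
slots, and reverses the edge in the third slot. `rootedIso_close_inC` is the same with the last two
slots exchanged in role. -/
theorem rootedIso_close_inB (A : Region) :
    RootedIso (close A single single) (inB false : Glue A.Dart Bool Bool Empty)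
      (close single A single) (closeRoot single A single) := by
  let f : Glue A.Dart Bool Bool Empty ≃ Glue Bool A.Dart Bool Empty :=
    { toFun := Glue.elim inB inA (fun z => inC !z) nw
      invFun := Glue.elim inB inA (fun z => inC !z) nw
      left_inv := by rintro (x | x | x | x) <;> simp
      right_inv := by rintro (x | x | x | x) <;> simp }
  have hA : ∀ x, f (inA x) = inB x := fun _ => rfl
  have hB : ∀ x, f (inB x) = inA x := fun _ => rfl
  have hC : ∀ x, f (inC x) = inC !x := fun _ => rfl
  refine ⟨f, ⟨?_, ?_⟩, rfl⟩
  · rintro (x | x | x | x) <;> rfl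
  · rintro (x | x | x | x)
    · rw [hA]
      by_cases h : x = A.u
      · rw [h, close_face_uA, close_face_uB, hC]; rfl
      by_cases h' : x = A.w
      · rw [h', close_face_wA, close_face_wB, hB]
      · rw [close_face_inA _ _ _ h h', close_face_inB _ _ _ h h', hA]
    · rw [hB]
      cases x
      · exact (congrArg f (close_face_uB A single single)).trans (close_face_uA single A single).symm
      · exact (congrArg f (close_face_wB A single single)).trans (close_face_wA single A single).symm
    · rw [hC]
      cases x
      · exact (congrArg f (close_face_uC A single single)).trans (close_face_wC single A single).symm
      · exact (congrArg f (close_face_wC A single single)).trans (close_face_uC single A single).symm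
    · exact x.elim

theorem rootedIso_close_inC (A : Region) :
    RootedIso (close A single single) (inC false : Glue A.Dart Bool Bool Empty)
      (close single single A) (closeRoot single single A) := by
  let f : Glue A.Dart Bool Bool Empty ≃ Glue Bool Bool A.Dart Empty :=
    { toFun := Glue.elim inC (fun z => inB !z) inA nw
      invFun := Glue.elim inC (fun z => inB !z) inA nw
      left_inv := by rintro (x | x | x | x) <;> simp
      right_inv := by rintro (x | x | x | x) <;> simp }
  have hA : ∀ x, f (inA x) = inC x := fun _ => rfl
  have hB : ∀ x, f (inB x) = inB !x := fun _ => rfl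
  have hC : ∀ x, f (inC x) = inA x := fun _ => rfl
  refine ⟨f, ⟨?_, ?_⟩, rfl⟩
  · rintro (x | x | x | x) <;> rfl
  · rintro (x | x | x | x)
    · rw [hA]
      by_cases h : x = A.u
      · rw [h, close_face_uA, close_face_uC, hC]
      by_cases h' : x = A.w
      · rw [h', close_face_wA, close_face_wC, hB]; rfl
      · rw [close_face_inA _ _ _ h h', close_face_inC _ _ _ h h', hA]
    · rw [hB]
      cases x
      · exact (congrArg f (close_face_uB A single single)).trans (close_face_wB single single A).symm
      · exact (congrArg f (close_face_wB A single single)).trans (close_face_uB single single A).symm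
    · rw [hC]
      cases x
      · exact (congrArg f (close_face_uC A single single)).trans (close_face_uA single single A).symm
      · exact (congrArg f (close_face_wC A single single)).trans (close_face_wA single single A).symm
    · exact x.elim

theorem exists_iso_twoTriangles : ∃ f : twoTriangles.Dart ≃ (close single single single).Dart,
    IsIso f ∧ f (true, 0) = closeRoot single single single ∧
      f (false, 1) = (inB false : Glue Bool Bool Bool Empty) ∧
      f (false, 2) = (inC false : Glue Bool Bool Bool Empty) := by
  let g : Bool × ZMod 3 → Glue Bool Bool Bool Empty :=
    tri (inA true) (inB false) (inC false) (inA false) (inB true) (inC true)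
  have hg : Function.Bijective g := by
    refine ⟨tri_injective (by simp), ?_⟩
    rintro ((_ | _) | (_ | _) | (_ | _) | x)
    exacts [⟨(true, 0), rfl⟩, ⟨(false, 0), rfl⟩, ⟨(false, 1), rfl⟩, ⟨(true, 1), rfl⟩,
      ⟨(false, 2), rfl⟩, ⟨(true, 2), rfl⟩, x.elim]
  refine ⟨Equiv.ofBijective g hg, ⟨?_, ?_⟩, rfl, rfl, rfl⟩
  · exact forall_side rfl rfl rfl rfl rfl rfl
  · refine forall_side ?_ ?_ ?_ ?_ ?_ ?_
    · exact (close_face_wA single single single).symm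
    · exact (close_face_uB single single single).symm
    · exact (close_face_uC single single single).symm
    · exact (close_face_uA single single single).symm
    · exact (close_face_wB single single single).symm
    · exact (close_face_wC single single single).symm

end Region

/-! ### Every rooted hierarchical triangulation has a code, and conversely -/

namespace Tern

open Glue CombMap Region

/-- The edge of `d` either lies in one of the three subregions, where induction applies, or is the
edge of the outer dart `w`, where the insertion adds a node on top of the tree. -/
theorem exists_rins (g : Tern) (d : g.reg.Dart) : ∃ g' : Tern, RIns g.reg d g'.reg := by
  have key : ∀ g : Tern, ∀ d : g.reg.Dart, d = g.reg.w ∨ d = g.reg.rev g.reg.w →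
      ∃ g' : Tern, RIns g.reg d g'.reg := by
    rintro g d (rfl | rfl)
    · have := (rins_node g.reg).swap
      rw [g.reg.rev_rev] at this
      exact ⟨node g leaf leaf, this⟩
    · exact ⟨node g leaf leaf, rins_node g.reg⟩
  induction g with
  | leaf =>
    refine key leaf d ?_
    cases (d : Bool)
    exacts [Or.inr rfl, Or.inl rfl]
  | node a b c iha ihb ihc =>
    rcases (d : Glue a.reg.Dart b.reg.Dart c.reg.Dart Bool) with d | d | d | d
    · obtain ⟨g', h⟩ := iha d
      exact ⟨node g' b c, h.node_A _ _⟩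
    · obtain ⟨g', h⟩ := ihb d
      exact ⟨node a g' c, h.node_B _ _⟩
    · obtain ⟨g', h⟩ := ihc d
      exact ⟨node a b g', h.node_C _ _⟩
    · refine key (node a b c) _ ?_
      cases d
      exacts [Or.inl rfl, Or.inr rfl]

/-- The map on the sphere coded by three ternary trees. -/
noncomputable abbrev closed (a b c : Tern) : CombMap := close a.reg b.reg c.reg

noncomputable abbrev root (a b c : Tern) : (closed a b c).Dart := closeRoot a.reg b.reg c.reg

theorem exists_cins (a b c : Tern) (d : (closed a b c).Dart) :
    ∃ a' b' c' : Tern, CIns (closed a b c) (root a b c) d (closed a' b' c') (root a' b' c') := by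
  rcases d with d | d | d | d
  · obtain ⟨g', h⟩ := exists_rins a d
    exact ⟨g', b, c, h.close_A _ _⟩
  · obtain ⟨g', h⟩ := exists_rins b d
    exact ⟨a, g', c, h.close_B _ _⟩
  · obtain ⟨g', h⟩ := exists_rins c d
    exact ⟨a, b, g', h.close_C _ _⟩
  · exact d.elim

/-- The rooted map `(M, r)` is coded by three ternary trees. -/
def Coded (M : CombMap) (r : M.Dart) : Prop :=
  ∃ a b c : Tern, RootedIso M r (closed a b c) (root a b c)

theorem Coded.of_iso {M N : CombMap} {f : M.Dart ≃ N.Dart} (hf : IsIso f) {r : M.Dart}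
    (h : Coded N (f r)) : Coded M r := by
  obtain ⟨a, b, c, h⟩ := h
  exact ⟨a, b, c, RootedIso.trans ⟨f, hf, rfl⟩ h⟩

theorem coded_of_close (a : Tern) {d : (closed a leaf leaf).Dart}
    (h : d = root a leaf leaf ∨ d = (inB false : Glue a.reg.Dart Bool Bool Empty) ∨
      d = (inC false : Glue a.reg.Dart Bool Bool Empty)) : Coded (closed a leaf leaf) d := by
  rcases h with rfl | rfl | rfl
  · exact ⟨a, leaf, leaf, Equiv.refl _, ⟨fun _ => rfl, fun _ => rfl⟩, rfl⟩
  · exact ⟨leaf, a, leaf, rootedIso_close_inB a.reg⟩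
  · exact ⟨leaf, leaf, a, rootedIso_close_inC a.reg⟩

/-- The half-turn exchanging the two triangles of `twoTriangles`. -/
theorem isIso_halfTurn :
    IsIso (M := twoTriangles) (N := twoTriangles)
      (Equiv.prodCongr Equiv.boolNot (Equiv.neg (ZMod 3))) :=
  ⟨by unfold twoTriangles pairRev; decide, by unfold twoTriangles pairFace; decide⟩

theorem coded_twoTriangles (r : twoTriangles.Dart) : Coded twoTriangles r := by
  obtain ⟨f, hf, h0, h1, h2⟩ := exists_iso_twoTriangles
  have key : ∀ t : twoTriangles.Dart, t = (true, 0) ∨ t = (false, 1) ∨ t = (false, 2) →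
      Coded twoTriangles t := by
    intro t ht
    refine Coded.of_iso hf (coded_of_close leaf ?_)
    rcases ht with rfl | rfl | rfl
    exacts [Or.inl h0, Or.inr (Or.inl h1), Or.inr (Or.inr h2)]
  have key' : ∀ t : Bool × ZMod 3, (!t.1, -t.2) = (true, (0 : ZMod 3)) ∨
      (!t.1, -t.2) = (false, (1 : ZMod 3)) ∨ (!t.1, -t.2) = (false, (2 : ZMod 3)) →
        Coded twoTriangles t := fun t ht => Coded.of_iso isIso_halfTurn (key _ ht)
  revert r
  refine forall_side (key' _ (by decide)) (key _ (Or.inr (Or.inl rfl)))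
    (key _ (Or.inr (Or.inr rfl))) (key _ (Or.inl rfl)) (key' _ (by decide)) (key' _ (by decide))

/-- The induction needs codes for all roots at once. If the new root is an old dart, `M` is coded
from that dart and the insertion takes place inside a region. If it is a new dart, `M` is coded from
`d`, so that the insertion happens at the root edge and yields a code with two single edges, which
can be rerooted; the half-turn `swap` reduces the six new darts to three. -/
theorem coded_of_ins {M N : CombMap} {d : M.Dart} {i : M.Dart → N.Dart}
    {j : Bool × ZMod 3 → N.Dart} (h : Ins M d N i j) (hM : ∀ r, Coded M r) (r : N.Dart) :
    Coded N r := by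
  have key : ∀ {d : M.Dart} {j : Bool × ZMod 3 → N.Dart}, Ins M d N i j →
      Coded N (j (true, 0)) ∧ Coded N (j (false, 1)) ∧ Coded N (j (false, 2)) := by
    intro d j h
    obtain ⟨a, b, c, f, hf, hr⟩ := hM d
    obtain ⟨i', j', h', h0, h1, h2⟩ := ins_closeRoot a.reg b.reg c.reg
    change Ins _ (root a b c) _ _ _ at h'
    rw [← hr] at h'
    obtain ⟨e, he, -, hj⟩ := h.exists_isIso (h'.comp_iso hf)
    refine ⟨?_, ?_, ?_⟩ <;> refine Coded.of_iso he (coded_of_close (node a b c) ?_) <;> rw [hj]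
    exacts [Or.inl h0, Or.inr (Or.inl h1), Or.inr (Or.inr h2)]
  revert r
  refine h.cases _ (fun x => ?_) (forall_side ?_ ?_ ?_ ?_ ?_ ?_)
  · obtain ⟨a, b, c, f, hf, hr⟩ := hM x
    obtain ⟨a', b', c', i', j', h', hi⟩ := exists_cins a b c (f d)
    obtain ⟨e, he, hi', -⟩ := h.exists_isIso (h'.comp_iso hf)
    refine ⟨a', b', c', e, he, ?_⟩
    rw [hi', Function.comp, hr, hi]
  · exact (key h.swap).1
  · exact (key h).2.1
  · exact (key h).2.2
  · exact (key h).1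
  · exact (key h.swap).2.2
  · exact (key h.swap).2.1

theorem coded_of_isHierarchical {M : CombMap} (h : M.IsHierarchical) (r : M.Dart) : Coded M r := by
  induction h with
  | base M h =>
    obtain ⟨f, hf⟩ := h
    exact Coded.of_iso (IsIso.symm hf) (coded_twoTriangles _)
  | insertPair M _ d N h ih =>
    obtain ⟨f, hf⟩ := h
    exact Coded.of_iso (IsIso.symm hf) (coded_of_ins (ins_insertPair M d) ih _)

/-- Descending into a second or third subtree that is not a leaf ends at a node whose second and
third subtrees are leaves; such a node is an insertion at the outer edge of its first subtree. -/
theorem exists_rins_of_ne_leaf (g : Tern) (h : g ≠ leaf) :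
    ∃ (g' : Tern) (d : g'.reg.Dart), size g = size g' + 1 ∧ RIns g'.reg d g.reg := by
  induction g with
  | leaf => exact absurd rfl h
  | node a b c iha ihb ihc =>
    by_cases hb : b = leaf
    · by_cases hc : c = leaf
      · subst hb hc
        exact ⟨a, _, by simp [size], rins_node a.reg⟩
      · obtain ⟨g', d, hs, H⟩ := ihc hc
        exact ⟨node a b g', _, by simp [size, hs]; ring, H.node_C _ _⟩
    · obtain ⟨g', d, hs, H⟩ := ihb hb
      exact ⟨node a g' c, _, by simp [size, hs]; ring, H.node_B _ _⟩

theorem isHierarchical_of_cins {M N : CombMap} {r d : M.Dart} {s : N.Dart} (h : CIns M r d N s)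
    (hM : M.IsHierarchical) : N.IsHierarchical := by
  obtain ⟨i, j, h, -⟩ := h
  obtain ⟨f, hf, -⟩ := (ins_insertPair M d).exists_isIso h
  exact .insertPair M hM d N ⟨f, hf⟩

theorem isHierarchical_closed (a b c : Tern) : (closed a b c).IsHierarchical := by
  induction hn : size a + size b + size c generalizing a b c with
  | zero =>
    obtain ⟨f, hf, -⟩ := exists_iso_twoTriangles
    cases a <;> cases b <;> cases c <;> simp [size] at hn
    exact .base _ ⟨f, hf⟩
  | succ n ih =>
    by_cases ha : a = leaf
    · by_cases hb : b = leaf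
      · by_cases hc : c = leaf
        · subst ha hb hc; simp [size] at hn
        · obtain ⟨g', d, hs, H⟩ := exists_rins_of_ne_leaf c hc
          exact isHierarchical_of_cins (H.close_C _ _) (ih a b g' (by omega))
      · obtain ⟨g', d, hs, H⟩ := exists_rins_of_ne_leaf b hb
        exact isHierarchical_of_cins (H.close_B _ _) (ih a g' c (by omega))
    · obtain ⟨g', d, hs, H⟩ := exists_rins_of_ne_leaf a ha
      exact isHierarchical_of_cins (H.close_A _ _) (ih g' b c (by omega))

end Tern

/-! ### Vertex labellings -/

namespace CombMap

/-- A function on the darts that depends only on the origin of the dart. -/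
def VertexLab (M : CombMap) {X : Type} (ν : M.Dart → X) : Prop :=
  ∀ x, ν (M.face x) = ν (M.rev x)

theorem vertexLab_iff_vert (M : CombMap) {X : Type} (ν : M.Dart → X) :
    M.VertexLab ν ↔ ∀ x, ν (M.vert x) = ν x := by
  refine ⟨fun h x => ?_, fun h x => ?_⟩
  · rw [vert, Equiv.Perm.mul_apply, h, M.rev_rev]
  · rw [← h (M.rev x), vert, Equiv.Perm.mul_apply, M.rev_rev]

end CombMap

theorem eq_of_sameCycle {α X : Type} {p : Equiv.Perm α} {ν : α → X} (h : ∀ x, ν (p x) = ν x)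
    {x y : α} (hxy : p.SameCycle x y) : ν x = ν y := by
  obtain ⟨k, rfl⟩ := hxy
  have hinv : ∀ x, ν (p⁻¹ x) = ν x := fun x => (h (p⁻¹ x)).symm.trans (by simp)
  have hn : ∀ q : Equiv.Perm α, (∀ x, ν (q x) = ν x) → ∀ (n : ℕ) x, ν ((q ^ n) x) = ν x := by
    intro q hq n
    induction n with
    | zero => intro x; rfl
    | succ n ih => intro x; rw [pow_succ', Equiv.Perm.mul_apply, hq, ih]
  cases k with
  | ofNat n => exact (hn p h n x).symm
  | negSucc n => rw [zpow_negSucc, ← inv_pow]; exact (hn p⁻¹ hinv (n + 1) x).symm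

/-- Invariant two-valued functions are the functions on the set of orbits. The number of orbits is
read off from a count of labellings, which, unlike the orbits themselves, decompose readily along a
gluing. -/
theorem two_pow_numOrbits {α : Type} [Finite α] (p : Equiv.Perm α) :
    2 ^ numOrbits p = {ν : α → Bool | ∀ x, ν (p x) = ν x}.ncard := by
  have : Finite (Quotient (Equiv.Perm.SameCycle.setoid p)) := Quotient.finite _
  let e : (Quotient (Equiv.Perm.SameCycle.setoid p) → Bool) ≃
      {ν : α → Bool // ∀ x, ν (p x) = ν x} :=
    { toFun := fun f => ⟨fun x => f (Quotient.mk _ x), fun x => congrArg f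
        (Quotient.sound ((Equiv.Perm.sameCycle_apply_left (f := p)).2 (Equiv.Perm.SameCycle.refl _ _)))⟩
      invFun := fun ν => Quotient.lift ν.1 fun _ _ h => eq_of_sameCycle ν.2 h
      left_inv := fun f => by
        funext q
        induction q using Quotient.inductionOn
        rfl
      right_inv := fun ν => rfl }
  have h := Nat.card_congr e
  rw [Nat.card_fun, Nat.card_eq_fintype_card (α := Bool), Fintype.card_bool] at h
  exact h

namespace CombMap

theorem origin_eq_iff (M : CombMap) {d d' : M.Dart} :
    M.origin d = M.origin d' ↔ M.vert.SameCycle d d' := Quotient.eq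

theorem vertexLab_origin (M : CombMap) : M.VertexLab (X := M.Vertex) M.origin := by
  rw [vertexLab_iff_vert]
  intro x
  rw [origin_eq_iff, Equiv.Perm.sameCycle_apply_left]

theorem VertexLab.eq_of_origin_eq {M : CombMap} {X : Type} {ν : M.Dart → X} (h : M.VertexLab ν)
    {d d' : M.Dart} (e : M.origin d = M.origin d') : ν d = ν d' :=
  eq_of_sameCycle ((M.vertexLab_iff_vert ν).1 h) (M.origin_eq_iff.1 e)

end CombMap

/-! ### Labellings of glued regions -/

namespace Region

open Glue CombMap

/-- A function on the darts of a region that depends only on the origin of the dart, with values `s`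
and `t` at the origins of the outer darts `u` and `w`. -/
def Lab (R : Region) {X : Type} (ν : R.Dart → X) (s t : X) : Prop :=
  ν R.u = s ∧ ν R.w = t ∧ ∀ x, x ≠ R.u → x ≠ R.w → ν (R.face x) = ν (R.rev x)

/-- The targets of the outer darts are each other's origins. -/
def Digon (R : Region) : Prop :=
  ∀ ⦃X : Type⦄ ⦃ν : R.Dart → X⦄ ⦃s t : X⦄, R.Lab ν s t → ν (R.rev R.u) = t ∧ ν (R.rev R.w) = s

theorem lab_single {X : Type} {ν : single.Dart → X} {s t : X} :
    single.Lab ν s t ↔ ν false = s ∧ ν true = t := by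
  refine ⟨fun h => ⟨h.1, h.2.1⟩, fun h => ⟨h.1, h.2, ?_⟩⟩
  rintro (_ | _) h1 h2
  exacts [absurd rfl h1, absurd rfl h2]

theorem digon_single : single.Digon := by
  intro X ν s t h
  rw [lab_single] at h
  exact ⟨h.2, h.1⟩

section
variable {A B C : Region}

/-- Along a triangle, the label at the target of each side is the label at the origin of the next
one, and `Digon` identifies these targets with the opposite ends of the regions. One value stays
free: the label `v` of the apex shared by `B` and `C`. -/
theorem lab_node (hA : A.Digon) (hB : B.Digon) (hC : C.Digon) {X : Type}
    {ν : Glue A.Dart B.Dart C.Dart Bool → X} {s t : X} :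
    (node A B C).Lab ν s t ↔ ∃ v, A.Lab (fun d => ν (inA d)) s t ∧ B.Lab (fun d => ν (inB d)) s v ∧
      C.Lab (fun d => ν (inC d)) v t ∧ ν (nw false) = t ∧ ν (nw true) = s := by
  constructor
  · rintro ⟨h1, h2, h⟩
    change ν (inA A.u) = s at h1
    change ν (nw false) = t at h2
    have hn : ν (inC C.w) = t := by
      rw [← node_face_nw A B C, h _ (by simp) (by simp)]; exact h2
    have hwA : ν (inB B.u) = ν (inA (A.rev A.w)) := by
      rw [← node_face_wA A B C]; exact h _ (by simpa using A.u_ne_w.symm) (by simp)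
    have huB : ν (inC C.u) = ν (inB (B.rev B.u)) := by
      rw [← node_face_uB A B C]; exact h _ (by simp) (by simp)
    have huC : ν (inA A.w) = ν (inC (C.rev C.u)) := by
      rw [← node_face_uC A B C]; exact h _ (by simp) (by simp)
    have hwC : ν (inB B.w) = ν (inC (C.rev C.w)) := by
      rw [← node_face_wC A B C]; exact h _ (by simp) (by simp)
    have hwB : ν (nw true) = ν (inB (B.rev B.w)) := by
      rw [← node_face_wB A B C]; exact h _ (by simp) (by simp)
    have HA : A.Lab (fun d => ν (inA d)) s (ν (inA A.w)) := by
      refine ⟨h1, rfl, fun x hu hw => ?_⟩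
      beta_reduce
      rw [← node_face_inA A B C hw]
      exact h _ (by simpa using hu) (by simp)
    have HB : B.Lab (fun d => ν (inB d)) (ν (inB B.u)) (ν (inB B.w)) := by
      refine ⟨rfl, rfl, fun x hu hw => ?_⟩
      beta_reduce
      rw [← node_face_inB A B C hu hw]
      exact h _ (by simp) (by simp)
    have HC : C.Lab (fun d => ν (inC d)) (ν (inC C.u)) (ν (inC C.w)) := by
      refine ⟨rfl, rfl, fun x hu hw => ?_⟩
      beta_reduce
      rw [← node_face_inC A B C hu hw]
      exact h _ (by simp) (by simp)
    rw [(hA HA).2] at hwA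
    rw [(hB HB).1] at huB
    rw [(hC HC).1, hn] at huC
    rw [(hB HB).2, hwA] at hwB
    rw [huC] at HA
    rw [hwA] at HB
    rw [huB, hn] at HC
    exact ⟨_, HA, HB, HC, h2, hwB⟩
  · rintro ⟨v, HA, HB, HC, h2, h3⟩
    refine ⟨HA.1, h2, ?_⟩
    rintro (x | x | x | x) hu hw
    · by_cases e : x = A.w
      · rw [e, node_face_wA]; exact HB.1.trans (hA HA).2.symm
      · rw [node_face_inA _ _ _ e]; exact HA.2.2 x (by simpa using hu) e
    · by_cases e : x = B.u
      · rw [e, node_face_uB]; exact HC.1.trans (hB HB).1.symm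
      by_cases e' : x = B.w
      · rw [e', node_face_wB]; exact h3.trans (hB HB).2.symm
      · rw [node_face_inB _ _ _ e e']; exact HB.2.2 x e e'
    · by_cases e : x = C.u
      · rw [e, node_face_uC]; exact HA.2.1.trans (hC HC).1.symm
      by_cases e' : x = C.w
      · rw [e', node_face_wC]; exact HB.2.1.trans (hC HC).2.symm
      · rw [node_face_inC _ _ _ e e']; exact HC.2.2 x e e'
    · cases x
      · exact absurd rfl hw
      · rw [node_face_nw]; exact HC.2.1.trans h2.symm

theorem digon_node (hA : A.Digon) (hB : B.Digon) (hC : C.Digon) : (node A B C).Digon := by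
  intro X ν s t h
  obtain ⟨v, HA, -, -, -, h3⟩ := (lab_node hA hB hC).1 h
  exact ⟨(hA HA).1, h3⟩

theorem vertexLab_close (hA : A.Digon) (hB : B.Digon) (hC : C.Digon) {X : Type}
    {ν : Glue A.Dart B.Dart C.Dart Empty → X} :
    (close A B C).VertexLab ν ↔ ∃ s t v, A.Lab (fun d => ν (inA d)) s t ∧
      B.Lab (fun d => ν (inB d)) s v ∧ C.Lab (fun d => ν (inC d)) v t := by
  constructor
  · intro h
    have huA : ν (inC C.w) = ν (inA (A.rev A.u)) := by
      rw [← close_face_uA A B C]; exact h _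
    have hwA : ν (inB B.u) = ν (inA (A.rev A.w)) := by
      rw [← close_face_wA A B C]; exact h _
    have huB : ν (inC C.u) = ν (inB (B.rev B.u)) := by
      rw [← close_face_uB A B C]; exact h _
    have HA : A.Lab (fun d => ν (inA d)) (ν (inA A.u)) (ν (inA A.w)) := by
      refine ⟨rfl, rfl, fun x hu hw => ?_⟩
      beta_reduce
      rw [← close_face_inA A B C hu hw]
      exact h _
    have HB : B.Lab (fun d => ν (inB d)) (ν (inB B.u)) (ν (inB B.w)) := by
      refine ⟨rfl, rfl, fun x hu hw => ?_⟩
      beta_reduce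
      rw [← close_face_inB A B C hu hw]
      exact h _
    have HC : C.Lab (fun d => ν (inC d)) (ν (inC C.u)) (ν (inC C.w)) := by
      refine ⟨rfl, rfl, fun x hu hw => ?_⟩
      beta_reduce
      rw [← close_face_inC A B C hu hw]
      exact h _
    rw [(hA HA).1] at huA
    rw [(hA HA).2] at hwA
    rw [(hB HB).1] at huB
    rw [hwA] at HB
    rw [huB, huA] at HC
    exact ⟨_, _, _, HA, HB, HC⟩
  · rintro ⟨s, t, v, HA, HB, HC⟩ (x | x | x | x)
    · by_cases e' : x = A.u
      · rw [e', close_face_uA]; exact HC.2.1.trans (hA HA).1.symm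
      by_cases e : x = A.w
      · rw [e, close_face_wA]; exact HB.1.trans (hA HA).2.symm
      · rw [close_face_inA _ _ _ e' e]; exact HA.2.2 x e' e
    · by_cases e : x = B.u
      · rw [e, close_face_uB]; exact HC.1.trans (hB HB).1.symm
      by_cases e' : x = B.w
      · rw [e', close_face_wB]; exact HA.1.trans (hB HB).2.symm
      · rw [close_face_inB _ _ _ e e']; exact HB.2.2 x e e'
    · by_cases e : x = C.u
      · rw [e, close_face_uC]; exact HA.2.1.trans (hC HC).1.symm
      by_cases e' : x = C.w
      · rw [e', close_face_wC]; exact HB.2.1.trans (hC HC).2.symm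
      · rw [close_face_inC _ _ _ e e']; exact HC.2.2 x e e'
    · exact x.elim

end

theorem lab_const (R : Region) {X : Type} (s : X) : R.Lab (fun _ => s) s s :=
  ⟨rfl, rfl, fun _ _ _ => rfl⟩

theorem Lab.comp {R : Region} {X Y : Type} {ν : R.Dart → X} {s t : X} (h : R.Lab ν s t) (f : X → Y) :
    R.Lab (fun d => f (ν d)) (f s) (f t) :=
  ⟨congrArg f h.1, congrArg f h.2.1, fun x h1 h2 => congrArg f (h.2.2 x h1 h2)⟩

end Region

namespace Tern

open Glue CombMap Region

theorem digon_reg (g : Tern) : g.reg.Digon := by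
  induction g with
  | leaf => exact digon_single
  | node a b c iha ihb ihc => exact digon_node iha ihb ihc

theorem lab_node {a b c : Tern} {X : Type} {ν : Glue a.reg.Dart b.reg.Dart c.reg.Dart Bool → X}
    {s t : X} : (Region.node a.reg b.reg c.reg).Lab ν s t ↔ ∃ v, a.reg.Lab (fun d => ν (inA d)) s t ∧
      b.reg.Lab (fun d => ν (inB d)) s v ∧
      c.reg.Lab (fun d => ν (inC d)) v t ∧ ν (nw false) = t ∧ ν (nw true) = s :=
  Region.lab_node a.digon_reg b.digon_reg c.digon_reg

theorem vertexLab_closed {a b c : Tern} {X : Type}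
    {ν : Glue a.reg.Dart b.reg.Dart c.reg.Dart Empty → X} :
    (closed a b c).VertexLab ν ↔ ∃ s t v, a.reg.Lab (fun d => ν (inA d)) s t ∧
      b.reg.Lab (fun d => ν (inB d)) s v ∧ c.reg.Lab (fun d => ν (inC d)) v t :=
  vertexLab_close a.digon_reg b.digon_reg c.digon_reg

theorem lab_elim {a b c : Tern} {X : Type} {νa : a.reg.Dart → X} {νb : b.reg.Dart → X}
    {νc : c.reg.Dart → X} {s t v : X} (ha : a.reg.Lab νa s t) (hb : b.reg.Lab νb s v)
    (hc : c.reg.Lab νc v t) :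
    (Region.node a.reg b.reg c.reg).Lab (Glue.elim νa νb νc fun z => if z then s else t) s t :=
  lab_node.2 ⟨v, ha, hb, hc, rfl, rfl⟩

theorem vertexLab_elim {a b c : Tern} {X : Type} {νa : a.reg.Dart → X} {νb : b.reg.Dart → X}
    {νc : c.reg.Dart → X} {s t v : X} (ha : a.reg.Lab νa s t) (hb : b.reg.Lab νb s v)
    (hc : c.reg.Lab νc v t) : (closed a b c).VertexLab (Glue.elim νa νb νc Empty.elim) :=
  vertexLab_closed.2 ⟨s, t, v, ha, hb, hc⟩

/-- A set of darts of a region that contains `u` and is closed under `rev` and under `face` away from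
the outer darts is everything. -/
theorem reg_induction (g : Tern) {P : g.reg.Dart → Prop} (hu : P g.reg.u)
    (hrev : ∀ d, P d → P (g.reg.rev d))
    (hface : ∀ d, d ≠ g.reg.u → d ≠ g.reg.w → P d → P (g.reg.face d)) (d : g.reg.Dart) : P d := by
  induction g with
  | leaf =>
    cases (d : Bool)
    exacts [hu, hrev _ hu]
  | node a b c iha ihb ihc =>
    have hA : ∀ d, P (inA d : Glue a.reg.Dart b.reg.Dart c.reg.Dart Bool) := by
      refine iha (P := fun d => P (inA d : Glue _ _ _ _)) hu (fun d h => hrev _ h) ?_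
      intro d h h' hd
      have := hface (inA d : Glue _ _ _ _) (fun e => h (inA.inj e)) (fun e => by cases e) hd
      rwa [show (node a b c).reg.face _ = _ from node_face_inA a.reg b.reg c.reg h'] at this
    have hB : ∀ d, P (inB d : Glue a.reg.Dart b.reg.Dart c.reg.Dart Bool) := by
      refine ihb (P := fun d => P (inB d : Glue _ _ _ _)) ?_ (fun d h => hrev _ h) ?_
      · have := hface (inA a.reg.w : Glue _ _ _ _) (fun e => a.reg.u_ne_w (inA.inj e).symm)
          (fun e => by cases e) (hA _)
        rwa [show (node a b c).reg.face _ = _ from node_face_wA a.reg b.reg c.reg] at this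
      intro d h h' hd
      have := hface (inB d : Glue _ _ _ _) (fun e => by cases e) (fun e => by cases e) hd
      rwa [show (node a b c).reg.face _ = _ from node_face_inB a.reg b.reg c.reg h h'] at this
    have hC : ∀ d, P (inC d : Glue a.reg.Dart b.reg.Dart c.reg.Dart Bool) := by
      refine ihc (P := fun d => P (inC d : Glue _ _ _ _)) ?_ (fun d h => hrev _ h) ?_
      · have := hface (inB b.reg.u : Glue _ _ _ _) (fun e => by cases e)
          (fun e => by cases e) (hB _)
        rwa [show (node a b c).reg.face _ = _ from node_face_uB a.reg b.reg c.reg] at this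
      intro d h h' hd
      have := hface (inC d : Glue _ _ _ _) (fun e => by cases e) (fun e => by cases e) hd
      rwa [show (node a b c).reg.face _ = _ from node_face_inC a.reg b.reg c.reg h h'] at this
    have hN : P (nw true : Glue a.reg.Dart b.reg.Dart c.reg.Dart Bool) := by
      have := hface (inB b.reg.w : Glue _ _ _ _) (fun e => by cases e)
        (fun e => by cases e) (hB _)
      rwa [show (node a b c).reg.face _ = _ from node_face_wB a.reg b.reg c.reg] at this
    rcases (d : Glue a.reg.Dart b.reg.Dart c.reg.Dart Bool) with d | d | d | d
    · exact hA d
    · exact hB d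
    · exact hC d
    · cases d
      exacts [hrev _ hN, hN]

theorem closed_induction (a b c : Tern) {P : (closed a b c).Dart → Prop} (hr : P (root a b c))
    (hrev : ∀ d, P d → P ((closed a b c).rev d)) (hface : ∀ d, P d → P ((closed a b c).face d))
    (d : (closed a b c).Dart) : P d := by
  have hA : ∀ d, P (inA d) := by
    refine reg_induction a hr (fun d h => hrev _ h) ?_
    intro d h h' hd
    have := hface _ hd
    rwa [close_face_inA _ _ _ h h'] at this
  have hB : ∀ d, P (inB d) := by
    refine reg_induction b ?_ (fun d h => hrev _ h) ?_
    · have := hface _ (hA a.reg.w)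
      rwa [close_face_wA] at this
    intro d h h' hd
    have := hface _ hd
    rwa [close_face_inB _ _ _ h h'] at this
  have hC : ∀ d, P (inC d) := by
    refine reg_induction c ?_ (fun d h => hrev _ h) ?_
    · have := hface _ (hB b.reg.u)
      rwa [close_face_uB] at this
    intro d h h' hd
    have := hface _ hd
    rwa [close_face_inC _ _ _ h h'] at this
  rcases d with d | d | d | d
  exacts [hA d, hB d, hC d, d.elim]

end Tern

/-! ### Numbers of vertices, edges and faces; planarity -/

theorem numOrbits_mul {α : Type} [Finite α] (p : Equiv.Perm α) (k : ℕ) (hk : 0 < k)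
    (h : ∀ x, Function.minimalPeriod p x = k) : numOrbits p * k = Nat.card α := by
  have hit : ∀ n x, (p ^ n) x = p^[n] x := fun n x => by rw [← Equiv.Perm.iterate_eq_pow]
  -- Each orbit is run through once by the first `k` powers of `p` applied to a chosen
  -- representative.
  let f : Quotient (Equiv.Perm.SameCycle.setoid p) × Fin k → α := fun q => (p ^ q.2.1) q.1.out
  have hf : Function.Bijective f := by
    constructor
    · rintro ⟨q, i⟩ ⟨q', i'⟩ e
      have hq : q = q' := by
        rw [← q.out_eq, ← q'.out_eq]
        refine Quotient.sound (s := Equiv.Perm.SameCycle.setoid p) ?_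
        have h1 : p.SameCycle q.out (f (q, i)) :=
          Equiv.Perm.sameCycle_pow_right.2 (Equiv.Perm.SameCycle.refl _ _)
        rw [e] at h1
        exact Equiv.Perm.sameCycle_pow_right.1 h1
      subst hq
      congr 1
      simp only [f, hit] at e
      exact Fin.ext (Function.iterate_injOn_Iio_minimalPeriod (f := p) (x := q.out)
        (by simp [h]) (by simp [h]) e)
    · intro x
      have h1 : p.SameCycle (Quotient.mk (Equiv.Perm.SameCycle.setoid p) x).out x :=
        Quotient.exact (s := Equiv.Perm.SameCycle.setoid p) (Quotient.out_eq _)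
      obtain ⟨n, hn⟩ := h1.exists_nat_pow_eq
      refine ⟨(Quotient.mk _ x, ⟨n % k, Nat.mod_lt _ hk⟩), ?_⟩
      · simp only [f, hit]
        rw [← h, Function.iterate_mod_minimalPeriod_eq, ← hit, hn]
  rw [← Nat.card_congr (Equiv.ofBijective f hf), Nat.card_prod, numOrbits, Nat.card_fin]

namespace CombMap

/-- All faces have degree three, without reference to periods. -/
def FacesAreTriangles (M : CombMap) : Prop :=
  ∀ d, M.face d ≠ d ∧ M.face (M.face (M.face d)) = d

theorem FacesAreTriangles.isTriangulation {M : CombMap} (h : M.FacesAreTriangles) :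
    M.IsTriangulation := by
  intro d
  have : Fact (Nat.Prime 3) := ⟨Nat.prime_three⟩
  exact Function.minimalPeriod_eq_prime_iff.2 ⟨(h d).2, (h d).1⟩

theorem FacesAreTriangles.of_iso {M N : CombMap} {f : M.Dart ≃ N.Dart} (hf : IsIso f)
    (h : M.FacesAreTriangles) : N.FacesAreTriangles := by
  intro d
  obtain ⟨d, rfl⟩ := f.surjective d
  simp only [← hf.2, ne_eq, f.injective.eq_iff]
  exact h d

theorem facesAreTriangles_pairFace (t : Bool × ZMod 3) :
    pairFace t ≠ t ∧ pairFace (pairFace (pairFace t)) = t := by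
  revert t; decide

theorem IsHierarchical.facesAreTriangles {M : CombMap} (h : M.IsHierarchical) :
    M.FacesAreTriangles := by
  induction h with
  | base M h =>
    obtain ⟨f, hf⟩ := h
    exact FacesAreTriangles.of_iso hf facesAreTriangles_pairFace
  | insertPair M _ d N h ih =>
    obtain ⟨f, hf⟩ := h
    refine FacesAreTriangles.of_iso hf ?_
    have hi := ins_insertPair M d
    refine hi.cases _ (fun x => ?_) (fun t => ?_)
    · rw [hi.face_i, hi.face_i, hi.face_i]
      exact ⟨fun e => (ih x).1 (hi.injective_i e), congrArg _ (ih x).2⟩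
    · rw [hi.face_j, hi.face_j, hi.face_j]
      exact ⟨fun e => (facesAreTriangles_pairFace t).1 (hi.injective_j e),
        congrArg _ (facesAreTriangles_pairFace t).2⟩

theorem numEdges_mul_two (M : CombMap) : M.numEdges * 2 = Nat.card M.Dart := by
  have := M.finite_dart
  have : Fact (Nat.Prime 2) := ⟨Nat.prime_two⟩
  exact numOrbits_mul _ 2 two_pos fun d =>
    Function.minimalPeriod_eq_prime_iff.2 ⟨M.rev_rev d, M.rev_ne d⟩

theorem IsTriangulation.numFaces_mul_three {M : CombMap} (h : M.IsTriangulation) :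
    M.numFaces * 3 = Nat.card M.Dart := by
  have := M.finite_dart
  exact numOrbits_mul _ 3 three_pos h

theorem two_pow_numVertices (M : CombMap) :
    2 ^ M.numVertices = {ν : M.Dart → Bool | M.VertexLab ν}.ncard := by
  have := M.finite_dart
  rw [numVertices, two_pow_numOrbits]
  congr 1
  ext ν
  exact (M.vertexLab_iff_vert ν).symm

end CombMap

theorem card_glue (A B C Z : Type) [Finite A] [Finite B] [Finite C] [Finite Z] :
    Nat.card (Glue A B C Z) = Nat.card A + Nat.card B + (Nat.card C + Nat.card Z) := by
  rw [Nat.card_congr Glue.equivSum, Nat.card_sum, Nat.card_sum, Nat.card_sum]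

namespace Glue

variable {A B C Z X : Type}

/-- The functions on a glued set whose restrictions to the three parts lie in given sets, and which
are given by `k` on the additional darts. -/
theorem ncard_elim [Finite A] [Finite B] [Finite C] [Finite X] (SA : Set (A → X)) (SB : Set (B → X))
    (SC : Set (C → X)) (k : Z → X) :
    {ν : Glue A B C Z → X | (fun d => ν (inA d)) ∈ SA ∧ (fun d => ν (inB d)) ∈ SB ∧
      (fun d => ν (inC d)) ∈ SC ∧ ∀ z, ν (nw z) = k z}.ncard =
      SA.ncard * (SB.ncard * SC.ncard) := by
  have hinj : Function.Injective fun p : (A → X) × (B → X) × (C → X) =>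
      (Glue.elim p.1 p.2.1 p.2.2 k : Glue A B C Z → X) := by
    rintro ⟨f, g, h⟩ ⟨f', g', h'⟩ e
    have e' := congrFun e
    refine Prod.ext (funext fun d => e' (inA d)) (Prod.ext (funext fun d => e' (inB d))
      (funext fun d => e' (inC d)))
  rw [← Set.ncard_prod, ← Set.ncard_prod, ← Set.ncard_image_of_injective _ hinj]
  congr 1
  ext ν
  constructor
  · rintro ⟨h1, h2, h3, h4⟩
    refine ⟨(_, _, _), ⟨h1, h2, h3⟩, ?_⟩
    funext d
    cases d <;> simp [h4]
  · rintro ⟨⟨f, g, h⟩, ⟨h1, h2, h3⟩, rfl⟩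
    exact ⟨h1, h2, h3, fun z => rfl⟩

end Glue

namespace Tern

open Glue CombMap Region

instance finite_reg (g : Tern) : Finite g.reg.Dart := g.reg.finite_dart

theorem card_reg (g : Tern) : Nat.card g.reg.Dart = 6 * g.size + 2 := by
  induction g with
  | leaf => simp [reg, size]
  | node a b c iha ihb ihc =>
    refine (card_glue a.reg.Dart b.reg.Dart c.reg.Dart Bool).trans ?_
    rw [iha, ihb, ihc, Nat.card_eq_fintype_card, Fintype.card_bool, size]
    ring

theorem card_closed (a b c : Tern) :
    Nat.card (closed a b c).Dart = 6 * (a.size + b.size + c.size + 1) := by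
  refine (card_glue a.reg.Dart b.reg.Dart c.reg.Dart Empty).trans ?_
  rw [card_reg, card_reg, card_reg, Nat.card_eq_fintype_card, Fintype.card_empty]
  ring

/-- Each node owns one vertex, its apex, whose label is free once the labels of the ends are
prescribed. -/
theorem ncard_lab (g : Tern) (s t : Bool) :
    {ν : g.reg.Dart → Bool | g.reg.Lab ν s t}.ncard = 2 ^ g.size := by
  induction g generalizing s t with
  | leaf =>
    rw [size, pow_zero, Set.ncard_eq_one]
    refine ⟨fun b : Bool => if b then t else s, ?_⟩
    ext ν
    refine lab_single.trans ⟨fun h => ?_, ?_⟩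
    · funext b; cases b; exacts [h.1, h.2]
    · rintro rfl; exact ⟨rfl, rfl⟩
  | node a b c iha ihb ihc =>
    change {ν : Glue a.reg.Dart b.reg.Dart c.reg.Dart Bool → Bool |
      (Region.node a.reg b.reg c.reg).Lab ν s t}.ncard = _
    let S : Bool → Set (Glue a.reg.Dart b.reg.Dart c.reg.Dart Bool → Bool) := fun v =>
      {ν | (fun d => ν (inA d)) ∈ {ν | a.reg.Lab ν s t} ∧ (fun d => ν (inB d)) ∈ {ν | b.reg.Lab ν s v} ∧
        (fun d => ν (inC d)) ∈ {ν | c.reg.Lab ν v t} ∧ ∀ z, ν (nw z) = if z then s else t}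
    have hS : ∀ v, (S v).ncard = 2 ^ (a.size + b.size + c.size) := by
      intro v
      rw [ncard_elim, iha, ihb, ihc]
      ring
    have hU : {ν : Glue a.reg.Dart b.reg.Dart c.reg.Dart Bool → Bool |
        (Region.node a.reg b.reg c.reg).Lab ν s t} = S false ∪ S true := by
      ext ν
      refine lab_node.trans ?_
      rw [Bool.exists_bool, Set.mem_union]
      simp only [S, Set.mem_ofPred_eq, Bool.forall_bool, if_true, Bool.false_eq_true, if_false]
    rw [hU, Set.ncard_union_eq _ (Set.toFinite _) (Set.toFinite _), hS, hS, size]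
    · ring
    · rw [Set.disjoint_left]
      intro ν h h'
      exact Bool.false_ne_true (h.2.1.2.1.symm.trans h'.2.1.2.1)

/-- The corners of the two triangles carry three free labels `s`, `t`, `v`, in addition to the inner
vertices of the regions. -/
theorem numVertices_closed (a b c : Tern) :
    (closed a b c).numVertices = a.size + b.size + c.size + 3 := by
  apply Nat.pow_right_injective (le_refl 2)
  beta_reduce
  rw [two_pow_numVertices]
  let S : Bool × Bool × Bool → Set (Glue a.reg.Dart b.reg.Dart c.reg.Dart Empty → Bool) := fun p =>
    {ν | (fun d => ν (inA d)) ∈ {ν | a.reg.Lab ν p.1 p.2.1} ∧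
      (fun d => ν (inB d)) ∈ {ν | b.reg.Lab ν p.1 p.2.2} ∧
      (fun d => ν (inC d)) ∈ {ν | c.reg.Lab ν p.2.2 p.2.1} ∧ ∀ z, ν (nw z) = Empty.elim z}
  have hS : ∀ p, (S p).ncard = 2 ^ (a.size + b.size + c.size) := by
    intro p
    rw [ncard_elim, ncard_lab, ncard_lab, ncard_lab]
    ring
  have hU : {ν : (closed a b c).Dart → Bool | (closed a b c).VertexLab ν} = ⋃ p, S p := by
    ext ν
    refine vertexLab_closed.trans ?_
    simp only [S, Set.mem_iUnion, Set.mem_ofPred_eq, IsEmpty.forall_iff, and_true, Prod.exists]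
  rw [hU, Set.ncard_iUnion_of_finite (fun _ => Set.toFinite _), finsum_congr hS,
    finsum_eq_sum_of_fintype]
  · simp
    ring
  · rintro ⟨s, t, v⟩ ⟨s', t', v'⟩ hne
    rw [Function.onFun, Set.disjoint_left]
    rintro ν ⟨h1, h2, -, -⟩ ⟨h1', h2', -, -⟩
    refine hne ?_
    rw [show s = s' from h1.1.symm.trans h1'.1, show t = t' from h1.2.1.symm.trans h1'.2.1,
      show v = v' from h2.2.1.symm.trans h2'.2.1]

/-- If the total size is `n`, there are `n + 3` vertices, `3 (n + 1)` edges and `2 (n + 1)` faces.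
-/
theorem isPlanar_closed (a b c : Tern) : (closed a b c).IsPlanar := by
  have hn := (closed a b c).numEdges_mul_two
  have hf := (isHierarchical_closed a b c).facesAreTriangles.isTriangulation.numFaces_mul_three
  have hv := numVertices_closed a b c
  rw [card_closed] at hn hf
  refine ⟨?_, by omega⟩
  set M := closed a b c
  let R : M.Dart → M.Dart → Prop := fun x y => y = M.rev x ∨ y = M.face x
  have hr : ∀ d, Relation.ReflTransGen R (root a b c) d := by
    refine closed_induction a b c .refl (fun d h => h.tail (Or.inl rfl))
      (fun d h => h.tail (Or.inr rfl))
  -- All faces being triangles, a step along a face is undone by two more.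
  have hback : ∀ d, Relation.ReflTransGen R d (root a b c) := by
    have h3 := (isHierarchical_closed a b c).facesAreTriangles
    refine closed_induction a b c .refl (fun d h => ?_) (fun d h => ?_)
    · exact .head (Or.inl (M.rev_rev d).symm) h
    · exact .head (Or.inr rfl) (.head (Or.inr rfl) (by rwa [(h3 d).2]))
  exact fun d d' => (hback d).trans (hr d')

end Tern

/-! ### Uniqueness of the code -/

namespace Region

open Glue CombMap

/-- An embedding of a region into a combinatorial map. -/
structure Emb (R : Region) (M : CombMap) (e : R.Dart → M.Dart) : Prop where
  inj : Function.Injective e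
  map_rev : ∀ d, e (R.rev d) = M.rev (e d)
  map_face : ∀ d, d ≠ R.u → d ≠ R.w → e (R.face d) = M.face (e d)

/-- An isomorphism of regions. -/
def IsRegIso {R R' : Region} (f : R.Dart ≃ R'.Dart) : Prop :=
  IsIso (M := R.toCombMap) (N := R'.toCombMap) f ∧ f R.u = R'.u ∧ f R.w = R'.w

theorem IsRegIso.lab {R R' : Region} {f : R.Dart ≃ R'.Dart} (hf : IsRegIso f) {X : Type}
    {ν : R'.Dart → X} {s t : X} (h : R'.Lab ν s t) : R.Lab (fun d => ν (f d)) s t := by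
  refine ⟨(congrArg ν hf.2.1).trans h.1, (congrArg ν hf.2.2).trans h.2.1, fun x hu hw => ?_⟩
  beta_reduce
  rw [hf.1.2, hf.1.1]
  refine h.2.2 _ (fun e => hu ?_) (fun e => hw ?_)
  · rwa [← hf.2.1, f.injective.eq_iff] at e
  · rwa [← hf.2.2, f.injective.eq_iff] at e

section
variable (A B C : Region)

theorem emb_node_A : Emb A (node A B C).toCombMap (inA : A.Dart → Glue _ _ _ _) :=
  ⟨fun _ _ => inA.inj, fun _ => rfl, fun _ _ h => (node_face_inA A B C h).symm⟩

theorem emb_node_B : Emb B (node A B C).toCombMap (inB : B.Dart → Glue _ _ _ _) :=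
  ⟨fun _ _ => inB.inj, fun _ => rfl, fun _ h h' => (node_face_inB A B C h h').symm⟩

theorem emb_node_C : Emb C (node A B C).toCombMap (inC : C.Dart → Glue _ _ _ _) :=
  ⟨fun _ _ => inC.inj, fun _ => rfl, fun _ h h' => (node_face_inC A B C h h').symm⟩

theorem emb_close_B : Emb B (close A B C) (inB : B.Dart → Glue _ _ _ _) :=
  ⟨fun _ _ => inB.inj, fun _ => rfl, fun _ h h' => (close_face_inB A B C h h').symm⟩

theorem emb_close_C : Emb C (close A B C) (inC : C.Dart → Glue _ _ _ _) :=
  ⟨fun _ _ => inC.inj, fun _ => rfl, fun _ h h' => (close_face_inC A B C h h').symm⟩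

end

end Region

namespace Tern

open Glue CombMap Region

section Restrict

variable {g g' : Tern} {M M' : CombMap} {e : g.reg.Dart → M.Dart} {e' : g'.reg.Dart → M'.Dart}
  {f : M.Dart ≃ M'.Dart}

/-- The darts sent into the image of `e'` include `u` and are stable under the moves that generate
the region. An inner dart never arrives at an outer one, since the outer darts of the target are
already hit by those of the source; this is what permits the use of `map_face`. -/
theorem exists_preimage (he : Emb g.reg M e) (he' : Emb g'.reg M' e') (hf : IsIso f)
    (hu : f (e g.reg.u) = e' g'.reg.u) (hw : f (e g.reg.w) = e' g'.reg.w) (d : g.reg.Dart) :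
    ∃ d', e' d' = f (e d) := by
  refine reg_induction g (P := fun d => ∃ d', e' d' = f (e d)) ⟨_, hu.symm⟩ ?_ ?_ d
  · rintro d ⟨d', h⟩
    exact ⟨g'.reg.rev d', by rw [he'.map_rev, he.map_rev, hf.1, h]⟩
  · rintro d h1 h2 ⟨d', h⟩
    refine ⟨g'.reg.face d', ?_⟩
    rw [he'.map_face, he.map_face _ h1 h2, hf.2, h]
    · rintro rfl
      rw [← hu, f.injective.eq_iff, he.inj.eq_iff] at h
      exact h1 h.symm
    · rintro rfl
      rw [← hw, f.injective.eq_iff, he.inj.eq_iff] at h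
      exact h2 h.symm

/-- The isomorphism `f` and its inverse both restrict to the embedded regions. An `Emb` says nothing
on faces at the outer darts; there the restriction is compatible because `u` and `w` are fixed by
`face`. -/
theorem exists_isRegIso (he : Emb g.reg M e) (he' : Emb g'.reg M' e') (hf : IsIso f)
    (hu : f (e g.reg.u) = e' g'.reg.u) (hw : f (e g.reg.w) = e' g'.reg.w) :
    ∃ φ : g.reg.Dart ≃ g'.reg.Dart, IsRegIso φ := by
  choose φ hφ using exists_preimage he he' hf hu hw
  have hu' : f.symm (e' g'.reg.u) = e g.reg.u := by rw [Equiv.symm_apply_eq, hu]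
  have hw' : f.symm (e' g'.reg.w) = e g.reg.w := by rw [Equiv.symm_apply_eq, hw]
  choose ψ hψ using exists_preimage he' he hf.symm hu' hw'
  have hφu : φ g.reg.u = g'.reg.u := he'.inj (by rw [hφ, hu])
  have hφw : φ g.reg.w = g'.reg.w := he'.inj (by rw [hφ, hw])
  let Φ : g.reg.Dart ≃ g'.reg.Dart :=
    ⟨φ, ψ, fun d => he.inj (by rw [hψ, hφ, f.symm_apply_apply]),
      fun d => he'.inj (by rw [hφ, hψ, f.apply_symm_apply])⟩
  refine ⟨Φ, ⟨?_, ?_⟩, hφu, hφw⟩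
  · intro d
    change φ _ = g'.reg.rev (φ d)
    apply he'.inj
    rw [hφ, he'.map_rev, hφ, he.map_rev, hf.1]
  · intro d
    change φ _ = g'.reg.face (φ d)
    by_cases h1 : d = g.reg.u
    · rw [h1, g.reg.face_u, hφu, g'.reg.face_u]
    by_cases h2 : d = g.reg.w
    · rw [h2, g.reg.face_w, hφw, g'.reg.face_w]
    apply he'.inj
    rw [hφ, he'.map_face, hφ, he.map_face _ h1 h2, hf.2]
    · rw [← hφu]; exact fun h => h1 (Φ.injective h)
    · rw [← hφw]; exact fun h => h2 (Φ.injective h)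

end Restrict

/-- A vertex labelling by given values `s` and `t` at the ends of a region, and `0` inside. -/
theorem exists_lab (g : Tern) (s t : ℕ) :
    ∃ ν : g.reg.Dart → ℕ, g.reg.Lab ν s t ∧ ∀ d, ν d = s ∨ ν d = t ∨ ν d = 0 := by
  induction g generalizing s t with
  | leaf =>
    refine ⟨fun b : Bool => if b then t else s, lab_single.2 ⟨rfl, rfl⟩, ?_⟩
    rintro (_ | _) <;> simp
  | node a b c iha ihb ihc =>
    obtain ⟨νa, ha, ha'⟩ := iha s t
    obtain ⟨νb, hb, hb'⟩ := ihb s 0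
    obtain ⟨νc, hc, hc'⟩ := ihc 0 t
    refine ⟨_, lab_elim ha hb hc, ?_⟩
    rintro (d | d | d | d)
    · exact ha' d
    · rcases hb' d with h | h | h <;> simp [h]
    · rcases hc' d with h | h | h <;> simp [h]
    · cases d <;> simp

/-- The triangle on the two ends and the apex of a node is characterized by a vertex labelling. -/
theorem exists_lab_unique (a b c : Tern) :
    ∃ ν : Glue a.reg.Dart b.reg.Dart c.reg.Dart Bool → ℕ,
      (Region.node a.reg b.reg c.reg).Lab ν 1 2 ∧ ν (inB b.reg.w) = 3 ∧
      ∀ x, x ≠ nw false → ν x = 2 → ν ((Region.node a.reg b.reg c.reg).face x) = 1 →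
        ν ((Region.node a.reg b.reg c.reg).face ((Region.node a.reg b.reg c.reg).face x)) = 3 →
        x = inA a.reg.w := by
  -- The ends are labelled 1 and 2, the apex 3, every other vertex 0. Starting from label 2, the
  -- triangle through `inA a.reg.w` reads 2, 1, 3, while the second triangle reads 2, 3, 1.
  obtain ⟨νa, ha, ha'⟩ := exists_lab a 1 2
  obtain ⟨νb, hb, hb'⟩ := exists_lab b 1 3
  obtain ⟨νc, hc, hc'⟩ := exists_lab c 3 2
  refine ⟨_, lab_elim ha hb hc, hb.2.1, ?_⟩
  rintro (x | x | x | x) hx h1 h2 h3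
  · by_contra hw
    have hw' : x ≠ a.reg.w := fun e => hw (by rw [e])
    have hw'' : a.reg.face x ≠ a.reg.w := fun e => hw' (a.reg.face.injective (e.trans a.reg.face_w.symm))
    rw [node_face_inA _ _ _ hw', node_face_inA _ _ _ hw''] at h3
    have := ha' (a.reg.face (a.reg.face x))
    simp only [elim_inA] at h3
    omega
  · have := hb' x
    simp only [elim_inB] at h1
    omega
  · by_cases e : x = c.reg.u
    · have := hc.1
      rw [← e] at this
      simp only [elim_inC] at h1
      omega
    by_cases e' : x = c.reg.w
    · rw [e', node_face_wC] at h2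
      have := hb.2.1
      simp only [elim_inB] at h2
      omega
    · rw [node_face_inC _ _ _ e e'] at h2
      have := hc' (c.reg.face x)
      simp only [elim_inC] at h2
      omega
  · cases x
    · exact absurd rfl hx
    · simp at h1

/-- A leaf is recognized by `rev w = u`. In a node, crossing the outer edge and turning around the
second triangle leads to the darts `w` of the third and second parts, so these are preserved. The
dart `w` of the first part is not reached in this way and is recognized by a labelling; from it the
first triangle gives the remaining outer darts, and the isomorphism restricts to the three parts. -/
theorem eq_of_isRegIso {g g' : Tern} {φ : g.reg.Dart ≃ g'.reg.Dart} (hφ : IsRegIso φ) : g = g' := by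
  induction g generalizing g' with
  | leaf =>
    cases g' with
    | leaf => rfl
    | node a' b' c' =>
      have h := hφ.1.1 Region.single.w
      rw [show φ Region.single.w = _ from hφ.2.2] at h
      have h' := hφ.2.1.symm.trans h
      exact absurd (show (inA a'.reg.u : Glue _ b'.reg.Dart c'.reg.Dart Bool) = nw true from h')
        (by simp)
  | node a b c iha ihb ihc =>
    cases g' with
    | leaf =>
      have h := hφ.1.1 (Region.node a.reg b.reg c.reg).w
      rw [show φ (Region.node a.reg b.reg c.reg).w = _ from hφ.2.2] at h
      have h' := φ.injective (hφ.2.1.trans h.symm)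
      exact absurd (show (inA a.reg.u : Glue _ b.reg.Dart c.reg.Dart Bool) = nw true from h')
        (by simp)
    | node a' b' c' =>
      let N := Region.node a.reg b.reg c.reg
      let N' := Region.node a'.reg b'.reg c'.reg
      let f : Glue a.reg.Dart b.reg.Dart c.reg.Dart Bool ≃
        Glue a'.reg.Dart b'.reg.Dart c'.reg.Dart Bool := φ
      have hf : IsRegIso (R := N) (R' := N') f := hφ
      have hrev : ∀ x, f (N.rev x) = N'.rev (f x) := hf.1.1
      have hface : ∀ x, f (N.face x) = N'.face (f x) := hf.1.2
      have hfw : f (nw false) = nw false := hf.2.2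
      have hfu : f (inA a.reg.u) = inA a'.reg.u := hf.2.1
      have hfn : f (nw true) = nw true := by
        have := hrev (nw false)
        rw [hfw] at this
        exact this
      have hwC : f (inC c.reg.w) = inC c'.reg.w := by
        rw [← node_face_nw a.reg b.reg c.reg, hface, hfn, node_face_nw]
      have hwB : f (inB b.reg.w) = inB b'.reg.w := by
        rw [← node_face_wC a.reg b.reg c.reg, hface, hwC, node_face_wC]
      -- The labelling of the target is pulled back along `f`. The pullback labels the apex 3 by
      -- `hwB`, so the image of `inA a.reg.w` starts a triangle labelled 2, 1, 3.
      have hwA : f (inA a.reg.w) = inA a'.reg.w := by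
        obtain ⟨ν, hν, hv, H⟩ := exists_lab_unique a' b' c'
        obtain ⟨v, h1, h2, h3, -, -⟩ := lab_node.1 (hf.lab hν)
        have hv3 : v = 3 := by rw [← h2.2.1, ← hv, ← hwB]
        refine H _ ?_ h1.2.1 ?_ ?_
        · rw [← hfw]
          exact fun e => by cases f.injective e
        · rw [← hface, node_face_wA]; exact h2.1
        · rw [← hface, ← hface, node_face_wA, node_face_uB, ← hv3]; exact h3.1
      have huB : f (inB b.reg.u) = inB b'.reg.u := by
        rw [← node_face_wA a.reg b.reg c.reg, hface, hwA, node_face_wA]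
      have huC : f (inC c.reg.u) = inC c'.reg.u := by
        rw [← node_face_uB a.reg b.reg c.reg, hface, huB, node_face_uB]
      obtain ⟨φa, ha⟩ := exists_isRegIso (emb_node_A a.reg b.reg c.reg)
        (emb_node_A a'.reg b'.reg c'.reg) hf.1 hfu hwA
      obtain ⟨φb, hb⟩ := exists_isRegIso (emb_node_B a.reg b.reg c.reg)
        (emb_node_B a'.reg b'.reg c'.reg) hf.1 huB hwB
      obtain ⟨φc, hc⟩ := exists_isRegIso (emb_node_C a.reg b.reg c.reg)
        (emb_node_C a'.reg b'.reg c'.reg) hf.1 huC hwC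
      rw [iha ha, ihb hb, ihc hc]

/-- When the first region is a single edge, all six sides of the two triangles are reached from the
root by `rev` and `face`. -/
theorem eq_of_closed_leaf_iso {b c b' c' : Tern}
    {f : (closed leaf b c).Dart ≃ (closed leaf b' c').Dart} (hf : IsIso f)
    (hr : f (root leaf b c) = root leaf b' c') : b = b' ∧ c = c' := by
  have hu : f (inA leaf.reg.u) = inA leaf.reg.u := hr
  have hw : f (inA leaf.reg.w) = inA leaf.reg.w := by
    have := hf.1 (root leaf b c)
    rw [hr] at this
    exact this
  have huB : f (inB b.reg.u) = inB b'.reg.u := by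
    rw [← close_face_wA leaf.reg b.reg c.reg, hf.2, hw, close_face_wA]
  have huC : f (inC c.reg.u) = inC c'.reg.u := by
    rw [← close_face_uB leaf.reg b.reg c.reg, hf.2, huB, close_face_uB]
  have hwC : f (inC c.reg.w) = inC c'.reg.w := by
    rw [← close_face_uA leaf.reg b.reg c.reg, hf.2, hu, close_face_uA]
  have hwB : f (inB b.reg.w) = inB b'.reg.w := by
    rw [← close_face_wC leaf.reg b.reg c.reg, hf.2, hwC, close_face_wC]
  obtain ⟨φb, hb⟩ := exists_isRegIso (emb_close_B leaf.reg b.reg c.reg)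
    (emb_close_B leaf.reg b'.reg c'.reg) hf huB hwB
  obtain ⟨φc, hc⟩ := exists_isRegIso (emb_close_C leaf.reg b.reg c.reg)
    (emb_close_C leaf.reg b'.reg c'.reg) hf huC hwC
  exact ⟨eq_of_isRegIso hb, eq_of_isRegIso hc⟩

/-- Rigidity of rooted maps: `rev` and `face` act transitively. -/
theorem eq_id_of_closed_iso {a b c : Tern} {f : (closed a b c).Dart ≃ (closed a b c).Dart}
    (hf : IsIso f) (hr : f (root a b c) = root a b c) (d : (closed a b c).Dart) : f d = d := by
  refine closed_induction a b c (P := fun d => f d = d) hr (fun d h => ?_) (fun d h => ?_) d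
  · rw [hf.1, h]
  · rw [hf.2, h]

end Tern

/-! ### Parallel edges and loops -/

namespace Tern

open Glue CombMap Region

/-- The darts of a region whose edge has no parallel edge. The flag tells whether this holds for
the edge of a single-edge region. -/
def isolated : Bool → (g : Tern) → Set g.reg.Dart
  | k, leaf => {_d | k = true}
  | _, node a b c => {d | Glue.elim (· ∈ isolated false a) (· ∈ isolated true b)
      (· ∈ isolated true c) (fun _ => False) d}

/-- The darts of a closed map whose edge has no parallel edge. -/
def closedIsolated (a b c : Tern) : Set (closed a b c).Dart :=
  {d | Glue.elim (· ∈ isolated true a) (· ∈ isolated true b)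
      (· ∈ isolated true c) (fun _ => False) d}

/-- In a node the edge `nw` has the same ends as the edge of `u` in the first part, so it is
parallel to it; in particular a single edge in the first slot has the parallel `nw`. The label type
is arbitrary so that `ν` can be the map `origin` itself. -/
theorem exists_parallel {X : Type} {g : Tern} {k : Bool} {d : g.reg.Dart} (hd : d ∉ isolated k g)
    {ν : g.reg.Dart → X} {s t : X} (h : g.reg.Lab ν s t) : (k = false ∧ g = leaf) ∨
      ∃ d', d' ≠ d ∧ d' ≠ g.reg.rev d ∧ ν d' = ν d ∧ ν (g.reg.rev d') = ν (g.reg.rev d) := by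
  induction g generalizing k s t with
  | leaf => exact Or.inl ⟨by simpa [isolated] using hd, rfl⟩
  | node a b c iha ihb ihc =>
    right
    obtain ⟨v, ha, hb, hc, h1, h2⟩ := lab_node.1 h
    have key : ∀ z, ∃ d, ν (inA d : Glue _ b.reg.Dart c.reg.Dart Bool) =
          ν (nw z : Glue a.reg.Dart b.reg.Dart c.reg.Dart Bool) ∧
        ν (inA (a.reg.rev d) : Glue _ b.reg.Dart c.reg.Dart Bool) =
          ν (nw !z : Glue a.reg.Dart b.reg.Dart c.reg.Dart Bool) := by
      have h3 := (a.digon_reg ha).1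
      rintro (_ | _)
      · refine ⟨a.reg.rev a.reg.u, h3.trans h1.symm, ?_⟩
        rw [a.reg.rev_rev]; exact ha.1.trans h2.symm
      · exact ⟨a.reg.u, ha.1.trans h2.symm, h3.trans h1.symm⟩
    rcases (d : Glue a.reg.Dart b.reg.Dart c.reg.Dart Bool) with d | d | d | z
    · rcases iha hd ha with ⟨-, rfl⟩ | ⟨d', e1, e2, e3, e4⟩
      · have h1' : (fun d => ν (inA d : Glue Bool b.reg.Dart c.reg.Dart Bool)) false = _ := ha.1
        have h2' : (fun d => ν (inA d : Glue Bool b.reg.Dart c.reg.Dart Bool)) true = _ := ha.2.1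
        cases (d : Bool)
        · exact ⟨(nw true : Glue _ _ _ _), fun e => (by cases e), fun e => (by cases e),
            h2.trans h1'.symm, h1.trans h2'.symm⟩
        · exact ⟨(nw false : Glue _ _ _ _), fun e => (by cases e), fun e => (by cases e),
            h1.trans h2'.symm, h2.trans h1'.symm⟩
      · exact ⟨(inA d' : Glue _ _ _ _), fun e => e1 (inA.inj e), fun e => e2 (inA.inj e), e3, e4⟩
    · rcases ihb hd hb with ⟨h, -⟩ | ⟨d', e1, e2, e3, e4⟩
      · cases h
      · exact ⟨(inB d' : Glue _ _ _ _), fun e => e1 (inB.inj e), fun e => e2 (inB.inj e), e3, e4⟩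
    · rcases ihc hd hc with ⟨h, -⟩ | ⟨d', e1, e2, e3, e4⟩
      · cases h
      · exact ⟨(inC d' : Glue _ _ _ _), fun e => e1 (inC.inj e), fun e => e2 (inC.inj e), e3, e4⟩
    · obtain ⟨d', e1, e2⟩ := key z
      exact ⟨(inA d' : Glue _ _ _ _), fun e => (by cases e), fun e => (by cases e), e1, e2⟩

/-- The apex can always be labelled so that the part containing `d` has ends with distinct labels
`s` and `t`: label `t` if `d` is in the second part, `s` if it is in the third. -/
theorem exists_lab_loopless (g : Tern) {s t : ℕ} (hst : s ≠ t) (d : g.reg.Dart) :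
    ∃ ν : g.reg.Dart → ℕ, g.reg.Lab ν s t ∧ ν d ≠ ν (g.reg.rev d) := by
  induction g generalizing s t with
  | leaf =>
    refine ⟨fun b : Bool => if b then t else s, lab_single.2 ⟨rfl, rfl⟩, ?_⟩
    cases (d : Bool)
    exacts [hst, hst.symm]
  | node a b c iha ihb ihc =>
    rcases (d : Glue a.reg.Dart b.reg.Dart c.reg.Dart Bool) with d | d | d | z
    · obtain ⟨ν, h, h'⟩ := iha hst d
      obtain ⟨νb, hb, -⟩ := exists_lab b s 0
      obtain ⟨νc, hc, -⟩ := exists_lab c 0 t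
      exact ⟨_, lab_elim h hb hc, h'⟩
    · obtain ⟨ν, h, h'⟩ := ihb hst d
      obtain ⟨νa, ha, -⟩ := exists_lab a s t
      exact ⟨_, lab_elim ha h (lab_const _ t), h'⟩
    · obtain ⟨ν, h, h'⟩ := ihc hst d
      obtain ⟨νa, ha, -⟩ := exists_lab a s t
      exact ⟨_, lab_elim ha (lab_const _ s) h, h'⟩
    · obtain ⟨νa, ha, -⟩ := exists_lab a s t
      refine ⟨_, lab_elim ha (lab_const _ s) (exists_lab c s t).choose_spec.1, ?_⟩
      cases z
      exacts [hst.symm, hst]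

/-- The pair `{1, 2}`. -/
def OneTwo (p q : ℕ) : Prop := (p = 1 ∧ q = 2) ∨ (p = 2 ∧ q = 1)

theorem exists_lab_not_oneTwo (g : Tern) {s t : ℕ} (h : ¬ OneTwo s t) :
    ∃ ν : g.reg.Dart → ℕ, g.reg.Lab ν s t ∧ ∀ d, ¬ OneTwo (ν d) (ν (g.reg.rev d)) := by
  obtain ⟨ν, hν, h'⟩ := exists_lab g s t
  refine ⟨ν, hν, fun d hd => h ?_⟩
  have h1 := h' d
  have h2 := h' (g.reg.rev d)
  unfold OneTwo at *
  omega

/-- The ends of `d` receive 1 and 2, all other vertices 0. If a parallel edge is going to be added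
along the region (flag `false`), the ends of the region must not carry the pair themselves; this
holds because `d` is then inside a second or third part, one of whose ends is an apex. -/
theorem exists_lab_isolated {g : Tern} {k : Bool} {d : g.reg.Dart} (hd : d ∈ isolated k g) :
    ∃ (ν : g.reg.Dart → ℕ) (s t : ℕ), g.reg.Lab ν s t ∧ (k = false → ¬ OneTwo s t) ∧
      OneTwo (ν d) (ν (g.reg.rev d)) ∧
      ∀ d', OneTwo (ν d') (ν (g.reg.rev d')) → d' = d ∨ d' = g.reg.rev d := by
  have h0 : ∀ n, ¬ OneTwo n 0 := by unfold OneTwo; omega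
  have h0' : ∀ n, ¬ OneTwo 0 n := by unfold OneTwo; omega
  have hs : ∀ {p q}, OneTwo p q → OneTwo q p := by unfold OneTwo; omega
  induction g generalizing k with
  | leaf =>
    have hk : k = true := hd
    refine ⟨fun b : Bool => if b then 2 else 1, 1, 2, lab_single.2 ⟨rfl, rfl⟩, by simp [hk], ?_, ?_⟩
    · cases (d : Bool)
      exacts [Or.inl ⟨rfl, rfl⟩, Or.inr ⟨rfl, rfl⟩]
    · intro d' _
      cases (d : Bool) <;> cases (d' : Bool)
      exacts [Or.inl rfl, Or.inr rfl, Or.inr rfl, Or.inl rfl]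
  | node a b c iha ihb ihc =>
    rcases (d : Glue a.reg.Dart b.reg.Dart c.reg.Dart Bool) with d | d | d | z
    · obtain ⟨ν, s, t, h, h1, h2, h3⟩ := iha (k := false) hd
      have hst := h1 rfl
      obtain ⟨νb, hb, hb'⟩ := exists_lab_not_oneTwo b (h0 s)
      obtain ⟨νc, hc, hc'⟩ := exists_lab_not_oneTwo c (h0' t)
      refine ⟨_, s, t, lab_elim h hb hc, fun _ => hst, h2, ?_⟩
      rintro (d' | d' | d' | z) hd'
      · exact (h3 d' hd').imp (congrArg _) (congrArg _)
      · exact absurd hd' (hb' d')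
      · exact absurd hd' (hc' d')
      · cases z
        exacts [absurd (hs hd') hst, absurd hd' hst]
    · obtain ⟨ν, s, v, h, -, h2, h3⟩ := ihb (k := true) hd
      obtain ⟨νa, ha, ha'⟩ := exists_lab_not_oneTwo a (h0 s)
      obtain ⟨νc, hc, hc'⟩ := exists_lab_not_oneTwo c (h0 v)
      refine ⟨_, s, 0, lab_elim ha h hc, fun _ => h0 s, h2, ?_⟩
      rintro (d' | d' | d' | z) hd'
      · exact absurd hd' (ha' d')
      · exact (h3 d' hd').imp (congrArg _) (congrArg _)
      · exact absurd hd' (hc' d')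
      · cases z
        exacts [absurd hd' (h0' s), absurd hd' (h0 s)]
    · obtain ⟨ν, v, t, h, -, h2, h3⟩ := ihc (k := true) hd
      obtain ⟨νa, ha, ha'⟩ := exists_lab_not_oneTwo a (h0' t)
      obtain ⟨νb, hb, hb'⟩ := exists_lab_not_oneTwo b (h0' v)
      refine ⟨_, 0, t, lab_elim ha hb h, fun _ => h0' t, h2, ?_⟩
      rintro (d' | d' | d' | z) hd'
      · exact absurd hd' (ha' d')
      · exact absurd hd' (hb' d')
      · exact (h3 d' hd').imp (congrArg _) (congrArg _)
      · cases z
        exacts [absurd hd' (h0 t), absurd hd' (h0' t)]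
    · exact absurd hd id

theorem origin_ne_closed (a b c : Tern) (d : (closed a b c).Dart) :
    (closed a b c).origin d ≠ (closed a b c).origin ((closed a b c).rev d) := by
  suffices h : ∃ ν : (closed a b c).Dart → ℕ, (closed a b c).VertexLab ν ∧
      ν d ≠ ν ((closed a b c).rev d) by
    obtain ⟨ν, h, h'⟩ := h
    exact fun e => h' (h.eq_of_origin_eq e)
  rcases d with d | d | d | d
  · obtain ⟨ν, h, h'⟩ := exists_lab_loopless a zero_ne_one d
    obtain ⟨νc, hc, -⟩ := exists_lab c 0 1
    exact ⟨_, vertexLab_elim h (lab_const _ 0) hc, h'⟩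
  · obtain ⟨ν, h, h'⟩ := exists_lab_loopless b zero_ne_one d
    obtain ⟨νa, ha, -⟩ := exists_lab a 0 1
    exact ⟨_, vertexLab_elim ha h (lab_const _ 1), h'⟩
  · obtain ⟨ν, h, h'⟩ := exists_lab_loopless c zero_ne_one d
    obtain ⟨νa, ha, -⟩ := exists_lab a 0 1
    exact ⟨_, vertexLab_elim ha (lab_const _ 0) h, h'⟩
  · exact d.elim

theorem exists_vertexLab_isolated {a b c : Tern} {d : (closed a b c).Dart}
    (hd : d ∈ closedIsolated a b c) :
    ∃ ν : (closed a b c).Dart → ℕ, (closed a b c).VertexLab ν ∧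
      OneTwo (ν d) (ν ((closed a b c).rev d)) ∧
      ∀ d', OneTwo (ν d') (ν ((closed a b c).rev d')) → d' = d ∨ d' = (closed a b c).rev d := by
  have h0 : ∀ n, ¬ OneTwo n 0 := by unfold OneTwo; omega
  have h0' : ∀ n, ¬ OneTwo 0 n := by unfold OneTwo; omega
  rcases d with d | d | d | d
  · obtain ⟨ν, s, t, h, -, h2, h3⟩ := exists_lab_isolated (k := true) hd
    obtain ⟨νb, hb, hb'⟩ := exists_lab_not_oneTwo b (h0 s)
    obtain ⟨νc, hc, hc'⟩ := exists_lab_not_oneTwo c (h0' t)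
    refine ⟨_, vertexLab_elim h hb hc, h2, ?_⟩
    rintro (d' | d' | d' | z) hd'
    exacts [(h3 d' hd').imp (congrArg _) (congrArg _), absurd hd' (hb' d'), absurd hd' (hc' d'),
      z.elim]
  · obtain ⟨ν, s, v, h, -, h2, h3⟩ := exists_lab_isolated (k := true) hd
    obtain ⟨νa, ha, ha'⟩ := exists_lab_not_oneTwo a (h0 s)
    obtain ⟨νc, hc, hc'⟩ := exists_lab_not_oneTwo c (h0 v)
    refine ⟨_, vertexLab_elim ha h hc, h2, ?_⟩
    rintro (d' | d' | d' | z) hd'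
    exacts [absurd hd' (ha' d'), (h3 d' hd').imp (congrArg _) (congrArg _), absurd hd' (hc' d'),
      z.elim]
  · obtain ⟨ν, v, t, h, -, h2, h3⟩ := exists_lab_isolated (k := true) hd
    obtain ⟨νa, ha, ha'⟩ := exists_lab_not_oneTwo a (h0' t)
    obtain ⟨νb, hb, hb'⟩ := exists_lab_not_oneTwo b (h0' v)
    refine ⟨_, vertexLab_elim ha hb h, h2, ?_⟩
    rintro (d' | d' | d' | z) hd'
    exacts [absurd hd' (ha' d'), absurd hd' (hb' d'), (h3 d' hd').imp (congrArg _) (congrArg _),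
      z.elim]
  · exact d.elim

/-- A labelling showing the pair 1, 2 along a single edge excludes parallels. Conversely, `origin`
is a labelling, to which `exists_parallel` applies. -/
theorem inTwoCycle_closed_iff {a b c : Tern} (d : (closed a b c).Dart) :
    (closed a b c).InTwoCycle d ↔ d ∉ closedIsolated a b c := by
  constructor
  · rintro ⟨-, d', h1, h2, h3⟩ hd
    obtain ⟨ν, hν, h, h'⟩ := exists_vertexLab_isolated hd
    have : OneTwo (ν d') (ν ((closed a b c).rev d')) := by
      rcases Sym2.eq_iff.1 h3 with ⟨e1, e2⟩ | ⟨e1, e2⟩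
      · rwa [hν.eq_of_origin_eq e1, hν.eq_of_origin_eq e2]
      · rw [hν.eq_of_origin_eq e1, hν.eq_of_origin_eq e2]
        unfold OneTwo at *
        omega
    exact (h' d' this).elim h1 h2
  · intro hd
    refine ⟨origin_ne_closed a b c d, ?_⟩
    obtain ⟨s, t, v, ha, hb, hc⟩ := vertexLab_closed.1 (closed a b c).vertexLab_origin
    rcases d with d | d | d | d
    · rcases exists_parallel (k := true) hd ha with ⟨h, -⟩ | ⟨d', h1, h2, h3, h4⟩
      · cases h
      · exact ⟨inA d', fun e => h1 (inA.inj e), fun e => h2 (inA.inj e),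
          Sym2.eq_iff.2 (Or.inl ⟨h3, h4⟩)⟩
    · rcases exists_parallel (k := true) hd hb with ⟨h, -⟩ | ⟨d', h1, h2, h3, h4⟩
      · cases h
      · exact ⟨inB d', fun e => h1 (inB.inj e), fun e => h2 (inB.inj e),
          Sym2.eq_iff.2 (Or.inl ⟨h3, h4⟩)⟩
    · rcases exists_parallel (k := true) hd hc with ⟨h, -⟩ | ⟨d', h1, h2, h3, h4⟩
      · cases h
      · exact ⟨inC d', fun e => h1 (inC.inj e), fun e => h2 (inC.inj e),
          Sym2.eq_iff.2 (Or.inl ⟨h3, h4⟩)⟩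
    · exact d.elim

theorem u_notMem_isolated (g : Tern) : g.reg.u ∉ isolated false g := by
  induction g with
  | leaf => exact fun h => by cases h
  | node a b c iha _ _ => exact iha

/-- The root is the dart `u` of the leftmost leaf of `a`; if `a` is a node, this leaf occupies a
first slot and has a parallel edge. -/
theorem eq_leaf_of_root_isolated {a b c : Tern} (h : root a b c ∈ closedIsolated a b c) :
    a = leaf := by
  cases a with
  | leaf => rfl
  | node a₁ a₂ a₃ => exact absurd h (u_notMem_isolated a₁)

end Tern

theorem Glue.ncard_eq {A B C Z : Type} [Finite A] [Finite B] [Finite C] [Finite Z]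
    (T : Set (Glue A B C Z)) : T.ncard = (Glue.inA ⁻¹' T).ncard + (Glue.inB ⁻¹' T).ncard +
      ((Glue.inC ⁻¹' T).ncard + (Glue.nw ⁻¹' T).ncard) := by
  have e : T ≃ ((Glue.inA ⁻¹' T : Set A) ⊕ (Glue.inB ⁻¹' T : Set B)) ⊕
      ((Glue.inC ⁻¹' T : Set C) ⊕ (Glue.nw ⁻¹' T : Set Z)) :=
    { toFun := fun d => match d with
        | ⟨.inA d, h⟩ => .inl (.inl ⟨d, h⟩)
        | ⟨.inB d, h⟩ => .inl (.inr ⟨d, h⟩)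
        | ⟨.inC d, h⟩ => .inr (.inl ⟨d, h⟩)
        | ⟨.nw d, h⟩ => .inr (.inr ⟨d, h⟩)
      invFun := fun d => match d with
        | .inl (.inl d) => ⟨.inA d.1, d.2⟩
        | .inl (.inr d) => ⟨.inB d.1, d.2⟩
        | .inr (.inl d) => ⟨.inC d.1, d.2⟩
        | .inr (.inr d) => ⟨.nw d.1, d.2⟩
      left_inv := by rintro ⟨d | d | d | d, h⟩ <;> rfl
      right_inv := by rintro ((d | d) | (d | d)) <;> rfl }
  have := Nat.card_congr e
  rwa [Nat.card_sum, Nat.card_sum, Nat.card_sum] at this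

/-! ### Spanning trees and forests in regions -/

namespace CombMap

/-- The labelling `ν` is constant on the edges belonging to `T`. -/
def Compat (M : CombMap) (ν : M.Dart → Bool) (T : Set M.Dart) : Prop :=
  ∀ d ∈ T, ν d = ν (M.rev d)

end CombMap

namespace Region

open Glue CombMap

/-- The edges of `T` connect the two ends of the region. -/
def Conn (R : Region) (T : Set R.Dart) : Prop :=
  ∀ (ν : R.Dart → Bool) (s t : Bool), R.Lab ν s t → R.Compat ν T → s = t

/-- The edges of `T` connect all vertices of the region, once its ends are identified. -/
def Spans (R : Region) (T : Set R.Dart) : Prop :=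
  ∀ (ν : R.Dart → Bool) (s : Bool), R.Lab ν s s → R.Compat ν T → ∀ d, ν d = s

/-- Negating a labelling that separates the ends exchanges their values; equal values are realized
by a constant. -/
theorem exists_of_not_conn {R : Region} {T : Set R.Dart} (h : ¬ R.Conn T) (s t : Bool) :
    ∃ ν : R.Dart → Bool, R.Lab ν s t ∧ R.Compat ν T := by
  unfold Conn at h
  push Not at h
  obtain ⟨ν, s', t', hν, hT, hne⟩ := h
  by_cases e : s = t
  · exact ⟨fun _ => s, e ▸ lab_const R s, fun _ _ => rfl⟩
  have key : ∀ s t s' t' : Bool, s ≠ t → s' ≠ t' →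
      (s = s' ∧ t = t') ∨ (s = (!s') ∧ t = (!t')) := by decide
  rcases key s t s' t' e hne with ⟨rfl, rfl⟩ | ⟨rfl, rfl⟩
  · exact ⟨ν, hν, hT⟩
  · exact ⟨fun d => !(ν d), hν.comp not, fun d hd => congrArg not (hT d hd)⟩

end Region

namespace Tern

open Glue CombMap Region

section

variable {a b c : Tern} {T : Set (Glue a.reg.Dart b.reg.Dart c.reg.Dart Bool)}

theorem compat_node_elim {νa : a.reg.Dart → Bool} {νb : b.reg.Dart → Bool} {νc : c.reg.Dart → Bool}
    {k : Bool → Bool} (hT : ∀ z, nw z ∉ T) (ha : a.reg.Compat νa (inA ⁻¹' T))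
    (hb : b.reg.Compat νb (inB ⁻¹' T)) (hc : c.reg.Compat νc (inC ⁻¹' T)) :
    (Region.node a.reg b.reg c.reg).Compat (Glue.elim νa νb νc k) T := by
  rintro (d | d | d | z) hd
  exacts [ha d hd, hb d hd, hc d hd, absurd hd (hT z)]

theorem compat_const (R : Region) (T : Set R.Dart) (s : Bool) : R.Compat (fun _ => s) T :=
  fun _ _ => rfl

/-- The ends are joined within `a`, or through the apex along `b` and `c`. Failing both, a
separating labelling of `a` extends: the apex gets `true` if `b` is cut and `false` if `c` is cut.
-/
theorem conn_node (hT : ∀ z, nw z ∉ T) : (Region.node a.reg b.reg c.reg).Conn T ↔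
    a.reg.Conn (inA ⁻¹' T) ∨ (b.reg.Conn (inB ⁻¹' T) ∧ c.reg.Conn (inC ⁻¹' T)) := by
  constructor
  · intro h
    by_contra hn
    rw [not_or, not_and_or] at hn
    obtain ⟨ha, hbc⟩ := hn
    obtain ⟨νa, ha, ha'⟩ := exists_of_not_conn ha false true
    rcases hbc with hb | hc
    · obtain ⟨νb, hb, hb'⟩ := exists_of_not_conn hb false true
      exact absurd (h _ _ _ (lab_elim ha hb (lab_const _ true))
        (compat_node_elim hT ha' hb' (compat_const _ _ _))) (by simp)
    · obtain ⟨νc, hc, hc'⟩ := exists_of_not_conn hc false true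
      exact absurd (h _ _ _ (lab_elim ha (lab_const _ false) hc)
        (compat_node_elim hT ha' (compat_const _ _ _) hc')) (by simp)
  · intro h ν s t hν hc
    obtain ⟨v, h1, h2, h3, -, -⟩ := lab_node.1 hν
    rcases h with h | ⟨h, h'⟩
    · exact h _ _ _ h1 fun d hd => hc _ hd
    · exact (h _ _ _ h2 fun d hd => hc _ hd).trans (h' _ _ _ h3 fun d hd => hc _ hd)

/-- Once the ends are identified, the apex can be tied to them only through `b` or `c`; if both are
cut, the apex can be labelled differently. -/
theorem spans_node (hT : ∀ z, nw z ∉ T) : (Region.node a.reg b.reg c.reg).Spans T ↔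
    a.reg.Spans (inA ⁻¹' T) ∧ b.reg.Spans (inB ⁻¹' T) ∧ c.reg.Spans (inC ⁻¹' T) ∧
      (b.reg.Conn (inB ⁻¹' T) ∨ c.reg.Conn (inC ⁻¹' T)) := by
  constructor
  · intro h
    refine ⟨fun ν s hν hc d => ?_, fun ν s hν hc d => ?_, fun ν s hν hc d => ?_, ?_⟩
    · exact h _ s (lab_elim hν (lab_const _ s) (lab_const _ s))
        (compat_node_elim hT hc (compat_const _ _ _) (compat_const _ _ _)) (inA d)
    · exact h _ s (lab_elim (lab_const _ s) hν (lab_const _ s))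
        (compat_node_elim hT (compat_const _ _ _) hc (compat_const _ _ _)) (inB d)
    · exact h _ s (lab_elim (lab_const _ s) (lab_const _ s) hν)
        (compat_node_elim hT (compat_const _ _ _) (compat_const _ _ _) hc) (inC d)
    · by_contra hn
      rw [not_or] at hn
      obtain ⟨νb, hb, hb'⟩ := exists_of_not_conn hn.1 false true
      obtain ⟨νc, hc, hc'⟩ := exists_of_not_conn hn.2 true false
      have := h _ false (lab_elim (lab_const _ false) hb hc)
        (compat_node_elim hT (compat_const _ _ _) hb' hc') (inB b.reg.w)
      exact Bool.false_ne_true (this.symm.trans hb.2.1)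
  · rintro ⟨ha, hb, hc, h⟩ ν s hν hT'
    obtain ⟨v, h1, h2, h3, h4, h5⟩ := lab_node.1 hν
    have hsv : s = v := by
      rcases h with h | h
      · exact h _ _ _ h2 fun d hd => hT' _ hd
      · exact (h _ _ _ h3 fun d hd => hT' _ hd).symm
    subst hsv
    rintro (d | d | d | z)
    · exact ha _ _ h1 (fun d hd => hT' _ hd) d
    · exact hb _ _ h2 (fun d hd => hT' _ hd) d
    · exact hc _ _ h3 (fun d hd => hT' _ hd) d
    · cases z
      exacts [h4, h5]

end

/-- The admissible edge sets in a region: they form a spanning tree (if `k` is true), or a spanning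
forest with two components that separate the two ends (if `k` is false), and contain no edge that
has a parallel edge. The flag `s` tells whether a single-edge region may contribute its edge. -/
def State : Bool → Bool → (g : Tern) → Set g.reg.Dart → Prop
  | s, k, leaf, T => (T = ∅ ∧ k = false) ∨ (s = true ∧ k = true ∧ T = Set.univ)
  | _, k, node a b c, T => ∃ T' : Set (Glue a.reg.Dart b.reg.Dart c.reg.Dart Bool), T' = T ∧
      ∃ i j l, State false i a (inA ⁻¹' T') ∧ State true j b (inB ⁻¹' T') ∧
      State true l c (inC ⁻¹' T') ∧ (∀ z, nw z ∉ T') ∧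
      -- If exactly one of `b`, `c` is connected, the apex hangs on one end and the ends are joined
      -- only if `a` joins them. If both are, the path through the apex joins the ends and `a` must
      -- not, lest a cycle appear.
      ((j ≠ l ∧ k = i) ∨ (j = true ∧ l = true ∧ i = false ∧ k = true))

theorem bool_set_cases {T : Set Bool} (h : ∀ d ∈ T, (!d) ∈ T) : T = ∅ ∨ T = Set.univ := by
  by_cases h0 : false ∈ T
  · right
    ext (_ | _)
    exacts [iff_of_true h0 trivial, iff_of_true (h _ h0) trivial]
  · left
    ext (_ | _)
    exacts [iff_of_false h0 id, iff_of_false (fun h' => h0 (h _ h')) id]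

theorem conn_leaf {T : Set Bool} (h : ∀ d ∈ T, (!d) ∈ T) :
    Region.single.Conn T ↔ T = Set.univ := by
  constructor
  · intro hc
    rcases bool_set_cases h with rfl | h
    · exact absurd (hc (fun b => b) false true (lab_single.2 ⟨rfl, rfl⟩) (fun _ h => h.elim)) (by simp)
    · exact h
  · rintro rfl ν s t hν hc
    rw [lab_single] at hν
    rw [← hν.1, ← hν.2]
    exact hc false trivial

theorem exists_bool_iff (p : Prop) : ∃ k : Bool, p ↔ k = true := by
  by_cases hp : p
  exacts [⟨true, by simp [hp]⟩, ⟨false, by simp [hp]⟩]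

theorem le_ncard_add {p q r x y z : ℕ} {i j l k : Bool} (hbc : j = true ∨ l = true)
    (hk : i = true ∨ (j = true ∧ l = true) ↔ k = true) (hx : 2 * (p + i.toNat) ≤ x)
    (hy : 2 * (q + j.toNat) ≤ y) (hz : 2 * (r + l.toNat) ≤ z) :
    2 * (p + q + r + 1 + k.toNat) ≤ x + y + z := by
  cases i <;> cases j <;> cases l <;> cases k <;>
    simp only [Bool.toNat_true, Bool.toNat_false] at * <;> simp at hbc hk <;> omega

/-- A local form of the bound on the number of edges of a connected graph: one edge for each inner
vertex, one more if the ends are joined. The factor 2 counts both darts of an edge. -/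
theorem le_ncard_of_spans {s k : Bool} {g : Tern} {T : Set g.reg.Dart}
    (hsymm : ∀ d ∈ T, g.reg.rev d ∈ T) (hiso : T ⊆ isolated s g) (hT : g.reg.Spans T)
    (hk : g.reg.Conn T ↔ k = true) : 2 * (g.size + k.toNat) ≤ T.ncard := by
  induction g generalizing s k with
  | leaf =>
    cases k with
    | false => simp [size]
    | true =>
      rw [(conn_leaf hsymm).1 (hk.2 rfl)]
      refine le_of_eq ((Set.ncard_univ Bool).trans ?_).symm
      simp [size]
  | node a b c iha ihb ihc =>
    change Set (Glue a.reg.Dart b.reg.Dart c.reg.Dart Bool) at T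
    have hN : ∀ z, nw z ∉ T := fun z hz => hiso hz
    obtain ⟨ha, hb, hc, hbc⟩ := (spans_node hN).1 hT
    have hk' := (conn_node hN).symm.trans hk
    obtain ⟨i, hi⟩ := exists_bool_iff (a.reg.Conn (inA ⁻¹' T))
    obtain ⟨j, hj⟩ := exists_bool_iff (b.reg.Conn (inB ⁻¹' T))
    obtain ⟨l, hl⟩ := exists_bool_iff (c.reg.Conn (inC ⁻¹' T))
    have ha' := iha (T := inA ⁻¹' T) (fun d hd => hsymm _ hd) (fun d hd => hiso hd) ha hi
    have hb' := ihb (T := inB ⁻¹' T) (fun d hd => hsymm _ hd) (fun d hd => hiso hd) hb hj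
    have hc' := ihc (T := inC ⁻¹' T) (fun d hd => hsymm _ hd) (fun d hd => hiso hd) hc hl
    rw [hj, hl] at hbc
    rw [hi, hj, hl] at hk'
    have hcard := Glue.ncard_eq T
    change _ ≤ T.ncard
    have := le_ncard_add hbc hk' ha' hb' hc'
    rw [size]
    omega

theorem state_ncard {p q r x y z : ℕ} {i j l k : Bool} (hbc : j = true ∨ l = true)
    (hk : i = true ∨ (j = true ∧ l = true) ↔ k = true) (hx : 2 * (p + i.toNat) ≤ x)
    (hy : 2 * (q + j.toNat) ≤ y) (hz : 2 * (r + l.toNat) ≤ z)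
    (h : 2 * (p + q + r + 1 + k.toNat) = x + y + z) :
    x = 2 * (p + i.toNat) ∧ y = 2 * (q + j.toNat) ∧ z = 2 * (r + l.toNat) ∧
      ((j ≠ l ∧ k = i) ∨ (j = true ∧ l = true ∧ i = false ∧ k = true)) := by
  cases i <;> cases j <;> cases l <;> cases k <;>
    simp only [Bool.toNat_true, Bool.toNat_false] at * <;> simp at hbc hk ⊢ <;> omega

theorem state_arith {i j l k : Bool}
    (h : (j ≠ l ∧ k = i) ∨ (j = true ∧ l = true ∧ i = false ∧ k = true)) :
    (j = true ∨ l = true) ∧ (i = true ∨ (j = true ∧ l = true) ↔ k = true) ∧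
      i.toNat + j.toNat + l.toNat = 1 + k.toNat := by
  revert i j l k
  decide

/-- Trees and forests are the cases of equality in `le_ncard_of_spans`. The bounds of the three
parts add up to at least the bound of the node, so equality for the node forces equality in each
part and leaves only the flag combinations allowed in `State`. -/
theorem state_iff {s k : Bool} {g : Tern} {T : Set g.reg.Dart} : State s k g T ↔
    (∀ d ∈ T, g.reg.rev d ∈ T) ∧ T ⊆ isolated s g ∧ g.reg.Spans T ∧ (g.reg.Conn T ↔ k = true) ∧
      T.ncard = 2 * (g.size + k.toNat) := by
  induction g generalizing s k with
  | leaf =>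
    have hspan : Region.single.Spans T := by
      intro ν s h _ d
      rw [lab_single] at h
      cases (d : Bool)
      exacts [h.1, h.2]
    change Set Bool at T
    constructor
    · rintro (⟨rfl, rfl⟩ | ⟨rfl, rfl, rfl⟩)
      · refine ⟨fun _ h => h.elim, fun _ h => h.elim, hspan, ?_, by simp [size]⟩
        rw [show leaf.reg.Conn ∅ ↔ _ from conn_leaf (T := ∅) (fun _ h => h.elim)]
        exact iff_of_false Set.empty_ne_univ Bool.false_ne_true
      · refine ⟨fun _ h => trivial, fun _ h => rfl, hspan, ?_, ?_⟩
        · rw [show leaf.reg.Conn Set.univ ↔ _ from conn_leaf (T := Set.univ) (fun _ h => trivial)]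
          simp
        · refine (Set.ncard_univ Bool).trans ?_
          simp [size]
    · rintro ⟨h1, h2, -, h4, -⟩
      rw [show leaf.reg.Conn T ↔ _ from conn_leaf h1] at h4
      rcases bool_set_cases h1 with h | h
      · left
        refine ⟨h, ?_⟩
        rw [h] at h4
        cases k
        · rfl
        · exact absurd (h4.2 rfl) Set.empty_ne_univ
      · right
        subst h
        exact ⟨h2 (show false ∈ Set.univ from trivial), h4.1 rfl, rfl⟩
  | node a b c iha ihb ihc =>
    change Set (Glue a.reg.Dart b.reg.Dart c.reg.Dart Bool) at T
    have hcard := Glue.ncard_eq T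
    constructor
    · rintro ⟨T, rfl, i, j, l, hi, hj, hl, hN, h⟩
      obtain ⟨a1, a2, a3, a4, a5⟩ := iha.1 hi
      obtain ⟨b1, b2, b3, b4, b5⟩ := ihb.1 hj
      obtain ⟨c1, c2, c3, c4, c5⟩ := ihc.1 hl
      have hz : nw ⁻¹' T = ∅ := Set.eq_empty_of_forall_notMem hN
      rw [hz, Set.ncard_empty, a5, b5, c5] at hcard
      refine ⟨?_, ?_, (spans_node hN).2 ⟨a3, b3, c3, ?_⟩, (conn_node hN).trans ?_,
        hcard.trans ?_⟩
      · rintro (d | d | d | z) hd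
        exacts [a1 d hd, b1 d hd, c1 d hd, absurd hd (hN z)]
      · rintro (d | d | d | z) hd
        exacts [a2 hd, b2 hd, c2 hd, absurd hd (hN z)]
      · rw [b4, c4]
        exact (state_arith h).1
      · rw [a4, b4, c4]
        exact (state_arith h).2.1
      · rw [size]
        have := (state_arith h).2.2
        omega
    · rintro ⟨h1, h2, h3, h4, h5⟩
      have hN : ∀ z, nw z ∉ T := fun z hz => h2 hz
      have hz : nw ⁻¹' T = ∅ := Set.eq_empty_of_forall_notMem hN
      obtain ⟨ha, hb, hc, hbc⟩ := (spans_node hN).1 h3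
      have hk' := (conn_node hN).symm.trans h4
      change T.ncard = _ at h5
      rw [hz, Set.ncard_empty, h5, size] at hcard
      have a1 : ∀ d ∈ inA ⁻¹' T, a.reg.rev d ∈ inA ⁻¹' T := fun d hd => h1 _ hd
      have b1 : ∀ d ∈ inB ⁻¹' T, b.reg.rev d ∈ inB ⁻¹' T := fun d hd => h1 _ hd
      have c1 : ∀ d ∈ inC ⁻¹' T, c.reg.rev d ∈ inC ⁻¹' T := fun d hd => h1 _ hd
      have a2 : inA ⁻¹' T ⊆ isolated false a := fun d hd => h2 hd
      have b2 : inB ⁻¹' T ⊆ isolated true b := fun d hd => h2 hd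
      have c2 : inC ⁻¹' T ⊆ isolated true c := fun d hd => h2 hd
      obtain ⟨i, hi⟩ := exists_bool_iff (a.reg.Conn (inA ⁻¹' T))
      obtain ⟨j, hj⟩ := exists_bool_iff (b.reg.Conn (inB ⁻¹' T))
      obtain ⟨l, hl⟩ := exists_bool_iff (c.reg.Conn (inC ⁻¹' T))
      have ha' := le_ncard_of_spans a1 a2 ha hi
      have hb' := le_ncard_of_spans b1 b2 hb hj
      have hc' := le_ncard_of_spans c1 c2 hc hl
      rw [hj, hl] at hbc
      rw [hi, hj, hl] at hk'
      have key : (inA ⁻¹' T).ncard = 2 * (a.size + i.toNat) ∧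
          (inB ⁻¹' T).ncard = 2 * (b.size + j.toNat) ∧
          (inC ⁻¹' T).ncard = 2 * (c.size + l.toNat) ∧
          ((j ≠ l ∧ k = i) ∨ (j = true ∧ l = true ∧ i = false ∧ k = true)) := by
        exact state_ncard hbc hk' ha' hb' hc' (by omega)
      exact ⟨T, rfl, i, j, l, iha.2 ⟨a1, a2, ha, hi, key.1⟩, ihb.2 ⟨b1, b2, hb, hj, key.2.1⟩,
        ihc.2 ⟨c1, c2, hc, hl, key.2.2.1⟩, hN, key.2.2.2⟩

end Tern

/-! ### Spanning trees by labellings and edge count -/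

namespace CombMap

theorem ends_eq_iff (M : CombMap) {d d' : M.Dart} : M.ends d = M.ends d' ↔
    (M.origin d = M.origin d' ∧ M.origin (M.rev d) = M.origin (M.rev d')) ∨
      (M.origin d = M.origin (M.rev d') ∧ M.origin (M.rev d) = M.origin d') := Sym2.eq_iff

theorem ends_rev (M : CombMap) (d : M.Dart) : M.ends (M.rev d) = M.ends d := by
  rw [ends_eq_iff, M.rev_rev]
  exact Or.inr ⟨rfl, rfl⟩

theorem finite_vertex (M : CombMap) : Finite M.Vertex :=
  have := M.finite_dart
  Quotient.finite _

theorem ncard_ends_image (M : CombMap) {T : Set M.Dart} (hsymm : ∀ d ∈ T, M.rev d ∈ T)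
    (hpar : ∀ d ∈ T, ∀ d' ∈ T, M.ends d = M.ends d' → d' = d ∨ d' = M.rev d) :
    T.ncard = 2 * (M.ends '' T).ncard := by
  classical
  have := M.finite_dart
  have hfin := T.toFinite
  have h1 : T.ncard = hfin.toFinset.card := Set.ncard_eq_toFinset_card T hfin
  have h2 : (M.ends '' T).ncard = (hfin.toFinset.image M.ends).card := by
    rw [← Set.ncard_coe_finset, Finset.coe_image, hfin.coe_toFinset]
  rw [h1, h2, Finset.card_eq_sum_card_image M.ends hfin.toFinset,
    Finset.sum_const_nat (m := 2), mul_comm]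
  intro e he
  obtain ⟨d, hd, rfl⟩ := Finset.mem_image.1 he
  rw [hfin.mem_toFinset] at hd
  rw [Finset.card_eq_two]
  refine ⟨d, M.rev d, (M.rev_ne d).symm, ?_⟩
  ext x
  simp only [Finset.mem_filter, hfin.mem_toFinset, Finset.mem_insert, Finset.mem_singleton]
  constructor
  · rintro ⟨hx, h⟩
    exact hpar d hd x hx h.symm
  · rintro (rfl | rfl)
    exacts [⟨hd, rfl⟩, ⟨hsymm d hd, M.ends_rev d⟩]

/-- A labelling compatible with `T` is constant along paths in `T`; conversely, reachability from a
fixed vertex is itself such a labelling. -/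
theorem connected_fromEdgeSet_iff (M : CombMap) [Nonempty M.Dart] (T : Set M.Dart)
    (hloop : ∀ d ∈ T, M.origin d ≠ M.origin (M.rev d)) :
    (SimpleGraph.fromEdgeSet (M.ends '' T)).Connected ↔
      ∀ ν : M.Dart → Bool, M.VertexLab ν → M.Compat ν T → ∀ d d', ν d = ν d' := by
  constructor
  · intro h ν hν hT d d'
    have key : ∀ v v' : M.Vertex, (SimpleGraph.fromEdgeSet (M.ends '' T)).Reachable v v' →
        ∀ d d', M.origin d = v → M.origin d' = v' → ν d = ν d' := by
      rintro v v' ⟨p⟩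
      induction p with
      | nil => exact fun d d' h h' => hν.eq_of_origin_eq (h.trans h'.symm)
      | cons hadj p ih =>
        intro d d' h h'
        obtain ⟨⟨x, hx, hxe⟩, -⟩ := (SimpleGraph.fromEdgeSet_adj _).1 hadj
        rcases Sym2.eq_iff.1 hxe with ⟨h1, h2⟩ | ⟨h1, h2⟩
        · exact (hν.eq_of_origin_eq (h.trans h1.symm)).trans ((hT x hx).trans (ih _ _ h2 h'))
        · exact (hν.eq_of_origin_eq (h.trans h2.symm)).trans ((hT x hx).symm.trans (ih _ _ h1 h'))
    exact key _ _ (h.preconnected _ _) d d' rfl rfl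
  · intro h
    have : Nonempty M.Vertex := ⟨M.origin (Classical.arbitrary _)⟩
    refine ⟨fun v v' => ?_⟩
    obtain ⟨d, rfl⟩ : ∃ d, M.origin d = v := Quotient.exists_rep v
    obtain ⟨d', rfl⟩ : ∃ d, M.origin d = v' := Quotient.exists_rep v'
    classical
    have := h (fun x => decide
      ((SimpleGraph.fromEdgeSet (M.ends '' T)).Reachable (M.origin d) (M.origin x))) ?_ ?_ d d'
    · simpa using this
    · intro x
      beta_reduce
      rw [show M.origin (M.face x) = M.origin (M.rev x) from M.vertexLab_origin x]
    · intro x hx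
      have hadj : (SimpleGraph.fromEdgeSet (M.ends '' T)).Adj (M.origin x) (M.origin (M.rev x)) :=
        (SimpleGraph.fromEdgeSet_adj _).2 ⟨⟨x, hx, rfl⟩, hloop x hx⟩
      exact decide_eq_decide.2 ⟨fun h => h.trans hadj.reachable, fun h => h.trans hadj.reachable.symm⟩

/-- A finite graph is a tree when it is connected and has one edge fewer than vertices; as `T`
contains two darts per edge, the count is doubled. -/
theorem isSpanningTree_iff (M : CombMap) [Nonempty M.Dart] (T : Set M.Dart) :
    M.IsSpanningTree T ↔ (∀ d ∈ T, M.rev d ∈ T) ∧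
      (∀ d ∈ T, M.origin d ≠ M.origin (M.rev d)) ∧
      (∀ d ∈ T, ∀ d' ∈ T, M.ends d = M.ends d' → d' = d ∨ d' = M.rev d) ∧
      (∀ ν : M.Dart → Bool, M.VertexLab ν → M.Compat ν T → ∀ d d', ν d = ν d') ∧
      T.ncard + 2 = 2 * M.numVertices := by
  refine and_congr_right fun h1 => and_congr_right fun h2 => and_congr_right fun h3 => ?_
  have := M.finite_vertex
  rw [SimpleGraph.isTree_iff_connected_and_card, M.connected_fromEdgeSet_iff T h2,
    M.ncard_ends_image h1 h3]
  have hd : M.ends '' T \ {e | e.IsDiag} = M.ends '' T := by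
    rw [sdiff_eq_left, Set.disjoint_left]
    rintro _ ⟨d, hd, rfl⟩ h
    exact h2 d hd h
  have hE : Nat.card (SimpleGraph.fromEdgeSet (M.ends '' T)).edgeSet = (M.ends '' T).ncard := by
    rw [SimpleGraph.edgeSet_fromEdgeSet]
    exact congrArg Set.ncard hd
  rw [hE]
  change _ ∧ _ = M.numVertices ↔ _
  refine and_congr_right fun _ => ?_
  omega

section Iso

variable {M N : CombMap} {f : M.Dart ≃ N.Dart} (hf : IsIso f)
include hf

theorem IsIso.vertexLab {X : Type} {ν : N.Dart → X} (h : N.VertexLab ν) :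
    M.VertexLab fun d => ν (f d) := fun x => by
  beta_reduce
  rw [hf.2, hf.1]
  exact h _

theorem IsIso.origin_eq {d d' : M.Dart} :
    N.origin (f d) = N.origin (f d') ↔ M.origin d = M.origin d' := by
  refine ⟨fun h => ?_, fun h => ?_⟩
  · simpa using (hf.symm.vertexLab M.vertexLab_origin).eq_of_origin_eq h
  · exact (hf.vertexLab N.vertexLab_origin).eq_of_origin_eq h

theorem IsIso.ends_eq {d d' : M.Dart} : N.ends (f d) = N.ends (f d') ↔ M.ends d = M.ends d' := by
  rw [ends_eq_iff, ends_eq_iff, ← hf.1, ← hf.1, hf.origin_eq, hf.origin_eq, hf.origin_eq,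
    hf.origin_eq]

theorem IsIso.inTwoCycle_iff {d : M.Dart} : N.InTwoCycle (f d) ↔ M.InTwoCycle d := by
  unfold InTwoCycle
  rw [← hf.1, ne_eq, hf.origin_eq, f.surjective.exists]
  simp only [hf.ends_eq, ne_eq, f.injective.eq_iff]

theorem IsIso.numVertices_eq : M.numVertices = N.numVertices :=
  Nat.card_congr (Quotient.congr f fun _ _ =>
    (M.origin_eq_iff.symm.trans hf.origin_eq.symm).trans N.origin_eq_iff)

theorem IsIso.isSpanningTree [Nonempty M.Dart] {T : Set M.Dart} (h : M.IsSpanningTree T) :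
    N.IsSpanningTree (f '' T) := by
  have : Nonempty N.Dart := ⟨f (Classical.arbitrary _)⟩
  rw [isSpanningTree_iff] at h ⊢
  obtain ⟨h1, h2, h3, h4, h5⟩ := h
  refine ⟨?_, ?_, ?_, fun ν hν hT d d' => ?_, ?_⟩
  · rintro _ ⟨d, hd, rfl⟩
    exact ⟨_, h1 d hd, hf.1 d⟩
  · rintro _ ⟨d, hd, rfl⟩
    rw [← hf.1, ne_eq, hf.origin_eq]
    exact h2 d hd
  · rintro _ ⟨d, hd, rfl⟩ _ ⟨d', hd', rfl⟩ h
    rw [← hf.1, f.injective.eq_iff, f.injective.eq_iff]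
    exact h3 d hd d' hd' (hf.ends_eq.1 h)
  · have := h4 _ (hf.vertexLab hν) (fun d hd => ?_) (f.symm d) (f.symm d')
    · simpa using this
    · beta_reduce
      rw [hf.1]
      exact hT _ ⟨d, hd, rfl⟩
  · rw [Set.ncard_image_of_injective _ f.injective, ← hf.numVertices_eq, h5]

end Iso

end CombMap

/-! ### Spanning trees of closed maps through the root edge -/

namespace Tern

open Glue CombMap Region

theorem compat_closed_elim {a b c : Tern} {T : Set (Glue a.reg.Dart b.reg.Dart c.reg.Dart Empty)}
    {νa : a.reg.Dart → Bool} {νb : b.reg.Dart → Bool} {νc : c.reg.Dart → Bool}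
    (ha : a.reg.Compat νa (inA ⁻¹' T))
    (hb : b.reg.Compat νb (inB ⁻¹' T)) (hc : c.reg.Compat νc (inC ⁻¹' T)) :
    (closed a b c).Compat (Glue.elim νa νb νc Empty.elim) T := by
  rintro (d | d | d | z) hd
  exacts [ha d hd, hb d hd, hc d hd, z.elim]

theorem closed_connected_iff {b c : Tern}
    {T : Set (Glue Bool b.reg.Dart c.reg.Dart Empty)} (hA : inA ⁻¹' T = Set.univ) :
    (∀ ν : (closed leaf b c).Dart → Bool, (closed leaf b c).VertexLab ν →
      (closed leaf b c).Compat ν T → ∀ d d', ν d = ν d') ↔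
      b.reg.Spans (inB ⁻¹' T) ∧ c.reg.Spans (inC ⁻¹' T) ∧
      (b.reg.Conn (inB ⁻¹' T) ∨ c.reg.Conn (inC ⁻¹' T)) := by
  constructor
  · intro h
    have hleaf : ∀ s : Bool, leaf.reg.Compat (fun _ => s) (inA ⁻¹' T) := fun s => compat_const _ _ s
    refine ⟨fun ν s hν hc d => ?_, fun ν s hν hc d => ?_, ?_⟩
    · exact h _ (vertexLab_elim (a := leaf) (lab_const _ s) hν (lab_const _ s))
        (compat_closed_elim (a := leaf) (hleaf s) hc (compat_const _ _ _)) (inB d) (inA false)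
    · exact h _ (vertexLab_elim (a := leaf) (lab_const _ s) (lab_const _ s) hν)
        (compat_closed_elim (a := leaf) (hleaf s) (compat_const _ _ _) hc) (inC d) (inA false)
    · by_contra hn
      rw [not_or] at hn
      obtain ⟨νb, hb, hb'⟩ := exists_of_not_conn hn.1 false true
      obtain ⟨νc, hc, hc'⟩ := exists_of_not_conn hn.2 true false
      have := h _ (vertexLab_elim (a := leaf) (lab_const _ false) hb hc)
        (compat_closed_elim (a := leaf) (hleaf false) hb' hc') (inB b.reg.w) (inA false)
      exact Bool.false_ne_true (this.symm.trans hb.2.1)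
  · rintro ⟨hb, hc, h⟩ ν hν hT
    obtain ⟨s, t, v, h1, h2, h3⟩ := (vertexLab_closed (a := leaf)).1 hν
    have h1' := lab_single.1 h1
    have hst : s = t := by
      rw [← h1'.1, ← h1'.2]
      exact hT (inA false) (by change false ∈ inA ⁻¹' T; rw [hA]; trivial)
    subst hst
    have hsv : s = v := by
      rcases h with h | h
      · exact h _ _ _ h2 fun d hd => hT _ hd
      · exact (h _ _ _ h3 fun d hd => hT _ hd).symm
    subst hsv
    have key : ∀ d, ν d = s := by
      rintro (d | d | d | z)
      · cases (d : Bool)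
        exacts [h1'.1, h1'.2]
      · exact hb _ _ h2 (fun d hd => hT _ hd) d
      · exact hc _ _ h3 (fun d hd => hT _ hd) d
      · exact z.elim
    exact fun d d' => (key d).trans (key d').symm

/-- The root edge joins two corners, and the third must be tied to them through `b` or `c`. A tree
has `b.size + c.size + 2` edges, one of them the root edge; comparing with the lower bounds in `b`
and `c` leaves room for exactly one connected region and forces equality in both bounds. -/
theorem isSpanningTree_closed_iff {b c : Tern}
    {T : Set (Glue Bool b.reg.Dart c.reg.Dart Empty)} (hroot : inA false ∈ T) :
    ((closed leaf b c).IsSpanningTree T ∧ T ⊆ closedIsolated leaf b c) ↔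
      inA ⁻¹' T = Set.univ ∧ ∃ j, State true j b (inB ⁻¹' T) ∧ State true (!j) c (inC ⁻¹' T) := by
  have : Nonempty (closed leaf b c).Dart := ⟨root leaf b c⟩
  have hV := numVertices_closed leaf b c
  have hcard := Glue.ncard_eq T
  have hz : nw ⁻¹' T = ∅ := Set.eq_empty_of_forall_notMem fun z => z.elim
  rw [hz, Set.ncard_empty] at hcard
  constructor
  · rintro ⟨hT, hI⟩
    obtain ⟨h1, -, -, h4, h5⟩ := ((closed leaf b c).isSpanningTree_iff T).1 hT
    rw [hV] at h5
    change T.ncard + 2 = _ at h5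
    have hA : inA ⁻¹' T = Set.univ := by
      rcases bool_set_cases (T := inA ⁻¹' T) (fun d hd => h1 _ hd) with h | h
      · exact absurd (show false ∈ inA ⁻¹' T from hroot) (by rw [h]; exact id)
      · exact h
    obtain ⟨hb, hc, h⟩ := (closed_connected_iff hA).1 h4
    have b1 : ∀ d ∈ inB ⁻¹' T, b.reg.rev d ∈ inB ⁻¹' T := fun d hd => h1 _ hd
    have c1 : ∀ d ∈ inC ⁻¹' T, c.reg.rev d ∈ inC ⁻¹' T := fun d hd => h1 _ hd
    have b2 : inB ⁻¹' T ⊆ isolated true b := fun d hd => hI hd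
    have c2 : inC ⁻¹' T ⊆ isolated true c := fun d hd => hI hd
    obtain ⟨j, hj⟩ := exists_bool_iff (b.reg.Conn (inB ⁻¹' T))
    obtain ⟨l, hl⟩ := exists_bool_iff (c.reg.Conn (inC ⁻¹' T))
    have hb' := le_ncard_of_spans b1 b2 hb hj
    have hc' := le_ncard_of_spans c1 c2 hc hl
    have hu : (inA ⁻¹' T).ncard = 2 := by rw [hA, Set.ncard_univ]; simp
    have hsl : leaf.size = 0 := rfl
    rw [hj, hl] at h
    have key : l = (!j) ∧ (inB ⁻¹' T).ncard = 2 * (b.size + j.toNat) ∧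
        (inC ⁻¹' T).ncard = 2 * (c.size + l.toNat) := by
      clear h1 h4 hI hb hc b1 c1 b2 c2 hj hl
      generalize (inB ⁻¹' T).ncard = x at *
      generalize (inC ⁻¹' T).ncard = y at *
      cases j <;> cases l <;> simp at h hb' hc' ⊢ <;> omega
    obtain ⟨rfl, k1, k2⟩ := key
    exact ⟨hA, j, state_iff.2 ⟨b1, b2, hb, hj, k1⟩, state_iff.2 ⟨c1, c2, hc, hl, k2⟩⟩
  · rintro ⟨hA, j, hb, hc⟩
    obtain ⟨b1, b2, b3, b4, b5⟩ := state_iff.1 hb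
    obtain ⟨c1, c2, c3, c4, c5⟩ := state_iff.1 hc
    have hI : T ⊆ closedIsolated leaf b c := by
      rintro (d | d | d | z) hd
      exacts [rfl, b2 hd, c2 hd, z.elim]
    refine ⟨((closed leaf b c).isSpanningTree_iff T).2 ⟨?_, fun d _ => origin_ne_closed leaf b c d,
      ?_, (closed_connected_iff hA).2 ⟨b3, c3, ?_⟩, ?_⟩, hI⟩
    · rintro (d | d | d | z) hd
      · change (leaf.reg.rev d) ∈ inA ⁻¹' T
        rw [hA]; trivial
      exacts [b1 d hd, c1 d hd, z.elim]
    · intro d hd d' hd' h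
      by_contra hn
      rw [not_or] at hn
      exact (inTwoCycle_closed_iff d).1 ⟨origin_ne_closed leaf b c d, d', hn.1, hn.2, h.symm⟩ (hI hd)
    · rw [b4, c4]
      cases j <;> simp
    · rw [hV]
      change T.ncard + 2 = _
      have hu : (inA ⁻¹' T).ncard = 2 := by rw [hA, Set.ncard_univ]; simp
      have hsl : leaf.size = 0 := rfl
      rw [hcard, hu, b5, c5, hsl]
      cases j <;> simp <;> ring

end Tern

/-! ### Counting admissible edge sets -/

namespace Tern

open Glue CombMap Region

/-- The number of admissible edge sets in a region. -/
noncomputable def numStates (s k : Bool) (g : Tern) : ℕ := {T | State s k g T}.ncard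

/-- The flag records whether `T` joins the ends, so `T` determines it. This makes the unions over
flags below disjoint. -/
theorem State.flag_eq {s s' k k' : Bool} {g : Tern} {T : Set g.reg.Dart} (h : State s k g T)
    (h' : State s' k' g T) : k = k' := by
  have := (state_iff.1 h).2.2.2.1.symm.trans (state_iff.1 h').2.2.2.1
  exact Bool.eq_iff_iff.2 this

theorem numStates_leaf_false (s : Bool) : numStates s false leaf = 1 := by
  refine Set.ncard_eq_one.2 ⟨(∅ : Set Bool), ?_⟩
  ext T
  exact ⟨fun h => h.elim (fun h => h.1) fun h => absurd h.2.1 (by simp), fun h => Or.inl ⟨h, rfl⟩⟩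

theorem numStates_leaf_true : numStates true true leaf = 1 := by
  refine Set.ncard_eq_one.2 ⟨(Set.univ : Set Bool), ?_⟩
  ext T
  exact ⟨fun h => h.elim (fun h => absurd h.2 (by simp)) fun h => h.2.2,
    fun h => Or.inr ⟨rfl, rfl, h⟩⟩

theorem numStates_leaf_false_true : numStates false true leaf = 0 := by
  refine (Set.ncard_eq_zero).2 (Set.eq_empty_of_forall_notMem fun T h => ?_)
  exact h.elim (fun h => absurd h.2 (by simp)) fun h => absurd h.1 (by simp)

section

variable (a b c : Tern)

/-- The edge sets in a region that are composed of admissible edge sets of given types. -/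
def compound (i j l : Bool) : Set (Set (Glue a.reg.Dart b.reg.Dart c.reg.Dart Bool)) :=
  {T | State false i a (inA ⁻¹' T) ∧ State true j b (inB ⁻¹' T) ∧ State true l c (inC ⁻¹' T) ∧
    ∀ z, nw z ∉ T}

theorem ncard_compound (i j l : Bool) : (compound a b c i j l).ncard =
    numStates false i a * (numStates true j b * numStates true l c) := by
  -- A set of darts is a `Prop`-valued function, so the count of functions on a glued set applies.
  refine Eq.trans ?_ (Glue.ncard_elim (X := Prop) {T | State false i a T} {T | State true j b T}
    {T | State true l c T} (fun _ : Bool => False))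
  congr 1
  ext T
  refine and_congr_right fun _ => and_congr_right fun _ => and_congr_right fun _ => ?_
  exact forall_congr' fun z => ⟨fun h => eq_false h, fun h => of_eq_false h⟩

theorem disjoint_compound {i j l i' j' l' : Bool} (h : (i, j, l) ≠ (i', j', l')) :
    Disjoint (compound a b c i j l) (compound a b c i' j' l') := by
  rw [Set.disjoint_left]
  rintro T ⟨h1, h2, h3, -⟩ ⟨h1', h2', h3', -⟩
  exact h (by rw [h1.flag_eq h1', h2.flag_eq h2', h3.flag_eq h3'])

theorem state_node_iff (s k : Bool) (T : Set (Glue a.reg.Dart b.reg.Dart c.reg.Dart Bool)) :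
    State s k (node a b c) T ↔ ∃ i j l, T ∈ compound a b c i j l ∧
      ((j ≠ l ∧ k = i) ∨ (j = true ∧ l = true ∧ i = false ∧ k = true)) := by
  constructor
  · rintro ⟨T, rfl, i, j, l, h1, h2, h3, h4, h5⟩
    exact ⟨i, j, l, ⟨h1, h2, h3, h4⟩, h5⟩
  · rintro ⟨i, j, l, ⟨h1, h2, h3, h4⟩, h5⟩
    exact ⟨T, rfl, i, j, l, h1, h2, h3, h4, h5⟩

theorem numStates_node_false (s : Bool) : numStates s false (node a b c) =
    numStates false false a * (numStates true true b * numStates true false c) +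
    numStates false false a * (numStates true false b * numStates true true c) := by
  rw [← ncard_compound, ← ncard_compound, ← Set.ncard_union_eq (disjoint_compound a b c (by simp))]
  refine congrArg Set.ncard (Set.ext fun T => (state_node_iff a b c s false T).trans ?_)
  constructor
  · rintro ⟨i, j, l, h, ⟨h1, h2⟩ | ⟨-, -, -, h1⟩⟩
    · cases j <;> cases l <;> cases i <;>
        first | exact absurd rfl h1 | exact Or.inl h | exact Or.inr h | cases h2
    · exact absurd h1 (by simp)
  · rintro (h | h)
    exacts [⟨_, _, _, h, by simp⟩, ⟨_, _, _, h, by simp⟩]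

theorem numStates_node_true (s : Bool) : numStates s true (node a b c) =
    numStates false true a * (numStates true true b * numStates true false c) +
    numStates false true a * (numStates true false b * numStates true true c) +
    numStates false false a * (numStates true true b * numStates true true c) := by
  rw [← ncard_compound, ← ncard_compound, ← ncard_compound,
    ← Set.ncard_union_eq (disjoint_compound a b c (by simp)),
    ← Set.ncard_union_eq (Set.disjoint_union_left.2 ⟨disjoint_compound a b c (by simp),
      disjoint_compound a b c (by simp)⟩)]
  refine congrArg Set.ncard (Set.ext fun T => (state_node_iff a b c s true T).trans ?_)
  constructor
  · rintro ⟨i, j, l, h, ⟨h1, rfl⟩ | ⟨rfl, rfl, rfl, -⟩⟩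
    · cases j <;> cases l <;>
        first | exact absurd rfl h1 | exact Or.inl (Or.inl h) | exact Or.inl (Or.inr h)
    · exact Or.inr h
  · rintro ((h | h) | h)
    exacts [⟨_, _, _, h, by simp⟩, ⟨_, _, _, h, by simp⟩, ⟨_, _, _, h, by simp⟩]

/-- The pairs of admissible edge sets that form a spanning tree together with the root edge. -/
def treePairs (b c : Tern) : Set (Set b.reg.Dart × Set c.reg.Dart) :=
  {p | ∃ j, State true j b p.1 ∧ State true (!j) c p.2}

theorem ncard_treePairs (b c : Tern) : (treePairs b c).ncard =
    numStates true true b * numStates true false c +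
      numStates true false b * numStates true true c := by
  unfold numStates
  rw [← Set.ncard_prod, ← Set.ncard_prod, ← Set.ncard_union_eq]
  · congr 1
    ext ⟨T, T'⟩
    constructor
    · rintro ⟨_ | _, h⟩
      exacts [Or.inr h, Or.inl h]
    · rintro (h | h)
      exacts [⟨true, h⟩, ⟨false, h⟩]
  · rw [Set.disjoint_left]
    rintro ⟨T, T'⟩ h h'
    exact absurd (State.flag_eq h.1 h'.1) (by simp)

end

end Tern

/-! ### Bijection between codes and decorated triangulations -/

namespace Tern

open Glue CombMap Region

/-- The edge set of a closed map that consists of the root edge and of given edge sets in the two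
other regions. -/
def planted {b c : Tern} (p : Set b.reg.Dart × Set c.reg.Dart) :
    Set (Glue Bool b.reg.Dart c.reg.Dart Empty) :=
  {d | Glue.elim (fun _ => True) (· ∈ p.1) (· ∈ p.2) (fun _ => False) d}

theorem planted_spec {b c : Tern} {p : Set b.reg.Dart × Set c.reg.Dart} (hp : p ∈ treePairs b c) :
    (closed leaf b c).IsSpanningTree (planted p) ∧ planted p ⊆ closedIsolated leaf b c :=
  (isSpanningTree_closed_iff (T := planted p) (show inA false ∈ planted p from trivial)).2 ⟨rfl, hp⟩

/-- The decorated triangulation coded by a pair of ternary trees and edge sets. -/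
noncomputable def decorated (b c : Tern) (p : Set b.reg.Dart × Set c.reg.Dart)
    (hp : p ∈ treePairs b c) : TreeDecorated where
  map := closed leaf b c
  planar := isPlanar_closed leaf b c
  triangulation := (isHierarchical_closed leaf b c).facesAreTriangles.isTriangulation
  root := root leaf b c
  tree := planted p
  spanning := (planted_spec hp).1
  root_mem := trivial

/-- The rooted map determines `b` and `c`. The isomorphism then fixes the root, hence is the
identity, and the two edge sets coincide dart by dart. -/
theorem eq_of_decorated_iso {b c b' c' : Tern} {p : Set b.reg.Dart × Set c.reg.Dart}
    {p' : Set b'.reg.Dart × Set c'.reg.Dart} {hp : p ∈ treePairs b c} {hp' : p' ∈ treePairs b' c'}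
    (h : (decorated b c p hp).Iso (decorated b' c' p' hp')) :
    (⟨(b, c), p⟩ : Σ q : Tern × Tern, Set q.1.reg.Dart × Set q.2.reg.Dart) = ⟨(b', c'), p'⟩ := by
  obtain ⟨f, h1, h2, h3, h4⟩ := h
  have hf : IsIso (M := closed leaf b c) (N := closed leaf b' c') f := ⟨h1, h2⟩
  obtain ⟨rfl, rfl⟩ := eq_of_closed_leaf_iso hf h3
  have hid := eq_id_of_closed_iso hf h3
  have key : ∀ d, d ∈ planted p' ↔ d ∈ planted p := fun d => by
    have h := h4 d
    have e : f d = d := hid d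
    rw [e] at h
    exact h
  have : p = p' := Prod.ext (Set.ext fun d => (key (inB d)).symm) (Set.ext fun d => (key (inC d)).symm)
  rw [this]

theorem mk_decorated_mem (b c : Tern) (p : Set b.reg.Dart × Set c.reg.Dart)
    (hp : p ∈ treePairs b c) : Quotient.mk TreeDecorated.isoSetoid (decorated b c p hp) ∈
      hierarchicalFamily (b.size + c.size + 2) := by
  refine ⟨_, rfl, ?_, isHierarchical_closed leaf b c, fun d hd h => ?_⟩
  · refine (numVertices_closed leaf b c).trans ?_
    rw [show leaf.size = 0 from rfl]
    ring
  · exact (inTwoCycle_closed_iff d).1 h ((planted_spec hp).2 hd)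

/-- The root edge belongs to the tree and therefore has no parallel edge, so in a code of the rooted
map the first ternary tree is a leaf. -/
theorem exists_decorated {n : ℕ} {q : Quotient TreeDecorated.isoSetoid}
    (hq : q ∈ hierarchicalFamily n) : ∃ b c p, ∃ hp : p ∈ treePairs b c,
      b.size + c.size + 2 = n ∧ Quotient.mk TreeDecorated.isoSetoid (decorated b c p hp) = q := by
  obtain ⟨t, rfl, hV, hH, hT⟩ := hq
  obtain ⟨a, b, c, f, hf, hr⟩ := coded_of_isHierarchical hH t.root
  have hI : ∀ d ∈ t.tree, f d ∈ closedIsolated a b c := fun d hd => by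
    by_contra h
    exact hT d hd (hf.inTwoCycle_iff.1 ((inTwoCycle_closed_iff _).2 h))
  obtain rfl : a = leaf := eq_leaf_of_root_isolated (hr ▸ hI _ t.root_mem)
  have : Nonempty t.map.Dart := ⟨t.root⟩
  have hS := hf.isSpanningTree t.spanning
  have hroot : root leaf b c ∈ f '' t.tree := ⟨_, t.root_mem, hr⟩
  have hsub : f '' t.tree ⊆ closedIsolated leaf b c := by
    rintro _ ⟨d, hd, rfl⟩
    exact hI d hd
  obtain ⟨hA, hp⟩ := (isSpanningTree_closed_iff (T := f '' t.tree) hroot).1 ⟨hS, hsub⟩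
  refine ⟨b, c, (inB ⁻¹' (f '' t.tree), inC ⁻¹' (f '' t.tree)), hp, ?_, ?_⟩
  · have := hf.numVertices_eq
    rw [hV, numVertices_closed, show leaf.size = 0 from rfl] at this
    omega
  · refine Quotient.sound (s := TreeDecorated.isoSetoid) (Setoid.symm ?_)
    refine ⟨f, hf.1, hf.2, hr, fun d => ?_⟩
    have key : ∀ x, x ∈ planted (inB ⁻¹' (f '' t.tree), inC ⁻¹' (f '' t.tree)) ↔ x ∈ f '' t.tree := by
      rintro (x | x | x | x)
      · exact iff_of_true trivial ((Set.ext_iff.1 hA x).2 trivial)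
      · exact Iff.rfl
      · exact Iff.rfl
      · exact x.elim
    exact (key _).trans (f.injective.mem_set_image)

/-- The codes of the decorated triangulations whose regions other than the root edge are coded by
the ternary trees in a given set of pairs. -/
noncomputable def codes (S : Finset (Tern × Tern)) :
    Finset (Σ q : Tern × Tern, Set q.1.reg.Dart × Set q.2.reg.Dart) :=
  S.sigma fun q => (treePairs q.1 q.2).toFinite.toFinset

theorem mem_codes {S : Finset (Tern × Tern)} {b c : Tern} {p : Set b.reg.Dart × Set c.reg.Dart} :
    (⟨(b, c), p⟩ : Σ q : Tern × Tern, Set q.1.reg.Dart × Set q.2.reg.Dart) ∈ codes S ↔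
      (b, c) ∈ S ∧ p ∈ treePairs b c := by
  unfold codes
  rw [Finset.mem_sigma, Set.Finite.mem_toFinset]

theorem hierarchicalFamily_eq_empty {n : ℕ} (h : n < 2) : hierarchicalFamily n = ∅ :=
  Set.eq_empty_of_forall_notMem fun _ hq => by
    obtain ⟨b, c, p, hp, rfl, -⟩ := exists_decorated hq
    omega

section

variable {n : ℕ} {S : Finset (Tern × Tern)}
  (hS : ∀ q : Tern × Tern, q ∈ S ↔ q.1.size + q.2.size = n)
include hS

theorem exists_bijOn_codes :
    ∃ F : (Σ q : Tern × Tern, Set q.1.reg.Dart × Set q.2.reg.Dart) →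
      Quotient TreeDecorated.isoSetoid, Set.BijOn F (codes S) (hierarchicalFamily (n + 2)) := by
  classical
  -- A default value for pairs outside `treePairs`, never taken on `codes S`.
  have q0 : Quotient TreeDecorated.isoSetoid := Quotient.mk _ (decorated leaf leaf (Set.univ, ∅)
    ⟨true, Or.inr ⟨rfl, rfl, rfl⟩, Or.inl ⟨rfl, rfl⟩⟩)
  let F : (Σ q : Tern × Tern, Set q.1.reg.Dart × Set q.2.reg.Dart) →
      Quotient TreeDecorated.isoSetoid := fun x =>
    if hp : x.2 ∈ treePairs x.1.1 x.1.2 then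
      Quotient.mk TreeDecorated.isoSetoid (decorated x.1.1 x.1.2 x.2 hp) else q0
  have hF : ∀ {b c p} (hp : p ∈ treePairs b c), F ⟨(b, c), p⟩ =
      Quotient.mk TreeDecorated.isoSetoid (decorated b c p hp) := fun hp => dif_pos hp
  refine ⟨F, ?_, ?_, ?_⟩
  · rintro ⟨⟨b, c⟩, p⟩ h
    obtain ⟨h, hp⟩ := mem_codes.1 h
    rw [hF hp, ← (hS _).1 h]
    exact mk_decorated_mem b c p hp
  · rintro ⟨⟨b, c⟩, p⟩ h ⟨⟨b', c'⟩, p'⟩ h' e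
    obtain ⟨h, hp⟩ := mem_codes.1 h
    obtain ⟨h', hp'⟩ := mem_codes.1 h'
    rw [hF hp, hF hp'] at e
    exact eq_of_decorated_iso (Quotient.exact (s := TreeDecorated.isoSetoid) e)
  · intro q hq
    obtain ⟨b, c, p, hp, h, rfl⟩ := exists_decorated hq
    exact ⟨⟨(b, c), p⟩, mem_codes.2 ⟨(hS _).2 (by simpa using h), hp⟩, hF hp⟩

theorem finite_hierarchicalFamily : (hierarchicalFamily (n + 2)).Finite := by
  obtain ⟨F, hF⟩ := exists_bijOn_codes hS
  rw [← hF.image_eq]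
  exact (Finset.finite_toSet _).image F

theorem ncard_hierarchicalFamily : (hierarchicalFamily (n + 2)).ncard =
    ∑ q ∈ S, (numStates true true q.1 * numStates true false q.2 +
      numStates true false q.1 * numStates true true q.2) := by
  obtain ⟨F, hF⟩ := exists_bijOn_codes hS
  rw [← hF.image_eq, hF.injOn.ncard_image, Set.ncard_coe_finset, codes,
    Finset.card_sigma]
  refine Finset.sum_congr rfl fun q _ => ?_
  rw [← ncard_treePairs, Set.ncard_eq_toFinset_card]

end

end Tern

/-! ### Generating functions -/

/-- The generating function of a weight on a type of objects that have a size. -/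
noncomputable def genFun {α : Type} (size : α → ℕ) (w : α → ℝ) : PowerSeries ℝ :=
  PowerSeries.mk fun n => ∑ᶠ (a) (_ : size a = n), w a

theorem coeff_genFun {α : Type} {size : α → ℕ} {n : ℕ} {S : Finset α}
    (hS : ∀ a, a ∈ S ↔ size a = n) (w : α → ℝ) :
    PowerSeries.coeff n (genFun size w) = ∑ a ∈ S, w a := by
  rw [genFun, PowerSeries.coeff_mk, ← finsum_mem_coe_finset]
  simp only [Finset.mem_coe, hS]

theorem coeff_genFun_of_finite {α : Type} {size : α → ℕ} (h : ∀ n, {a | size a = n}.Finite)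
    (n : ℕ) (w : α → ℝ) :
    PowerSeries.coeff n (genFun size w) = ∑ a ∈ (h n).toFinset, w a :=
  coeff_genFun (fun _ => (h n).mem_toFinset) w

section

variable {α β : Type} {size : α → ℕ} {size' : β → ℕ}
  (hα : ∀ n, {a | size a = n}.Finite) (hβ : ∀ n, {b | size' b = n}.Finite)
include hα

theorem genFun_add (w w' : α → ℝ) :
    genFun size (fun a => w a + w' a) = genFun size w + genFun size w' := by
  ext n
  rw [map_add, coeff_genFun_of_finite hα, coeff_genFun_of_finite hα, coeff_genFun_of_finite hα,
    Finset.sum_add_distrib]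

include hβ

/-- The finite set of pairs of a given total size. -/
theorem exists_finset_pairs (n : ℕ) : ∃ S : Finset (α × β), (∀ q, q ∈ S ↔ size q.1 + size' q.2 = n) ∧
    ∀ w : α × β → ℝ, ∑ q ∈ S, w q = ∑ p ∈ Finset.HasAntidiagonal.antidiagonal n, ∑ a ∈ (hα p.1).toFinset,
      ∑ b ∈ (hβ p.2).toFinset, w (a, b) := by
  classical
  refine ⟨(Finset.HasAntidiagonal.antidiagonal n).biUnion fun p => (hα p.1).toFinset ×ˢ (hβ p.2).toFinset,
    fun q => ?_, fun w => ?_⟩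
  · rw [Finset.mem_biUnion]
    constructor
    · rintro ⟨p, hp, hq⟩
      rw [Finset.mem_product, Set.Finite.mem_toFinset, Set.Finite.mem_toFinset] at hq
      rw [← Finset.HasAntidiagonal.mem_antidiagonal.1 hp]
      exact congrArg₂ _ hq.1 hq.2
    · intro h
      refine ⟨(size q.1, size' q.2), Finset.HasAntidiagonal.mem_antidiagonal.2 h, ?_⟩
      rw [Finset.mem_product, Set.Finite.mem_toFinset, Set.Finite.mem_toFinset]
      exact ⟨rfl, rfl⟩
  · rw [Finset.sum_biUnion]
    · exact Finset.sum_congr rfl fun p _ => Finset.sum_product _ _ _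
    · intro p _ p' _ hne
      refine Finset.disjoint_left.2 fun q hq hq' => hne ?_
      rw [Finset.mem_product, Set.Finite.mem_toFinset, Set.Finite.mem_toFinset] at hq hq'
      exact Prod.ext (hq.1.symm.trans hq'.1) (hq.2.symm.trans hq'.2)

theorem finite_pairs (n : ℕ) : {q : α × β | size q.1 + size' q.2 = n}.Finite := by
  obtain ⟨S, hS, -⟩ := exists_finset_pairs hα hβ n
  exact S.finite_toSet.subset fun q hq => (hS q).2 hq

theorem genFun_prod (w : α → ℝ) (w' : β → ℝ) :
    genFun (fun q : α × β => size q.1 + size' q.2) (fun q => w q.1 * w' q.2) =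
      genFun size w * genFun size' w' := by
  ext n
  obtain ⟨S, hS, hsum⟩ := exists_finset_pairs hα hβ n
  rw [coeff_genFun hS, hsum, PowerSeries.coeff_mul]
  refine Finset.sum_congr rfl fun p _ => ?_
  rw [coeff_genFun_of_finite hα, coeff_genFun_of_finite hβ, Finset.sum_mul_sum]

end

namespace Tern

theorem finite_size_le (n : ℕ) : {g : Tern | g.size ≤ n}.Finite := by
  induction n with
  | zero =>
    refine (Set.finite_singleton leaf).subset fun g hg => ?_
    cases g with
    | leaf => rfl
    | node a b c => exact absurd hg (by simp [size])
  | succ n ih =>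
    refine ((Set.finite_singleton leaf).union
      ((ih.prod (ih.prod ih)).image fun q => node q.1 q.2.1 q.2.2)).subset fun g hg => ?_
    cases g with
    | leaf => exact Or.inl rfl
    | node a b c =>
      have h : a.size + b.size + c.size + 1 ≤ n + 1 := hg
      have ha : a.size ≤ n := by omega
      have hb : b.size ≤ n := by omega
      have hc : c.size ≤ n := by omega
      exact Or.inr ⟨(a, b, c), ⟨ha, hb, hc⟩, rfl⟩

theorem finite_size_eq (n : ℕ) : {g : Tern | g.size = n}.Finite :=
  (finite_size_le n).subset fun _ h => le_of_eq h

/-- A ternary tree is a leaf, of size 0, or a node over a triple of trees; the node itself accounts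
for the factor `X`. -/
theorem genFun_size (w : Tern → ℝ) : genFun size w = PowerSeries.C (w leaf) + PowerSeries.X *
    genFun (fun q : Tern × Tern × Tern => q.1.size + (q.2.1.size + q.2.2.size))
      (fun q => w (node q.1 q.2.1 q.2.2)) := by
  ext n
  rw [map_add, PowerSeries.coeff_C]
  cases n with
  | zero =>
    rw [PowerSeries.coeff_zero_X_mul, if_pos rfl, add_zero, coeff_genFun (S := {leaf}),
      Finset.sum_singleton]
    intro g
    cases g <;> simp [size]
  | succ n =>
    rw [PowerSeries.coeff_succ_X_mul, if_neg (Nat.succ_ne_zero n), zero_add]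
    have hfin := finite_pairs finite_size_eq (finite_pairs finite_size_eq finite_size_eq) n
    have hinj : Set.InjOn (fun q : Tern × Tern × Tern => node q.1 q.2.1 q.2.2) hfin.toFinset := by
      rintro ⟨a, b, c⟩ - ⟨a', b', c'⟩ - h
      injection h with h1 h2 h3
      exact Prod.ext h1 (Prod.ext h2 h3)
    classical
    rw [coeff_genFun (fun q => hfin.mem_toFinset),
      coeff_genFun (S := hfin.toFinset.image fun q => node q.1 q.2.1 q.2.2), Finset.sum_image hinj]
    intro g
    rw [Finset.mem_image]
    constructor
    · rintro ⟨q, hq, rfl⟩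
      have := hfin.mem_toFinset.1 hq
      change q.1.size + (q.2.1.size + q.2.2.size) = n at this
      rw [size]
      omega
    · intro h
      cases g with
      | leaf => exact absurd h (by simp [size])
      | node a b c =>
        refine ⟨(a, b, c), hfin.mem_toFinset.2 ?_, rfl⟩
        change a.size + (b.size + c.size) = n
        rw [size] at h
        omega

theorem genFun_triple (w w' w'' : Tern → ℝ) :
    genFun (fun q : Tern × Tern × Tern => q.1.size + (q.2.1.size + q.2.2.size))
      (fun q => w q.1 * (w' q.2.1 * w'' q.2.2)) = genFun size w * (genFun size w' * genFun size w'') := by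
  rw [← genFun_prod finite_size_eq finite_size_eq]
  exact genFun_prod finite_size_eq (finite_pairs finite_size_eq finite_size_eq) w
    (fun q => w' q.1 * w'' q.2)

/-- The generating function of admissible edge sets in regions. -/
noncomputable def stateSeries (s k : Bool) : PowerSeries ℝ :=
  genFun size fun g => (numStates s k g : ℝ)

theorem stateSeries_false (s : Bool) : stateSeries s false = 1 + PowerSeries.X *
    (stateSeries false false * (stateSeries true true * stateSeries true false) +
     stateSeries false false * (stateSeries true false * stateSeries true true)) := by
  have hfin := finite_pairs finite_size_eq (finite_pairs finite_size_eq finite_size_eq)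
  unfold stateSeries
  rw [genFun_size, numStates_leaf_false, Nat.cast_one, map_one, ← genFun_triple, ← genFun_triple,
    ← genFun_add hfin]
  simp only [numStates_node_false, Nat.cast_add, Nat.cast_mul]

theorem stateSeries_true (s : Bool) :
    stateSeries s true = PowerSeries.C (numStates s true leaf : ℝ) + PowerSeries.X *
    (stateSeries false true * (stateSeries true true * stateSeries true false) +
     stateSeries false true * (stateSeries true false * stateSeries true true) +
     stateSeries false false * (stateSeries true true * stateSeries true true)) := by
  have hfin := finite_pairs finite_size_eq (finite_pairs finite_size_eq finite_size_eq)
  unfold stateSeries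
  rw [genFun_size, ← genFun_triple, ← genFun_triple, ← genFun_triple,
    ← genFun_add hfin, ← genFun_add hfin]
  simp only [numStates_node_true, Nat.cast_add, Nat.cast_mul]

theorem finite_hierarchicalFamily_all (n : ℕ) : (hierarchicalFamily n).Finite := by
  rcases lt_or_ge n 2 with h | h
  · rw [hierarchicalFamily_eq_empty h]
    exact Set.finite_empty
  · obtain ⟨n, rfl⟩ := Nat.exists_eq_add_of_le' h
    obtain ⟨S, hS, -⟩ := exists_finset_pairs finite_size_eq finite_size_eq n
    exact finite_hierarchicalFamily hS

/-- Two ternary trees of total size `n` give a member of `hierarchicalFamily (n + 2)`, whose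
exponent is `n + 1`; hence the factor `X`. The two products correspond to the region that is
connected. -/
theorem hierarchicalSeries_eq : hierarchicalSeries = PowerSeries.X *
    (stateSeries true true * stateSeries true false +
      stateSeries true false * stateSeries true true) := by
  unfold stateSeries
  rw [← genFun_prod finite_size_eq finite_size_eq, ← genFun_prod finite_size_eq finite_size_eq,
    ← genFun_add (finite_pairs finite_size_eq finite_size_eq)]
  ext n
  rw [hierarchicalSeries, PowerSeries.coeff_mk]
  cases n with
  | zero =>
    rw [PowerSeries.coeff_zero_X_mul, hierarchicalFamily_eq_empty (by norm_num), Set.ncard_empty,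
      Nat.cast_zero]
  | succ n =>
    obtain ⟨S, hS, -⟩ := exists_finset_pairs finite_size_eq finite_size_eq n
    rw [PowerSeries.coeff_succ_X_mul, coeff_genFun hS, ncard_hierarchicalFamily hS]
    push_cast
    rfl

open PowerSeries in
/-- The quadratic equation for the generating function. -/
theorem two_mul_hierarchicalSeries :
    2 * hierarchicalSeries - 3 * hierarchicalSeries ^ 2 = 4 * (X : PowerSeries ℝ) := by
  have hH := hierarchicalSeries_eq
  have h1 := stateSeries_false true
  have h2 := stateSeries_false false
  have h3 := stateSeries_true true
  have h4 := stateSeries_true false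
  rw [numStates_leaf_true, Nat.cast_one, map_one] at h3
  rw [numStates_leaf_false_true, Nat.cast_zero, map_zero, zero_add] at h4
  -- The flag matters only for the single edge, whose edge may be used in one case and not in the
  -- other; for forests it does not matter at all (`h6`).
  have h5 : stateSeries false true = stateSeries true true - 1 := by
    linear_combination h4 - h3
  have h6 : stateSeries true false = stateSeries false false := h1.trans h2.symm
  rw [h6] at hH h1 h3
  rw [h5] at h3
  generalize hierarchicalSeries = H at *
  generalize stateSeries true true = K at *
  generalize stateSeries false false = D at *
  -- With `H = 2 X K D` from `hH`, the recursions become linear in `D` and in `K` over the series in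
  -- `H`.
  have hD : D * (1 - H) = 1 := by linear_combination h1 - D * hH
  have hK : K * (2 - 3 * H) = 2 * (1 - H) := by linear_combination 2 * h3 - (3 * K - 2) * hH
  linear_combination (2 - 3 * H) * hH + 2 * X * D * hK + 4 * X * hD

end Tern

/-! ### Solution by the Catalan series -/

open PowerSeries in
theorem constantCoeff_hierarchicalSeries : constantCoeff hierarchicalSeries = 0 := by
  rw [Tern.hierarchicalSeries_eq, map_mul, constantCoeff_X, zero_mul]

open PowerSeries in
/-- A power series without constant term is determined by the quadratic equation. -/
theorem eq_of_quadratic {F G : PowerSeries ℝ} (hF : constantCoeff F = 0) (hG : constantCoeff G = 0)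
    (h : 2 * F - 3 * F ^ 2 = 2 * G - 3 * G ^ 2) : F = G := by
  have h' : (F - G) * (2 - 3 * (F + G)) = 0 := by linear_combination h
  rcases mul_eq_zero.1 h' with h' | h'
  · exact sub_eq_zero.1 h'
  -- The second factor has constant term 2 and cannot vanish.
  · have := congrArg (constantCoeff (R := ℝ)) h'
    rw [map_sub, map_mul, map_add, hF, hG, map_ofNat, map_zero] at this
    norm_num at this

open PowerSeries in
-- For the Catalan series `c = 1 + X c ^ 2`, the series `2 X c(3 X)` solves the same quadratic
-- equation.
theorem hierarchicalSeries_eq_catalan :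
    hierarchicalSeries = X * (2 * rescale (3 : ℝ) (map (Nat.castRingHom ℝ) catalanSeries)) := by
  have h := congrArg (fun F => rescale (3 : ℝ) (map (Nat.castRingHom ℝ) F))
    catalanSeries_sq_mul_X_add_one
  simp only [map_add, map_mul, map_pow, map_X, map_one, rescale_X] at h
  rw [show C (3 : ℝ) = 3 from map_ofNat C 3] at h
  refine eq_of_quadratic constantCoeff_hierarchicalSeries (by simp) ?_
  rw [Tern.two_mul_hierarchicalSeries]
  linear_combination (4 * X) * h

theorem ncard_hierarchicalFamily_eq (m : ℕ) :
    (hierarchicalFamily (m + 2)).ncard = 2 * 3 ^ m * catalan m := by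
  have h := congrArg (PowerSeries.coeff (m + 1)) hierarchicalSeries_eq_catalan
  rw [PowerSeries.coeff_succ_X_mul, hierarchicalSeries, PowerSeries.coeff_mk,
    show (2 : PowerSeries ℝ) = PowerSeries.C (2 : ℝ) from (map_ofNat PowerSeries.C 2).symm,
    PowerSeries.coeff_C_mul, PowerSeries.coeff_rescale, PowerSeries.coeff_map,
    PowerSeries.catalanSeries_coeff] at h
  have h' : ((hierarchicalFamily (m + 2)).ncard : ℝ) = ((2 * 3 ^ m * catalan m : ℕ) : ℝ) := by
    push_cast
    rw [h, mul_assoc]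
    rfl
  exact_mod_cast h'

/-! ### Asymptotics -/

open Real in
theorem centralBinom_isEquivalent :
    (fun m : ℕ => (m.centralBinom : ℝ)) ~[atTop] fun m : ℕ => 4 ^ m / (√π * √m) := by
  have h1 := Stirling.factorial_isEquivalent_stirling
  have h2 : (fun m : ℕ => ((2 * m).factorial : ℝ)) ~[atTop] fun m : ℕ =>
      √(2 * (2 * m : ℕ) * π) * ((2 * m : ℕ) / exp 1) ^ (2 * m) :=
    h1.comp_tendsto (tendsto_id.const_mul_atTop' two_pos)
  refine ((h2.div (h1.mul h1)).congr_left ?_).congr_right ?_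
  · filter_upwards with m
    change ((2 * m).factorial : ℝ) / (m.factorial * m.factorial) = _
    rw [Nat.centralBinom_eq_two_mul_choose, Nat.cast_choose ℝ (by omega : m ≤ 2 * m),
      show 2 * m - m = m by omega]
  · filter_upwards [eventually_gt_atTop 0] with m hm
    have hm' : (0 : ℝ) < m := by exact_mod_cast hm
    change √(2 * (2 * m : ℕ) * π) * ((2 * m : ℕ) / exp 1) ^ (2 * m) /
      ((√(2 * m * π) * (m / exp 1) ^ m) * (√(2 * m * π) * (m / exp 1) ^ m)) = _
    have e1 : √(2 * (2 * m : ℕ) * π) = 2 * (√m * √π) := by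
      push_cast
      rw [← Real.sqrt_mul hm'.le, show (2 : ℝ) * (2 * m) * π = 2 ^ 2 * (m * π) by ring,
        Real.sqrt_mul (by norm_num), Real.sqrt_sq (by norm_num)]
    have e2 : √(2 * m * π) * √(2 * m * π) = 2 * (m * π) := by
      rw [Real.mul_self_sqrt (by positivity)]; ring
    have e3 : (((2 * m : ℕ) : ℝ) / exp 1) ^ (2 * m) = 4 ^ m * ((m / exp 1) ^ m * (m / exp 1) ^ m) := by
      push_cast
      rw [mul_div_assoc, mul_pow, pow_mul, ← pow_add, two_mul m]
      norm_num
    have e4 : (m : ℝ) = √m * √m := (Real.mul_self_sqrt hm'.le).symm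
    have e5 : π = √π * √π := (Real.mul_self_sqrt pi_pos.le).symm
    have p1 : 0 < √(m : ℝ) := Real.sqrt_pos.2 hm'
    have p2 : 0 < √π := Real.sqrt_pos.2 pi_pos
    have p3 : 0 < ((m : ℝ) / exp 1) ^ m := by positivity
    rw [mul_mul_mul_comm, e2, e1, e3]
    generalize ((m : ℝ) / exp 1) ^ m = x at *
    have : 2 * ((m : ℝ) * π) = 2 * ((√m * √m) * (√π * √π)) := by rw [← e4, ← e5]
    rw [this]
    field_simp

theorem add_isEquivalent (k : ℕ) : (fun m : ℕ => ((m + k : ℕ) : ℝ)) ~[atTop] fun m : ℕ => (m : ℝ) := by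
  have h : (fun _ : ℕ => (k : ℝ)) =o[atTop] fun m : ℕ => (m : ℝ) :=
    isLittleO_const_left.2 (Or.inr (tendsto_norm_atTop_atTop.comp tendsto_natCast_atTop_atTop))
  refine (IsEquivalent.refl.add_isLittleO h).congr_left ?_
  filter_upwards with m
  simp

/-- The square root is continuous at 1, the limit of the quotient. -/
theorem sqrt_add_isEquivalent (k : ℕ) :
    (fun m : ℕ => √((m + k : ℕ) : ℝ)) ~[atTop] fun m : ℕ => √(m : ℝ) := by
  have hne : ∀ᶠ m : ℕ in atTop, (m : ℝ) ≠ 0 := by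
    filter_upwards [eventually_gt_atTop 0] with m hm
    exact_mod_cast hm.ne'
  have h := (isEquivalent_iff_tendsto_one hne).1 (add_isEquivalent k)
  refine isEquivalent_of_tendsto_one ?_
  have h' := (Real.continuous_sqrt.tendsto 1).comp h
  rw [Real.sqrt_one] at h'
  refine h'.congr fun m => ?_
  exact Real.sqrt_div (Nat.cast_nonneg _) _

/-- The Catalan number is the central binomial coefficient over `m + 1`, hence equivalent to `4 ^ m
/ (√π m ^ (3/2))`, and `2 * 3 ^ m * 4 ^ m = 12 ^ (m + 2) / 72`. Finally `m` is replaced by `m + 2`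
in the power. -/
theorem ncard_hierarchicalFamily_isEquivalent :
    (fun m : ℕ => ((hierarchicalFamily (m + 2)).ncard : ℝ)) ~[atTop] fun m : ℕ =>
      12 ^ (m + 2) / (72 * √Real.pi * ((m + 2 : ℕ) : ℝ) ^ (3 / 2 : ℝ)) := by
  have h1 := (centralBinom_isEquivalent.div (add_isEquivalent 1))
  have h2 := (IsEquivalent.refl (u := fun m : ℕ => (2 * 3 ^ m : ℝ)) (l := atTop)).mul h1
  have h3 := (IsEquivalent.refl (u := fun m : ℕ => (12 ^ (m + 2) / (72 * √Real.pi) : ℝ))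
    (l := atTop)).div ((add_isEquivalent 2).mul (sqrt_add_isEquivalent 2))
  refine ((h2.congr_left ?_).trans (h3.symm.congr_left ?_)).congr_right ?_
  · filter_upwards with m
    have hc : ((m + 1 : ℕ) : ℝ) * catalan m = m.centralBinom := by
      exact_mod_cast succ_mul_catalan_eq_centralBinom m
    have hm : ((m + 1 : ℕ) : ℝ) ≠ 0 := Nat.cast_ne_zero.2 (Nat.succ_ne_zero m)
    change 2 * 3 ^ m * ((m.centralBinom : ℝ) / ((m + 1 : ℕ) : ℝ)) = _
    rw [ncard_hierarchicalFamily_eq, ← hc, mul_div_cancel_left₀ _ hm]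
    push_cast
    rfl
  · filter_upwards with m
    change 12 ^ (m + 2) / (72 * √Real.pi) / ((m : ℝ) * √m) =
      2 * 3 ^ m * (4 ^ m / (√Real.pi * √m) / m)
    rw [show (12 : ℝ) ^ (m + 2) = 144 * (3 ^ m * 4 ^ m) by rw [← mul_pow]; norm_num; ring]
    ring
  · filter_upwards with m
    change 12 ^ (m + 2) / (72 * √Real.pi) / (((m + 2 : ℕ) : ℝ) * √((m + 2 : ℕ) : ℝ)) = _
    rw [div_div, show (3 / 2 : ℝ) = 1 + 1 / 2 by norm_num,
      Real.rpow_add (by positivity), Real.rpow_one, ← Real.sqrt_eq_rpow]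

theorem mainTheorem8 :
    -- every family is finite, so that the cardinalities below are genuine
    (∀ n : ℕ, (hierarchicalFamily n).Finite) ∧
    -- generating function `(1 - √(1 - 12 z)) / 3`, with `S` the power series `√(1 - 12 z)`
    (∃ S : PowerSeries ℝ, PowerSeries.constantCoeff S = 1 ∧
      S ^ 2 = 1 - 12 * PowerSeries.X ∧
      hierarchicalSeries = PowerSeries.C (1 / 3 : ℝ) * (1 - S)) ∧
    -- its first terms `2 z + 6 z ^ 2 + 36 z ^ 3`
    (PowerSeries.coeff 0 hierarchicalSeries = 0 ∧ PowerSeries.coeff 1 hierarchicalSeries = 2 ∧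
      PowerSeries.coeff 2 hierarchicalSeries = 6 ∧ PowerSeries.coeff 3 hierarchicalSeries = 36) ∧
    -- exact enumeration
    (∀ n : ℕ, 2 ≤ n → (hierarchicalFamily n).ncard = 2 * 3 ^ (n - 2) * catalan (n - 2)) ∧
    -- asymptotics
    (fun n : ℕ => ((hierarchicalFamily n).ncard : ℝ)) ~[atTop]
      (fun n : ℕ => 12 ^ n / (72 * Real.sqrt Real.pi * (n : ℝ) ^ (3 / 2 : ℝ))) := by
  have hcoeff : ∀ m, PowerSeries.coeff (m + 1) hierarchicalSeries =
      ((2 * 3 ^ m * catalan m : ℕ) : ℝ) := fun m => by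
    rw [hierarchicalSeries, PowerSeries.coeff_mk, ← ncard_hierarchicalFamily_eq]
  -- Completing the square in `2 H - 3 H ^ 2 = 4 X` gives `(1 - 3 H) ^ 2 = 1 - 12 X`.
  refine ⟨Tern.finite_hierarchicalFamily_all, ⟨1 - 3 * hierarchicalSeries, ?_, ?_, ?_⟩,
    ⟨?_, ?_, ?_, ?_⟩, ?_, ?_⟩
  · simp [constantCoeff_hierarchicalSeries]
  · linear_combination -3 * Tern.two_mul_hierarchicalSeries
  · have h : PowerSeries.C (1 / 3 : ℝ) * 3 = 1 := by
      rw [← map_ofNat PowerSeries.C 3, ← map_mul]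
      norm_num
    linear_combination (-hierarchicalSeries) * h
  · rw [PowerSeries.coeff_zero_eq_constantCoeff_apply, constantCoeff_hierarchicalSeries]
  · rw [hcoeff, catalan_zero]; norm_num
  · rw [hcoeff, catalan_one]; norm_num
  · rw [hcoeff, catalan_two]; norm_num
  · intro n hn
    obtain ⟨m, rfl⟩ := Nat.exists_eq_add_of_le' hn
    exact ncard_hierarchicalFamily_eq m
  · have h := ncard_hierarchicalFamily_isEquivalent.comp_tendsto (tendsto_sub_atTop_nat 2)
    have e : ∀ᶠ n : ℕ in atTop, n - 2 + 2 = n := by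
      filter_upwards [eventually_ge_atTop 2] with n hn
      exact Nat.sub_add_cancel hn
    refine (h.congr_left ?_).congr_right ?_ <;> filter_upwards [e] with n hn <;>
      simp only [Function.comp_apply, hn]
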